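/- Let $b\in\mathbb{R}\setminus\{0\}$, and write $x=(x_1,x_2,x_3)$ for points of $\mathbb{R}^3=\mathbb{R}^2\times\mathbb{R}$. Let $\mathbf{L}=-\partial_{x_1}^2+(-\mathrm{i}\partial_{x_2}+bx_1)^2$ be the (self-adjoint) Landau operator on $L^2(\mathbb{R}^2)$, and let $\mathbf{P}_n$ be the orthogonal projector of $L^2(\mathbb{R}^2)$ onto the $n$-th Landau level $\ker(\mathbf{L}-|b|(2n+1))$, $n=0,1,2,\dots$ For $R=(R_1,R_2)\in\mathbb{R}^2$ let $\mathfrak{m}_R$ be the magnetic translation on $L^2(\mathbb{R}^3)$, $$(\mathfrak{m}_Rf)(x)=\mathrm{e}^{-\mathrm{i}bR_1x_2}\,f(x_1-R_1,x_2-R_2,x_3).$$ Let $\gamma$ be a bounded operator on $L^2(\mathbb{R}^3)=L^2(\mathbb{R}^2)\otimes L^2(\mathbb{R})$ that commutes with $\mathfrak{m}_R$ for every $R\in\mathbb{R}^2$ and with $\mathbf{L}\otimes\mathbb{I}$ (that is, $\gamma$ maps the domain of $\mathbf{L}\otimes\mathbb{I}$ into itself and $(\mathbf{L}\otimes\mathbb{I})\gamma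 f=\gamma(\mathbf{L}\otimes\mathbb{I})f$ on this domain). Then there is a family $(\gamma_n)_{n\ge 0}$ of bounded operators on $L^2(\mathbb{R})$ with $\|\gamma_n\|\le\|\gamma\|$ for all $n$ and $$\gamma=\sum_{n=0}^\infty \mathbf{P}_n\otimes\gamma_n ,$$ where the series converges strongly. Moreover, this family has the following properties. An operator $T$ on $L^2(\mathbb{R}^d)$ is called locally trace class if $\mathbf{1}_KT\mathbf{1}_K$ is trace class for every compact $K\subset\mathbb{R}^d$; its density $\rho_T$ is the locally integrable function such that $\mathrm{Tr}(\mathbf{1}_KT\mathbf{1}_K)=\int_K\rho_T$ for every compact $K$. 1. If $\gamma$ is locally trace class, then $\gamma$ has a density, and this density depends only on $x_3$: $\rho_\gamma(x)=\rho_\gamma(x_3)$. 2. If, in addition, $\gamma\ge 0$, then every $\gamma_n$ is locally trace class and has a density $\rho_{\gamma_n}$, and for almost every $x_3\in\mathbb{R}$ $$\rho_\gamma(x_3)=\frac{|b|}{2\pi}\sum_{n=0}^\infty\rho_{\gamma_n}(x_3),$$ where the series converges. -/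

import Mathlib

open MeasureTheory
open scoped ENNReal ContDiff InnerProductSpace

noncomputable section

namespace MagneticSlab

/-- The complex Hilbert space `L²(X)` for the Lebesgue measure on `X`. -/
abbrev L2 (X : Type) [MeasureSpace X] : Type := Lp ℂ 2 (volume : Measure X)

/-- The plane of the first two coordinates `(x₁, x₂)`. -/
abbrev Plane : Type := ℝ × ℝ

/-- Three-dimensional space `ℝ³ = ℝ² × ℝ`; the point `x` has coordinates
`x₁ = x.1.1`, `x₂ = x.1.2`, `x₃ = x.2`, and `volume` is the Lebesgue measure. -/
abbrev Space : Type := Plane × ℝ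

/-! ### Multiplication operators and magnetic translations -/

theorem norm_indicator_one_le {X : Type} (K : Set X) (x : X) :
    ‖K.indicator (fun _ => (1 : ℂ)) x‖ ≤ 1 := by
  by_cases h : x ∈ K <;> simp [h]

section Multiplication

variable {X : Type} [MeasureSpace X]

theorem memLp_mul (m : X → ℂ) (hm : Measurable m) (hb : ∀ x, ‖m x‖ ≤ 1) (f : L2 X) :
    MemLp (fun x => m x * f x) 2 (volume : Measure X) := by
  refine (Lp.memLp f).mono (hm.aestronglyMeasurable.mul (Lp.aestronglyMeasurable f)) ?_
  refine Filter.Eventually.of_forall fun x => ?_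
  simpa [norm_mul] using mul_le_mul_of_nonneg_right (hb x) (norm_nonneg (f x))

/-- Multiplication by a measurable function bounded by `1`, as a bounded operator on `L²(X)`. -/
def mulOp (m : X → ℂ) (hm : Measurable m) (hb : ∀ x, ‖m x‖ ≤ 1) : L2 X →L[ℂ] L2 X :=
  LinearMap.mkContinuous
    { toFun := fun f => (memLp_mul m hm hb f).toLp
      map_add' := by
        intro f g
        refine Lp.ext ?_
        filter_upwards [MemLp.coeFn_toLp (memLp_mul m hm hb (f + g)),
          MemLp.coeFn_toLp (memLp_mul m hm hb f), MemLp.coeFn_toLp (memLp_mul m hm hb g),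
          Lp.coeFn_add f g, Lp.coeFn_add (memLp_mul m hm hb f).toLp (memLp_mul m hm hb g).toLp]
          with x h1 h2 h3 h4 h5
        rw [h1, h5, Pi.add_apply, h2, h3, h4, Pi.add_apply, mul_add]
      map_smul' := by
        intro c f
        refine Lp.ext ?_
        filter_upwards [MemLp.coeFn_toLp (memLp_mul m hm hb (c • f)),
          MemLp.coeFn_toLp (memLp_mul m hm hb f),
          Lp.coeFn_smul c f, Lp.coeFn_smul c (memLp_mul m hm hb f).toLp]
          with x h1 h2 h3 h4
        rw [RingHom.id_apply, h1, h4, Pi.smul_apply, h2, h3, Pi.smul_apply, smul_eq_mul,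
          smul_eq_mul]
        ring }
    1 (by
      intro f
      rw [one_mul]
      refine Lp.norm_le_norm_of_ae_le ?_
      filter_upwards [MemLp.coeFn_toLp (memLp_mul m hm hb f)] with x h1
      simp only [LinearMap.coe_mk, AddHom.coe_mk]
      rw [h1, norm_mul]
      exact mul_le_of_le_one_left (norm_nonneg _) (hb x))

theorem mulOp_ae (m : X → ℂ) (hm : Measurable m) (hb : ∀ x, ‖m x‖ ≤ 1) (f : L2 X) :
    mulOp m hm hb f =ᵐ[volume] fun x => m x * f x :=
  MemLp.coeFn_toLp (memLp_mul m hm hb f)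

/-- The operator of multiplication by the indicator function of `K`. -/
def indicatorOp (K : Set X) (hK : MeasurableSet K) : L2 X →L[ℂ] L2 X :=
  mulOp (K.indicator fun _ => (1 : ℂ)) (measurable_const.indicator hK) (norm_indicator_one_le K)

end Multiplication

theorem measurePreserving_shift (R : Plane) :
    MeasurePreserving (fun x : Space => ((x.1.1 - R.1, x.1.2 - R.2), x.2)) volume volume := by
  have h (r : ℝ) : MeasurePreserving (fun t : ℝ => t - r) volume volume :=
    measurePreserving_sub_right volume r
  exact ((h R.1).prod (h R.2)).prod (MeasurePreserving.id (volume : Measure ℝ))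

/-- The translation `(τ_R f)(x) = f(x₁ - R₁, x₂ - R₂, x₃)` on `L²(ℝ³)`. -/
def translation (R : Plane) : L2 Space →L[ℂ] L2 Space :=
  (Lp.compMeasurePreservingₗᵢ ℂ _ (measurePreserving_shift R)).toContinuousLinearMap

theorem measurable_phase (b : ℝ) (R : Plane) :
    Measurable fun x : Space => Complex.exp (-(Complex.I * ((b * R.1 * x.1.2 : ℝ) : ℂ))) := by
  fun_prop

theorem norm_phase_le (b : ℝ) (R : Plane) (x : Space) :
    ‖Complex.exp (-(Complex.I * ((b * R.1 * x.1.2 : ℝ) : ℂ)))‖ ≤ 1 := by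
  simp [Complex.norm_exp]

/-- The magnetic translation `(𝔪_R f)(x) = exp(-i b R₁ x₂) f(x₁ - R₁, x₂ - R₂, x₃)` on `L²(ℝ³)`. -/
def magneticTranslation (b : ℝ) (R : Plane) : L2 Space →L[ℂ] L2 Space :=
  mulOp (fun x => Complex.exp (-(Complex.I * ((b * R.1 * x.1.2 : ℝ) : ℂ))))
    (measurable_phase b R) (norm_phase_le b R) ∘L translation R

theorem magneticTranslation_ae (b : ℝ) (R : Plane) (f : L2 Space) :
    magneticTranslation b R f =ᵐ[volume] fun x : Space =>
      Complex.exp (-(Complex.I * ((b * R.1 * x.1.2 : ℝ) : ℂ)))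
        * f ((x.1.1 - R.1, x.1.2 - R.2), x.2) := by
  filter_upwards [mulOp_ae _ (measurable_phase b R) (norm_phase_le b R) (translation R f),
    Lp.coeFn_compMeasurePreserving f (measurePreserving_shift R)] with x h1 h2
  exact h1.trans (congrArg _ h2)

/-! ### The Landau operator -/

/-- `p₁ = -i ∂₁`, as a differential expression in the plane. -/
def momentum₁ (φ : Plane → ℂ) (x : Plane) : ℂ :=
  -Complex.I * lineDeriv ℝ φ x (1, 0)

/-- `p₂ = -i ∂₂ + b x₁`, as a differential expression in the plane. -/
def momentum₂ (b : ℝ) (φ : Plane → ℂ) (x : Plane) : ℂ :=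
  -Complex.I * lineDeriv ℝ φ x (0, 1) + (b : ℂ) * (x.1 : ℂ) * φ x

/-- The Landau differential expression `p₁² + p₂² = -∂₁² + (-i∂₂ + b x₁)²` in the plane. -/
def landauExpr (b : ℝ) (φ : Plane → ℂ) (x : Plane) : ℂ :=
  momentum₁ (momentum₁ φ) x + momentum₂ b (momentum₂ b φ) x

/-- The Landau differential expression acting in the first two variables of `ℝ³`. -/
def landauExprSpace (b : ℝ) (φ : Space → ℂ) (x : Space) : ℂ :=
  landauExpr b (fun y => φ (y, x.2)) x.1

/-- `f` lies in the domain of the self-adjoint Landau operator on `L²(ℝ²)` and is mapped to `g`.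
The operator is the adjoint of the symmetric, essentially self-adjoint operator given by
`landauExpr` on smooth compactly supported functions: `⟨L φ, f⟩ = ⟨φ, g⟩` for all such `φ`. -/
def IsLandau (b : ℝ) (f g : L2 Plane) : Prop :=
  ∀ φ : Plane → ℂ, ContDiff ℝ ∞ φ → HasCompactSupport φ →
    ∫ x, starRingEnd ℂ (landauExpr b φ x) * f x = ∫ x, starRingEnd ℂ (φ x) * g x

/-- The same for the self-adjoint operator `L ⊗ 1` on `L²(ℝ³) = L²(ℝ²) ⊗ L²(ℝ)`, with `L` the
Landau operator on `L²(ℝ²)`. -/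
def IsLandauSpace (b : ℝ) (f g : L2 Space) : Prop :=
  ∀ φ : Space → ℂ, ContDiff ℝ ∞ φ → HasCompactSupport φ →
    ∫ x, starRingEnd ℂ (landauExprSpace b φ x) * f x = ∫ x, starRingEnd ℂ (φ x) * g x

/-- A bounded operator commutes with the unbounded operator `L ⊗ 1`: it maps the domain of `L ⊗ 1`
to itself, and `(L ⊗ 1) γ f = γ (L ⊗ 1) f` for all `f` in this domain. -/
def CommutesWithLandau (b : ℝ) (γ : L2 Space →L[ℂ] L2 Space) : Prop :=
  ∀ f g : L2 Space, IsLandauSpace b f g → IsLandauSpace b (γ f) (γ g)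

/-- The `n`-th Landau energy `|b| (2n + 1)`. -/
def landauEnergy (b : ℝ) (n : ℕ) : ℝ := |b| * (2 * n + 1)

section LandauLevel

theorem contDiff_lineDeriv {φ : Plane → ℂ} (hφ : ContDiff ℝ ∞ φ) (v : Plane) :
    ContDiff ℝ ∞ fun x => lineDeriv ℝ φ x v := by
  have e : (fun x => lineDeriv ℝ φ x v) = fun x => fderiv ℝ φ x v := by
    funext x
    exact ((hφ.differentiable (by simp)) x).lineDeriv_eq_fderiv
  rw [e]
  exact (hφ.fderiv_right (m := ∞) (by simp)).clm_apply contDiff_const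

theorem hasCompactSupport_lineDeriv {φ : Plane → ℂ} (hφ : ContDiff ℝ ∞ φ)
    (hc : HasCompactSupport φ) (v : Plane) : HasCompactSupport fun x => lineDeriv ℝ φ x v := by
  have e : (fun x => lineDeriv ℝ φ x v) = fun x => fderiv ℝ φ x v := by
    funext x
    exact ((hφ.differentiable (by simp)) x).lineDeriv_eq_fderiv
  rw [e]
  exact (hc.fderiv (𝕜 := ℝ)).comp_left (g := fun T : Plane →L[ℝ] ℂ => T v) rfl

theorem momentum₁_test {φ : Plane → ℂ} (hφ : ContDiff ℝ ∞ φ) (hc : HasCompactSupport φ) :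
    ContDiff ℝ ∞ (momentum₁ φ) ∧ HasCompactSupport (momentum₁ φ) :=
  ⟨contDiff_const.mul (contDiff_lineDeriv hφ _),
    (hasCompactSupport_lineDeriv hφ hc _).mul_left (f := fun _ => -Complex.I)⟩

theorem momentum₂_test (b : ℝ) {φ : Plane → ℂ} (hφ : ContDiff ℝ ∞ φ) (hc : HasCompactSupport φ) :
    ContDiff ℝ ∞ (momentum₂ b φ) ∧ HasCompactSupport (momentum₂ b φ) := by
  have h1 : ContDiff ℝ ∞ fun x : Plane => (b : ℂ) * (x.1 : ℂ) :=
    contDiff_const.mul (Complex.ofRealCLM.contDiff.comp contDiff_fst)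
  exact ⟨(contDiff_const.mul (contDiff_lineDeriv hφ _)).add (h1.mul hφ),
    ((hasCompactSupport_lineDeriv hφ hc _).mul_left (f := fun _ => -Complex.I)).add
      (hc.mul_left (f := fun x : Plane => (b : ℂ) * (x.1 : ℂ)))⟩

theorem landauExpr_test (b : ℝ) {φ : Plane → ℂ} (hφ : ContDiff ℝ ∞ φ) (hc : HasCompactSupport φ) :
    ContDiff ℝ ∞ (landauExpr b φ) ∧ HasCompactSupport (landauExpr b φ) := by
  obtain ⟨a1, a2⟩ := momentum₁_test hφ hc
  obtain ⟨b1, b2⟩ := momentum₁_test a1 a2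
  obtain ⟨c1, c2⟩ := momentum₂_test b hφ hc
  obtain ⟨d1, d2⟩ := momentum₂_test b c1 c2
  exact ⟨b1.add d1, b2.add d2⟩

theorem integral_conj_mul_eq_inner {φ : Plane → ℂ} (h : MemLp φ 2 (volume : Measure Plane))
    (f : L2 Plane) : ∫ x, starRingEnd ℂ (φ x) * f x = ⟪h.toLp, f⟫_ℂ := by
  rw [L2.inner_def]
  refine integral_congr_ae ?_
  filter_upwards [h.coeFn_toLp] with x hx
  rw [hx, RCLike.inner_apply, mul_comm]

/-- The `n`-th Landau level: the eigenspace `ker (L - |b| (2n + 1))` of the Landau operator. -/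
def landauLevel (b : ℝ) (n : ℕ) : Submodule ℂ (L2 Plane) where
  carrier := {f | IsLandau b f ((landauEnergy b n : ℂ) • f)}
  zero_mem' := by
    intro φ hφ hc
    have h1 := (landauExpr_test b hφ hc).1.continuous.memLp_of_hasCompactSupport (p := 2)
      (μ := (volume : Measure Plane)) (landauExpr_test b hφ hc).2
    have h2 := hφ.continuous.memLp_of_hasCompactSupport (p := 2)
      (μ := (volume : Measure Plane)) hc
    rw [integral_conj_mul_eq_inner h1, integral_conj_mul_eq_inner h2]
    simp
  add_mem' := by
    intro f g hf hg φ hφ hc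
    have hf' := hf φ hφ hc
    have hg' := hg φ hφ hc
    have h1 := (landauExpr_test b hφ hc).1.continuous.memLp_of_hasCompactSupport (p := 2)
      (μ := (volume : Measure Plane)) (landauExpr_test b hφ hc).2
    have h2 := hφ.continuous.memLp_of_hasCompactSupport (p := 2)
      (μ := (volume : Measure Plane)) hc
    rw [integral_conj_mul_eq_inner h1, integral_conj_mul_eq_inner h2] at hf' hg' ⊢
    rw [smul_add, inner_add_right, inner_add_right, hf', hg']
  smul_mem' := by
    intro c f hf φ hφ hc
    have hf' := hf φ hφ hc
    have h1 := (landauExpr_test b hφ hc).1.continuous.memLp_of_hasCompactSupport (p := 2)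
      (μ := (volume : Measure Plane)) (landauExpr_test b hφ hc).2
    have h2 := hφ.continuous.memLp_of_hasCompactSupport (p := 2)
      (μ := (volume : Measure Plane)) hc
    rw [integral_conj_mul_eq_inner h1, integral_conj_mul_eq_inner h2] at hf' ⊢
    rw [smul_comm, inner_smul_right, inner_smul_right, hf']

theorem isClosed_landauLevel (b : ℝ) (n : ℕ) : IsClosed (landauLevel b n : Set (L2 Plane)) := by
  have e : (landauLevel b n : Set (L2 Plane)) = {f | IsLandau b f ((landauEnergy b n : ℂ) • f)} :=
    rfl
  rw [e]
  unfold IsLandau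
  simp only [Set.ofPred_forall]
  refine isClosed_iInter fun φ => isClosed_iInter fun hφ => isClosed_iInter fun hc => ?_
  have h1 := (landauExpr_test b hφ hc).1.continuous.memLp_of_hasCompactSupport (p := 2)
    (μ := (volume : Measure Plane)) (landauExpr_test b hφ hc).2
  have h2 := hφ.continuous.memLp_of_hasCompactSupport (p := 2)
    (μ := (volume : Measure Plane)) hc
  simp only [integral_conj_mul_eq_inner h1, integral_conj_mul_eq_inner h2]
  exact isClosed_eq (by fun_prop) (by fun_prop)

instance completeSpace_landauLevel (b : ℝ) (n : ℕ) : CompleteSpace (landauLevel b n) :=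
  (isClosed_landauLevel b n).completeSpace_coe

/-- The orthogonal projector `P_n` of `L²(ℝ²)` onto the `n`-th Landau level. -/
def landauProjector (b : ℝ) (n : ℕ) : L2 Plane →L[ℂ] L2 Plane :=
  (landauLevel b n).starProjection

end LandauLevel

/-! ### Tensor products -/

theorem memLp_tensor (f : L2 Plane) (g : L2 ℝ) :
    MemLp (fun x : Space => f x.1 * g x.2) 2 (volume : Measure Space) := by
  have hm : AEStronglyMeasurable (fun x : Space => f x.1 * g x.2) (volume : Measure Space) :=
    (Lp.aestronglyMeasurable f).comp_fst.mul (Lp.aestronglyMeasurable g).comp_snd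
  rw [memLp_two_iff_integrable_sq_norm hm]
  have h := Integrable.mul_prod ((memLp_two_iff_integrable_sq_norm
    (Lp.aestronglyMeasurable f)).1 (Lp.memLp f)) ((memLp_two_iff_integrable_sq_norm
    (Lp.aestronglyMeasurable g)).1 (Lp.memLp g))
  simp only [norm_mul, mul_pow]
  exact h

/-- The function `(f ⊗ g)(x) = f(x₁, x₂) g(x₃)` in `L²(ℝ³)`. -/
def tensor (f : L2 Plane) (g : L2 ℝ) : L2 Space := (memLp_tensor f g).toLp

/-- `T` is the bounded operator `A ⊗ B` on `L²(ℝ³) = L²(ℝ²) ⊗ L²(ℝ)`: the one (there is exactly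
one, as functions `f ⊗ g` span a dense subspace) with `T (f ⊗ g) = A f ⊗ B g`. -/
def IsTensorOp (A : L2 Plane →L[ℂ] L2 Plane) (B : L2 ℝ →L[ℂ] L2 ℝ)
    (T : L2 Space →L[ℂ] L2 Space) : Prop :=
  ∀ (f : L2 Plane) (g : L2 ℝ), T (tensor f g) = tensor (A f) (B g)

/-! ### Trace class operators and densities -/

section Trace

variable {H : Type} [NormedAddCommGroup H] [InnerProductSpace ℂ H] [CompleteSpace H]

/-- The index set of a fixed orthonormal basis of the Hilbert space `H`. -/
def basisIndex (H : Type) [NormedAddCommGroup H] [InnerProductSpace ℂ H] [CompleteSpace H] :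
    Set H :=
  (exists_hilbertBasis ℂ H).choose

/-- A fixed orthonormal basis of the Hilbert space `H`. -/
def stdBasis (H : Type) [NormedAddCommGroup H] [InnerProductSpace ℂ H] [CompleteSpace H] :
    HilbertBasis (basisIndex H) ℂ H :=
  (exists_hilbertBasis ℂ H).choose_spec.choose

/-- Hilbert-Schmidt operators: `∑ᵢ ‖A eᵢ‖² < ∞` (the sum does not depend on the basis). -/
def IsHilbertSchmidt (A : H →L[ℂ] H) : Prop :=
  Summable fun i => ‖A (stdBasis H i)‖ ^ 2

/-- Trace class operators: the products of two Hilbert-Schmidt operators. -/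
def IsTraceClass (T : H →L[ℂ] H) : Prop :=
  ∃ A B : H →L[ℂ] H, IsHilbertSchmidt A ∧ IsHilbertSchmidt B ∧ T = A ∘L B

/-- The trace `∑ᵢ ⟨eᵢ, T eᵢ⟩` of a trace class operator (it does not depend on the basis). -/
def opTrace (T : H →L[ℂ] H) : ℂ := ∑' i, ⟪stdBasis H i, T (stdBasis H i)⟫_ℂ

end Trace

section Density

variable {X : Type} [MeasureSpace X] [TopologicalSpace X] [T2Space X] [OpensMeasurableSpace X]

/-- The localized operator `1_K T 1_K`. -/
def compression (K : Set X) (hK : IsCompact K) (T : L2 X →L[ℂ] L2 X) : L2 X →L[ℂ] L2 X :=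
  indicatorOp K hK.measurableSet ∘L T ∘L indicatorOp K hK.measurableSet

/-- `T` is locally trace class: `1_K T 1_K` is trace class for every compact `K`. -/
def IsLocallyTraceClass (T : L2 X →L[ℂ] L2 X) : Prop :=
  ∀ (K : Set X) (hK : IsCompact K), IsTraceClass (compression K hK T)

/-- `ρ` is the density of the locally trace class operator `T`: it is locally integrable, and
`Tr (1_K T 1_K) = ∫_K ρ` for every compact `K`; this determines `ρ` almost everywhere. -/
def IsDensity (T : L2 X →L[ℂ] L2 X) (ρ : X → ℂ) : Prop :=
  IsLocallyTraceClass T ∧ LocallyIntegrable ρ ∧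
    ∀ (K : Set X) (hK : IsCompact K), opTrace (compression K hK T) = ∫ x in K, ρ x

end Density

end MagneticSlab

end

/-!
The Landau operator is a harmonic oscillator. The kinetic momenta `p₁`, `p₂` give ladder operators
`lowerL`, `raiseL` with `L = |b| (2 a† a + 1)`, and the generators `k₁`, `k₂` of the magnetic
translations give a second, commuting pair `lowerM`, `raiseM`. Applied to a Gaussian ground state,
the raising operators produce orthonormal Schwartz functions `e_{nk}` (`landauFun`). They form a
Hilbert basis of `L²(ℝ²)` (`landauBasis`): the coordinates are linear combinations of ladder
operators, so a function orthogonal to all `e_{nk}`, multiplied by the Gaussian, has vanishing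
moments and hence a vanishing Fourier transform. The level `n` is spanned by the `e_{nk}` with `k`
arbitrary.

Let `γ` commute with the magnetic translations and with `L ⊗ 1`. Commutation with `L ⊗ 1` forbids
matrix elements of `γ` between different levels (`inner_tensor_apply_tensor_of_ne`).
Differentiating the commutation with the magnetic translations along the two axes gives weak
commutation with `k₁` and `k₂`, hence with `lowerM` and `raiseM`, and by Schur's argument the matrix
elements between `e_{nj}` and `e_{nk}` are `δ_{jk}` times an operator `γ_n` on `L²(ℝ)` independent
of `k` (`inner_apply_landauVec`, `levelBlock`). Expanding in the basis `e_{nk} ⊗ q_l` yields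
`γ = ∑ P_n ⊗ γ_n`.

A locally trace class operator has a density: if `1_K γ 1_K = A B` with Hilbert-Schmidt operators
`A` and `B`, the density on `K` is `∑ conj (B† eᵢ) (A eᵢ)` (`exists_density`). By cyclicity of the
trace the density of `γ` is invariant under the translations of the plane, so that it depends on
`x₃` only (`exists_density_snd`).

For `γ ≥ 0`, the trace of `γ` localized to a box `Q × J` is the sum over `n` of
`Tr (1_Q P_n 1_Q) Tr (1_J γ_n 1_J)`. Here `Tr (1_Q P_n 1_Q) = ∫_Q ∑_k |e_{nk}|² = |Q| |b| / 2π`,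
because the diagonal `∑_k |e_{nk}(y)|²` is `|b| / 2π` at every point `y`
(`hasSum_norm_sq_landauFun`): for `n = 0` this is an exponential series, and the partial sums for
`n + 1` and `n` differ by a boundary term that tends to zero. With `Q` the unit square, every `γ_n`
is locally trace class, and the integrals over compact sets of the densities
`(|b| / 2π) ρ_{γ_n}` add up to those of `ρ_γ`; all functions being nonnegative, the densities
themselves add up almost everywhere.
-/

namespace MagneticSlab

/-! ### Hilbert-Schmidt and trace class operators -/

section TraceClass

variable {H : Type} [NormedAddCommGroup H] [InnerProductSpace ℂ H]
variable {ι κ : Type*}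

/-- Parseval's identity in `ℝ≥0∞`. -/
theorem tsum_enorm_inner_sq (e : HilbertBasis ι ℂ H) (x : H) :
    ∑' i, ‖⟪e i, x⟫_ℂ‖ₑ ^ 2 = ‖x‖ₑ ^ 2 := by
  have h := e.hasSum_inner_mul_inner x x
  have h2 : HasSum (fun i => ‖⟪e i, x⟫_ℂ‖ ^ 2) (‖x‖ ^ 2) := by
    have h3 := Complex.reCLM.hasSum h
    convert h3 using 1
    · funext i
      rw [← inner_conj_symm x (e i), Complex.reCLM_apply, mul_comm,
        Complex.mul_conj, Complex.ofReal_re, Complex.normSq_eq_norm_sq]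
    · simp [← inner_self_eq_norm_sq (𝕜 := ℂ)]
  have h4 := ENNReal.ofReal_tsum_of_nonneg (fun i => sq_nonneg ‖⟪e i, x⟫_ℂ‖) h2.summable
  rw [h2.tsum_eq] at h4
  simpa [ENNReal.ofReal_pow, ofReal_norm] using h4.symm

variable [CompleteSpace H]

/-- The square of the Hilbert-Schmidt norm is computed by the adjoint in any other basis. -/
theorem tsum_enorm_sq_adjoint (A : H →L[ℂ] H) (e : HilbertBasis ι ℂ H) (f : HilbertBasis κ ℂ H) :
    ∑' i, ‖A (e i)‖ₑ ^ 2 = ∑' j, ‖A.adjoint (f j)‖ₑ ^ 2 := by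
  simp_rw [← tsum_enorm_inner_sq f (A _), ← tsum_enorm_inner_sq e (A.adjoint _)]
  rw [ENNReal.tsum_comm]
  refine tsum_congr fun j => tsum_congr fun i => ?_
  rw [ContinuousLinearMap.adjoint_inner_right, ← inner_conj_symm, RCLike.enorm_conj]

theorem tsum_enorm_sq_eq (A : H →L[ℂ] H) (e : HilbertBasis ι ℂ H) (f : HilbertBasis κ ℂ H) :
    ∑' i, ‖A (e i)‖ₑ ^ 2 = ∑' j, ‖A (f j)‖ₑ ^ 2 := by
  rw [tsum_enorm_sq_adjoint A e f, tsum_enorm_sq_adjoint A.adjoint f f,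
    ContinuousLinearMap.adjoint_adjoint]

theorem summable_norm_sq_iff {E : Type*} [SeminormedAddCommGroup E] (f : ι → E) :
    (Summable fun i => ‖f i‖ ^ 2) ↔ ∑' i, ‖f i‖ₑ ^ 2 ≠ ⊤ := by
  have : (fun i => ‖f i‖ₑ ^ 2) = fun i => (((‖f i‖₊ ^ 2 : NNReal)) : ℝ≥0∞) := by
    funext i; simp [enorm_eq_nnnorm]
  rw [this, ENNReal.tsum_coe_ne_top_iff_summable, ← NNReal.summable_coe]
  simp

theorem isHilbertSchmidt_iff (A : H →L[ℂ] H) (e : HilbertBasis ι ℂ H) :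
    IsHilbertSchmidt A ↔ ∑' i, ‖A (e i)‖ₑ ^ 2 ≠ ⊤ := by
  rw [IsHilbertSchmidt, summable_norm_sq_iff, tsum_enorm_sq_eq A _ e]

theorem IsHilbertSchmidt.summable {A : H →L[ℂ] H} (hA : IsHilbertSchmidt A)
    (e : HilbertBasis ι ℂ H) : Summable fun i => ‖A (e i)‖ ^ 2 := by
  rw [summable_norm_sq_iff]
  exact (isHilbertSchmidt_iff A e).1 hA

theorem IsHilbertSchmidt.adjoint {A : H →L[ℂ] H} (hA : IsHilbertSchmidt A) :
    IsHilbertSchmidt A.adjoint := by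
  rw [isHilbertSchmidt_iff _ (stdBasis H)] at hA ⊢
  rwa [← tsum_enorm_sq_adjoint A (stdBasis H)]

theorem IsHilbertSchmidt.comp_left {A : H →L[ℂ] H} (hA : IsHilbertSchmidt A) (B : H →L[ℂ] H) :
    IsHilbertSchmidt (B ∘L A) := by
  refine Summable.of_nonneg_of_le (fun _ => by positivity) (fun i => ?_) (hA.mul_left (‖B‖ ^ 2))
  rw [← mul_pow]
  gcongr
  exact B.le_opNorm _

theorem IsHilbertSchmidt.comp_right {A : H →L[ℂ] H} (hA : IsHilbertSchmidt A) (B : H →L[ℂ] H) :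
    IsHilbertSchmidt (A ∘L B) := by
  have h := (hA.adjoint.comp_left B.adjoint).adjoint
  rwa [← ContinuousLinearMap.adjoint_comp, ContinuousLinearMap.adjoint_adjoint] at h

/-- The absolutely convergent double series behind all manipulations of traces. -/
theorem summable_inner_mul_inner {A B : H →L[ℂ] H} (hA : IsHilbertSchmidt A)
    (hB : IsHilbertSchmidt B) (e : HilbertBasis ι ℂ H) (f : HilbertBasis κ ℂ H) :
    Summable fun p : ι × κ => ⟪e p.1, A (f p.2)⟫_ℂ * ⟪f p.2, B (e p.1)⟫_ℂ := by
  have h1 : Summable fun p : ι × κ => ‖⟪e p.1, A (f p.2)⟫_ℂ‖ ^ 2 := by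
    rw [summable_norm_sq_iff, ENNReal.tsum_prod (f := fun i j => ‖⟪e i, A (f j)⟫_ℂ‖ₑ ^ 2),
      ENNReal.tsum_comm]
    simp_rw [tsum_enorm_inner_sq]
    exact (isHilbertSchmidt_iff A f).1 hA
  have h2 : Summable fun p : ι × κ => ‖⟪f p.2, B (e p.1)⟫_ℂ‖ ^ 2 := by
    rw [summable_norm_sq_iff, ENNReal.tsum_prod (f := fun i j => ‖⟪f j, B (e i)⟫_ℂ‖ₑ ^ 2)]
    simp_rw [tsum_enorm_inner_sq]
    exact (isHilbertSchmidt_iff B e).1 hB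
  refine Summable.of_norm_bounded (h1.add h2) fun p => ?_
  rw [norm_mul]
  nlinarith [sq_nonneg (‖⟪e p.1, A (f p.2)⟫_ℂ‖ - ‖⟪f p.2, B (e p.1)⟫_ℂ‖),
    sq_nonneg (‖⟪e p.1, A (f p.2)⟫_ℂ‖), sq_nonneg ‖⟪f p.2, B (e p.1)⟫_ℂ‖]

theorem hasSum_inner_comp_inner (A B : H →L[ℂ] H) (f : HilbertBasis κ ℂ H) (x : H) :
    HasSum (fun j => ⟪x, A (f j)⟫_ℂ * ⟪f j, B x⟫_ℂ) ⟪x, A (B x)⟫_ℂ := by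
  simpa only [ContinuousLinearMap.adjoint_inner_left] using
    f.hasSum_inner_mul_inner (A.adjoint x) (B x)

theorem summable_inner_comp {A B : H →L[ℂ] H} (hA : IsHilbertSchmidt A)
    (hB : IsHilbertSchmidt B) (e : HilbertBasis ι ℂ H) :
    Summable fun i => ⟪e i, A (B (e i))⟫_ℂ :=
  (((summable_inner_mul_inner hA hB e (stdBasis H)).hasSum.prod_fiberwise
    fun i => hasSum_inner_comp_inner A B (stdBasis H) (e i))).summable

/-- Cyclicity of the trace; for `f = e` and twice applied, independence of the basis. -/
theorem tsum_inner_comp_comm {A B : H →L[ℂ] H} (hA : IsHilbertSchmidt A)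
    (hB : IsHilbertSchmidt B) (e : HilbertBasis ι ℂ H) (f : HilbertBasis κ ℂ H) :
    ∑' i, ⟪e i, A (B (e i))⟫_ℂ = ∑' j, ⟪f j, B (A (f j))⟫_ℂ := by
  have h := summable_inner_mul_inner hA hB e f
  have h1 := h.hasSum.prod_fiberwise fun i => hasSum_inner_comp_inner A B f (e i)
  have h2 := ((Equiv.prodComm κ ι).summable_iff.2 h).hasSum.prod_fiberwise fun j => by
    have := hasSum_inner_comp_inner B A e (f j)
    simpa [Function.comp_def, mul_comm] using this
  rw [h1.tsum_eq, h2.tsum_eq]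
  exact ((Equiv.prodComm κ ι).tsum_eq _).symm

theorem opTrace_comp_comm {A B : H →L[ℂ] H} (hA : IsHilbertSchmidt A) (hB : IsHilbertSchmidt B) :
    opTrace (A ∘L B) = opTrace (B ∘L A) :=
  tsum_inner_comp_comm hA hB _ _

/-- The trace may be computed in any orthonormal basis. -/
theorem IsTraceClass.hasSum {T : H →L[ℂ] H} (hT : IsTraceClass T) (e : HilbertBasis ι ℂ H) :
    HasSum (fun i => ⟪e i, T (e i)⟫_ℂ) (opTrace T) := by
  obtain ⟨A, B, hA, hB, rfl⟩ := hT
  have h : opTrace (A ∘L B) = ∑' i, ⟪e i, A (B (e i))⟫_ℂ :=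
    (tsum_inner_comp_comm hA hB (stdBasis H) e).trans (tsum_inner_comp_comm hB hA e e)
  rw [h]
  exact (summable_inner_comp hA hB e).hasSum

/-- A positive operator whose diagonal in one basis is summable is trace class, as it is the
square of its Hilbert-Schmidt square root. -/
theorem isTraceClass_of_isPositive {T : H →L[ℂ] H} (hT : T.IsPositive) (e : HilbertBasis ι ℂ H)
    (h : Summable fun i => ⟪e i, T (e i)⟫_ℂ) : IsTraceClass T := by
  have h0 : 0 ≤ T := (ContinuousLinearMap.nonneg_iff_isPositive T).2 hT
  set S := CFC.sqrt T with hS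
  have hSS : S ∘L S = T := CFC.sqrt_mul_sqrt_self T h0
  have hsa : IsSelfAdjoint S := (CFC.sqrt_nonneg T).isSelfAdjoint
  have hHS : IsHilbertSchmidt S := by
    rw [isHilbertSchmidt_iff S e, ← summable_norm_sq_iff]
    refine (Complex.reCLM.summable h).congr fun i => ?_
    have h1 : ⟪e i, T (e i)⟫_ℂ = ⟪S (e i), S (e i)⟫_ℂ := by
      rw [← hSS, ContinuousLinearMap.comp_apply, ← ContinuousLinearMap.adjoint_inner_left,
        hsa.adjoint_eq]
    rw [h1, ← inner_self_eq_norm_sq (𝕜 := ℂ)]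
    rfl
  exact ⟨S, S, hHS, hHS, hSS.symm⟩

end TraceClass


/-! ### Densities of locally trace class operators -/

section IndicatorOp

variable {X : Type} [MeasureSpace X]

theorem indicatorOp_ae (K : Set X) (hK : MeasurableSet K) (f : L2 X) :
    indicatorOp K hK f =ᵐ[volume] K.indicator f := by
  filter_upwards [mulOp_ae _ (measurable_const.indicator hK) (norm_indicator_one_le K) f] with x hx
  refine hx.trans ?_
  by_cases h : x ∈ K <;> simp [h]

theorem L2_inner_eq (f g : L2 X) : ⟪f, g⟫_ℂ = ∫ x, starRingEnd ℂ (f x) * g x := by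
  rw [L2.inner_def]
  exact integral_congr_ae (Filter.Eventually.of_forall fun x => by
    simp only [RCLike.inner_apply, mul_comm])

theorem integrable_conj_mul (f g : L2 X) :
    Integrable (fun x => starRingEnd ℂ (f x) * g x) (volume : Measure X) := by
  refine (L2.integrable_inner (𝕜 := ℂ) f g).congr (Filter.Eventually.of_forall fun x => ?_)
  simp only [RCLike.inner_apply, mul_comm]

theorem integral_norm_sq (f : L2 X) : ∫ x, ‖f x‖ ^ 2 = ‖f‖ ^ 2 := by
  have h := L2_inner_eq f f
  have h2 : ∀ x, starRingEnd ℂ (f x) * f x = ((‖f x‖ ^ 2 : ℝ) : ℂ) := fun x => by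
    rw [mul_comm, Complex.mul_conj, Complex.normSq_eq_norm_sq]
  simp_rw [h2] at h
  rw [integral_complex_ofReal, inner_self_eq_norm_sq_to_K] at h
  exact Complex.ofReal_injective (h.symm.trans (by push_cast; rfl))

theorem integrable_norm_sq (f : L2 X) : Integrable (fun x => ‖f x‖ ^ 2) (volume : Measure X) :=
  (memLp_two_iff_integrable_sq_norm (Lp.aestronglyMeasurable f)).1 (Lp.memLp f)

theorem inner_indicatorOp (K : Set X) (hK : MeasurableSet K) (f g : L2 X) :
    ⟪f, indicatorOp K hK g⟫_ℂ = ∫ x in K, starRingEnd ℂ (f x) * g x := by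
  rw [L2_inner_eq, ← integral_indicator hK]
  refine integral_congr_ae ?_
  filter_upwards [indicatorOp_ae K hK g] with x hx
  rw [hx]
  by_cases h : x ∈ K <;> simp [h]

theorem indicatorOp_symm (K : Set X) (hK : MeasurableSet K) (f g : L2 X) :
    ⟪indicatorOp K hK f, g⟫_ℂ = ⟪f, indicatorOp K hK g⟫_ℂ := by
  rw [← inner_conj_symm, inner_indicatorOp, inner_indicatorOp, ← integral_conj]
  refine integral_congr_ae (Filter.Eventually.of_forall fun x => ?_)
  simp [mul_comm]

theorem indicatorOp_comp_of_subset {K K' : Set X} (hK : MeasurableSet K) (hK' : MeasurableSet K')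
    (h : K' ⊆ K) : indicatorOp K' hK' ∘L indicatorOp K hK = indicatorOp K' hK' := by
  ext1 f
  refine Lp.ext ?_
  filter_upwards [indicatorOp_ae K' hK' (indicatorOp K hK f), indicatorOp_ae K hK f,
    indicatorOp_ae K' hK' f] with x h1 h2 h3
  rw [ContinuousLinearMap.comp_apply, h1, h3]
  by_cases hx : x ∈ K'
  · simp [hx, h2, h hx]
  · simp [hx]

theorem indicatorOp_comp_of_subset' {K K' : Set X} (hK : MeasurableSet K)
    (hK' : MeasurableSet K') (h : K' ⊆ K) :
    indicatorOp K hK ∘L indicatorOp K' hK' = indicatorOp K' hK' := by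
  ext1 f
  refine Lp.ext ?_
  filter_upwards [indicatorOp_ae K hK (indicatorOp K' hK' f), indicatorOp_ae K' hK' f]
    with x h1 h3
  rw [ContinuousLinearMap.comp_apply, h1, h3]
  by_cases hx : x ∈ K
  · simp [hx, h3]
  · rw [Set.indicator_of_notMem hx, Set.indicator_of_notMem fun h' => hx (h h')]

theorem norm_sq_indicatorOp (K : Set X) (hK : MeasurableSet K) (f : L2 X) :
    ‖indicatorOp K hK f‖ ^ 2 = ∫ x in K, ‖f x‖ ^ 2 := by
  rw [← integral_norm_sq, ← integral_indicator hK]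
  refine integral_congr_ae ?_
  filter_upwards [indicatorOp_ae K hK f] with x hx
  rw [hx]
  by_cases h : x ∈ K <;> simp [h]

end IndicatorOp

section Density

variable {X : Type} [MeasureSpace X] [TopologicalSpace X] [T2Space X] [OpensMeasurableSpace X]

theorem compression_comp_of_subset {K K' : Set X} (hK : IsCompact K) (hK' : IsCompact K')
    (h : K' ⊆ K) (T : L2 X →L[ℂ] L2 X) :
    compression K' hK' (compression K hK T) = compression K' hK' T := by
  have h1 := indicatorOp_comp_of_subset hK.measurableSet hK'.measurableSet h
  have h2 := indicatorOp_comp_of_subset' hK.measurableSet hK'.measurableSet h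
  unfold compression
  calc _ = (indicatorOp K' hK'.measurableSet ∘L indicatorOp K hK.measurableSet) ∘L T ∘L
        (indicatorOp K hK.measurableSet ∘L indicatorOp K' hK'.measurableSet) := rfl
    _ = _ := by rw [h1, h2]

theorem compression_isPositive {T : L2 X →L[ℂ] L2 X} (hT : T.IsPositive) (K : Set X)
    (hK : IsCompact K) : (compression K hK T).IsPositive := by
  have h : (indicatorOp K hK.measurableSet).adjoint = indicatorOp K hK.measurableSet :=
    ((ContinuousLinearMap.eq_adjoint_iff _ _).2 fun f g =>
      indicatorOp_symm K hK.measurableSet f g).symm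
  have := hT.conj_adjoint (indicatorOp K hK.measurableSet)
  rwa [h] at this

/-- On the compact set `K`, the density of `T` is `∑ᵢ conj (B† eᵢ) · (A eᵢ)`, where
`1_K T 1_K = A B` with Hilbert-Schmidt operators `A`, `B`; the series converges in `L¹`. -/
theorem exists_density_on_compact {T : L2 X →L[ℂ] L2 X} {K : Set X} (hK : IsCompact K)
    (hT : IsTraceClass (compression K hK T)) :
    ∃ ρ : X → ℂ, Integrable ρ ∧ ∀ (K' : Set X) (hK' : IsCompact K'), K' ⊆ K →
      opTrace (compression K' hK' T) = ∫ x in K', ρ x := by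
  obtain ⟨A, B, hA, hB, hAB⟩ := hT
  set e := stdBasis (L2 X)
  have hint := fun i => integrable_conj_mul (B.adjoint (e i)) (A (e i))
  have hsum : Summable fun i => (hint i).toL1 := by
    refine Summable.of_norm_bounded ((hB.adjoint.summable e).add (hA.summable e)) fun i => ?_
    rw [L1.norm_eq_integral_norm]
    calc _ = ∫ x, ‖starRingEnd ℂ (B.adjoint (e i) x) * A (e i) x‖ := by
          refine integral_congr_ae ?_
          filter_upwards [(hint i).coeFn_toL1] with x hx
          rw [hx]
      _ ≤ ∫ x, (‖B.adjoint (e i) x‖ ^ 2 + ‖A (e i) x‖ ^ 2) := by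
          refine integral_mono (hint i).norm
            ((integrable_norm_sq _).add (integrable_norm_sq _)) fun x => ?_
          simp only [norm_mul, RCLike.norm_conj]
          nlinarith [sq_nonneg (‖B.adjoint (e i) x‖ - ‖A (e i) x‖),
            sq_nonneg ‖B.adjoint (e i) x‖, sq_nonneg ‖A (e i) x‖]
      _ = _ := by
          rw [integral_add (integrable_norm_sq _) (integrable_norm_sq _), integral_norm_sq,
            integral_norm_sq]
  refine ⟨(∑' i, (hint i).toL1 : X →₁[volume] ℂ), L1.integrable_coeFn _, fun K' hK' hsub => ?_⟩
  -- Integration over `K'` is continuous on `L¹`, hence may be carried out term by term.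
  let I : (X →₁[volume] ℂ) →+ ℂ :=
    { toFun := fun f => ∫ x in K', f x
      map_zero' := by
        rw [← integral_zero X ℂ]
        exact integral_congr_ae (ae_restrict_of_ae (Lp.coeFn_zero ℂ 1 volume))
      map_add' := fun f g => by
        rw [← integral_add (L1.integrable_coeFn f).integrableOn
          (L1.integrable_coeFn g).integrableOn]
        exact integral_congr_ae (ae_restrict_of_ae (Lp.coeFn_add f g)) }
  have hI := hsum.hasSum.map I (continuous_setIntegral K')
  refine Eq.trans ?_ hI.tsum_eq
  set χ := indicatorOp K' hK'.measurableSet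
  have hχ : χ ∘L χ = χ := indicatorOp_comp_of_subset _ _ subset_rfl
  rw [← compression_comp_of_subset hK hK' hsub, hAB]
  have h1 : opTrace (compression K' hK' (A ∘L B)) = opTrace (B ∘L χ ∘L A) := by
    have h2 := opTrace_comp_comm (hA.comp_left χ) (hB.comp_right χ)
    refine h2.trans (congrArg _ ?_)
    calc _ = B ∘L (χ ∘L χ) ∘L A := rfl
      _ = _ := by rw [hχ]
  rw [h1]
  refine tsum_congr fun i => ?_
  rw [ContinuousLinearMap.comp_apply, ← ContinuousLinearMap.adjoint_inner_left,
    ContinuousLinearMap.comp_apply, inner_indicatorOp]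
  refine integral_congr_ae (ae_restrict_of_ae ?_)
  filter_upwards [(hint i).coeFn_toL1] with x hx
  exact hx.symm

theorem ae_eq_on_of_forall_compact [SigmaCompactSpace X] [BorelSpace X] {K : Set X}
    (hK : IsCompact K) {ρ₁ ρ₂ : X → ℂ} (h₁ : IntegrableOn ρ₁ K) (h₂ : IntegrableOn ρ₂ K)
    (h : ∀ K' : Set X, IsCompact K' → K' ⊆ K → ∫ x in K', ρ₁ x = ∫ x in K', ρ₂ x) :
    ρ₁ =ᵐ[volume.restrict K] ρ₂ := by
  have := ae_eq_zero_of_forall_setIntegral_isCompact_eq_zero (h₁.sub h₂) fun s hs => by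
    rw [Measure.restrict_restrict' hK.measurableSet]
    have hsub : s ∩ K ⊆ K := Set.inter_subset_right
    have hc := hs.inter hK
    rw [integral_sub' (h₁.mono_set hsub) (h₂.mono_set hsub), h _ hc hsub, sub_self]
  filter_upwards [this] with x hx
  exact sub_eq_zero.1 hx

/-- The densities on the sets of a compact exhaustion agree where both are defined, and glue to a
density. -/
theorem exists_density [SigmaCompactSpace X] [WeaklyLocallyCompactSpace X] [BorelSpace X]
    {T : L2 X →L[ℂ] L2 X} (hT : IsLocallyTraceClass T) : ∃ ρ : X → ℂ, IsDensity T ρ := by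
  let E := CompactExhaustion.choice X
  choose r hr hrK using fun n => exists_density_on_compact (E.isCompact n) (hT _ (E.isCompact n))
  let ρ : X → ℂ := fun x => r (E.find x) x
  have hag : ∀ m n, m ≤ n → r m =ᵐ[volume.restrict (E m)] r n := fun m n hmn =>
    ae_eq_on_of_forall_compact (E.isCompact m) (hr m).integrableOn (hr n).integrableOn
      fun K' hK' hsub => by
        rw [← hrK m K' hK' hsub, ← hrK n K' hK' (hsub.trans (E.subset hmn))]
  have hρ : ∀ n, ρ =ᵐ[volume.restrict (E n)] r n := fun n => by
    have h1 : ∀ᵐ x, ∀ m, m ≤ n → x ∈ E m → r m x = r n x := by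
      rw [ae_all_iff]
      intro m
      by_cases hmn : m ≤ n
      · filter_upwards [(ae_restrict_iff' (E.isCompact m).measurableSet).1 (hag m n hmn)]
          with x hx _ using hx
      · exact Filter.Eventually.of_forall fun x h => absurd h hmn
    refine (ae_restrict_iff' (E.isCompact n).measurableSet).2 ?_
    filter_upwards [h1] with x hx hxn
    exact hx _ ((E.mem_iff_find_le).1 hxn) (E.mem_find x)
  refine ⟨ρ, hT, fun x => ?_, fun K hK => ?_⟩
  · obtain ⟨n, hn⟩ := E.exists_mem_nhds x
    exact ⟨E n, hn, (hr n).integrableOn.congr_fun_ae (hρ n).symm⟩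
  · obtain ⟨n, hn⟩ := E.exists_superset_of_isCompact hK
    rw [hrK n K hK hn]
    exact integral_congr_ae (ae_restrict_of_ae_restrict_of_subset hn (hρ n).symm)

end Density


/-! ### Magnetic translations -/

section MagneticTranslation

/-- The translation of space underlying `magneticTranslation`. -/
def planeShift (R : Plane) (x : Space) : Space := ((x.1.1 - R.1, x.1.2 - R.2), x.2)

theorem measurePreserving_planeShift (R : Plane) :
    MeasurePreserving (planeShift R) (volume : Measure Space) volume :=
  measurePreserving_shift R

theorem planeShift_eq (R : Plane) : planeShift R = Homeomorph.subRight ((R, 0) : Space) := by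
  funext x
  simp [planeShift, Prod.ext_iff]

theorem planeShift_planeShift_neg (R : Plane) (x : Space) :
    planeShift (-R) (planeShift R x) = x := by
  simp [planeShift]

theorem measurableEmbedding_planeShift (R : Plane) : MeasurableEmbedding (planeShift R) := by
  rw [planeShift_eq]
  exact (Homeomorph.subRight ((R, 0) : Space)).measurableEmbedding

theorem isCompact_preimage_planeShift (R : Plane) {K : Set Space} (hK : IsCompact K) :
    IsCompact (planeShift R ⁻¹' K) := by
  rw [planeShift_eq]
  exact (Homeomorph.isCompact_preimage _).2 hK

theorem norm_magneticTranslation (b : ℝ) (R : Plane) (f : L2 Space) :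
    ‖magneticTranslation b R f‖ = ‖f‖ := by
  have h : ‖translation R f‖ = ‖f‖ :=
    (Lp.compMeasurePreservingₗᵢ ℂ _ (measurePreserving_shift R)).norm_map f
  rw [← h]
  have h2 : ‖magneticTranslation b R f‖ ≤ ‖translation R f‖ ∧
      ‖translation R f‖ ≤ ‖magneticTranslation b R f‖ := by
    have h1 : ∀ᵐ x, ‖magneticTranslation b R f x‖ = ‖translation R f x‖ := by
      filter_upwards [mulOp_ae _ (measurable_phase b R) (norm_phase_le b R) (translation R f)]
        with x hx
      refine (congrArg _ hx).trans ?_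
      rw [norm_mul, Complex.norm_exp]
      simp
    exact ⟨Lp.norm_le_norm_of_ae_le (h1.mono fun x hx => hx.le),
      Lp.norm_le_norm_of_ae_le (h1.mono fun x hx => hx.ge)⟩
  exact le_antisymm h2.1 h2.2

/-- The magnetic translations form a projective representation: `𝔪_R 𝔪_{-R}` is a phase. -/
theorem magneticTranslation_neg_apply (b : ℝ) (R : Plane) (f : L2 Space) :
    magneticTranslation b R (magneticTranslation b (-R) f) =
      Complex.exp (-(Complex.I * ((b * R.1 * R.2 : ℝ) : ℂ))) • f := by
  refine Lp.ext ?_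
  filter_upwards [magneticTranslation_ae b R (magneticTranslation b (-R) f),
    (measurePreserving_planeShift R).quasiMeasurePreserving.ae (magneticTranslation_ae b (-R) f),
    Lp.coeFn_smul (Complex.exp (-(Complex.I * ((b * R.1 * R.2 : ℝ) : ℂ)))) f] with x h1 h2 h3
  rw [h1, h3, Pi.smul_apply, smul_eq_mul]
  change _ * (magneticTranslation b (-R) f) (planeShift R x) = _
  rw [h2]
  simp only [planeShift, Prod.fst_neg, Prod.snd_neg, sub_neg_eq_add, sub_add_cancel]
  rw [← mul_assoc, ← Complex.exp_add]
  congr 2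
  push_cast
  ring

theorem adjoint_magneticTranslation_comp_self (b : ℝ) (R : Plane) :
    (magneticTranslation b R).adjoint ∘L magneticTranslation b R = 1 := by
  rw [← ContinuousLinearMap.norm_map_iff_adjoint_comp_self]
  exact norm_magneticTranslation b R

theorem adjoint_magneticTranslation (b : ℝ) (R : Plane) (f : L2 Space) :
    (magneticTranslation b R).adjoint f =
      Complex.exp (Complex.I * ((b * R.1 * R.2 : ℝ) : ℂ)) • magneticTranslation b (-R) f := by
  have h := congrArg (Complex.exp (Complex.I * ((b * R.1 * R.2 : ℝ) : ℂ)) • ·)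
    (magneticTranslation_neg_apply b R f)
  simp only [smul_smul, ← Complex.exp_add, add_neg_cancel, Complex.exp_zero, one_smul] at h
  rw [← map_smul] at h
  conv_lhs => rw [← h]
  exact DFunLike.congr_fun (adjoint_magneticTranslation_comp_self b R) _

theorem magneticTranslation_comp_adjoint (b : ℝ) (R : Plane) :
    magneticTranslation b R ∘L (magneticTranslation b R).adjoint = 1 := by
  ext1 f
  rw [ContinuousLinearMap.comp_apply, adjoint_magneticTranslation, map_smul,
    magneticTranslation_neg_apply, smul_smul, ← Complex.exp_add]
  simp

theorem indicatorOp_comp_magneticTranslation (b : ℝ) (R : Plane) (K : Set Space)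
    (hK : MeasurableSet K) :
    indicatorOp (planeShift R ⁻¹' K) ((measurePreserving_planeShift R).measurable hK) ∘L
      magneticTranslation b R = magneticTranslation b R ∘L indicatorOp K hK := by
  ext1 f
  refine Lp.ext ?_
  filter_upwards [indicatorOp_ae (planeShift R ⁻¹' K)
      ((measurePreserving_planeShift R).measurable hK) (magneticTranslation b R f),
    magneticTranslation_ae b R f, magneticTranslation_ae b R (indicatorOp K hK f),
    (measurePreserving_planeShift R).quasiMeasurePreserving.ae (indicatorOp_ae K hK f)]
    with x h1 h2 h3 h4
  rw [ContinuousLinearMap.comp_apply, ContinuousLinearMap.comp_apply, h1, h3]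
  change _ = _ * (indicatorOp K hK f) (planeShift R x)
  rw [h4]
  by_cases hx : x ∈ planeShift R ⁻¹' K
  · rw [Set.indicator_of_mem hx, Set.indicator_of_mem (show planeShift R x ∈ K from hx), h2]
    rfl
  · rw [Set.indicator_of_notMem hx, Set.indicator_of_notMem (show planeShift R x ∉ K from hx),
      mul_zero]

end MagneticTranslation

/-! ### Translation invariance of the density -/

section Invariance

theorem opTrace_conj_of_adjoint_comp_self {H : Type} [NormedAddCommGroup H]
    [InnerProductSpace ℂ H] [CompleteSpace H] {U T : H →L[ℂ] H} (hU : U.adjoint ∘L U = 1)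
    (hT : IsTraceClass T) : opTrace (U ∘L T ∘L U.adjoint) = opTrace T := by
  obtain ⟨A, B, hA, hB, rfl⟩ := hT
  rw [opTrace_comp_comm hA hB]
  have h : opTrace ((U ∘L A) ∘L (B ∘L U.adjoint)) = opTrace ((B ∘L U.adjoint) ∘L (U ∘L A)) :=
    opTrace_comp_comm (hA.comp_left _) (hB.comp_right _)
  have h2 : (B ∘L U.adjoint) ∘L (U ∘L A) = B ∘L (U.adjoint ∘L U) ∘L A := rfl
  rw [h2, hU] at h
  exact h

/-- `𝔪_R` conjugates the localization of `γ` to `K` into the localization to the translate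
of `K`. -/
theorem opTrace_compression_planeShift {b : ℝ} {γ : L2 Space →L[ℂ] L2 Space}
    (hmag : ∀ R : Plane, γ ∘L magneticTranslation b R = magneticTranslation b R ∘L γ)
    (hγ : IsLocallyTraceClass γ) (R : Plane) {K : Set Space} (hK : IsCompact K) :
    opTrace (compression (planeShift R ⁻¹' K) (isCompact_preimage_planeShift R hK) γ) =
      opTrace (compression K hK γ) := by
  rw [← opTrace_conj_of_adjoint_comp_self (adjoint_magneticTranslation_comp_self b R) (hγ K hK)]
  congr 1
  set m := magneticTranslation b R
  set χ := indicatorOp K hK.measurableSet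
  set χ' := indicatorOp (planeShift R ⁻¹' K) (isCompact_preimage_planeShift R hK).measurableSet
  have h1 : χ' ∘L m = m ∘L χ := indicatorOp_comp_magneticTranslation b R K hK.measurableSet
  have h2 : m ∘L m.adjoint = 1 := magneticTranslation_comp_adjoint b R
  have h3 : γ ∘L m = m ∘L γ := hmag R
  calc χ' ∘L γ ∘L χ' = χ' ∘L γ ∘L χ' ∘L (m ∘L m.adjoint) := by rw [h2]; rfl
    _ = χ' ∘L γ ∘L (χ' ∘L m) ∘L m.adjoint := rfl
    _ = χ' ∘L (γ ∘L m) ∘L χ ∘L m.adjoint := by rw [h1]; rfl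
    _ = (χ' ∘L m) ∘L γ ∘L χ ∘L m.adjoint := by rw [h3]; rfl
    _ = m ∘L (χ ∘L γ ∘L χ) ∘L m.adjoint := by rw [h1]; rfl

theorem density_comp_planeShift {b : ℝ} {γ : L2 Space →L[ℂ] L2 Space}
    (hmag : ∀ R : Plane, γ ∘L magneticTranslation b R = magneticTranslation b R ∘L γ)
    {ρ : Space → ℂ} (hρ : IsDensity γ ρ) (R : Plane) :
    (fun x => ρ (planeShift R x)) =ᵐ[volume] ρ := by
  have hmp := measurePreserving_planeShift R
  have hloc : LocallyIntegrable (fun x => ρ (planeShift R x)) (volume : Measure Space) := by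
    rw [locallyIntegrable_iff]
    intro K hK
    have hK' := isCompact_preimage_planeShift (-R) hK
    have h := (hmp.integrableOn_comp_preimage (measurableEmbedding_planeShift R)).2
      (hρ.2.1.integrableOn_isCompact hK')
    refine h.mono_set fun x hx => ?_
    change planeShift (-R) (planeShift R x) ∈ K
    rwa [planeShift_planeShift_neg]
  have h0 := ae_eq_zero_of_forall_setIntegral_isCompact_eq_zero' (hloc.sub hρ.2.1) fun K hK => by
    have hK' := isCompact_preimage_planeShift (-R) hK
    have hKK : planeShift R ⁻¹' (planeShift (-R) ⁻¹' K) = K := by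
      ext x
      simp [planeShift_planeShift_neg]
    have h1 : ∫ x in K, ρ (planeShift R x) = ∫ x in planeShift (-R) ⁻¹' K, ρ x := by
      have h := hmp.setIntegral_preimage_emb (measurableEmbedding_planeShift R) ρ
        (planeShift (-R) ⁻¹' K)
      rwa [hKK] at h
    have h2 := opTrace_compression_planeShift hmag hρ.1 (-R) hK
    rw [hρ.2.2 _ hK, hρ.2.2] at h2
    rw [integral_sub' (hloc.integrableOn_isCompact hK) (hρ.2.1.integrableOn_isCompact hK), h1, h2,
      sub_self]
  filter_upwards [h0] with x hx
  exact sub_eq_zero.1 hx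

/-- A function invariant under all translations of the plane is a function of `x₃` alone: by
Fubini's theorem, almost every slice `ρ (y, ·)` represents it. -/
theorem exists_eq_snd_of_planeShift {ρ : Space → ℂ} (hm : AEStronglyMeasurable ρ volume)
    (h : ∀ R : Plane, (fun x => ρ (planeShift R x)) =ᵐ[volume] ρ) :
    ∃ r : ℝ → ℂ, ρ =ᵐ[volume] fun x => r x.2 := by
  obtain ⟨σ, hσ, hρσ⟩ := hm
  have hσm : Measurable σ := hσ.measurable
  have hσR : ∀ R : Plane, ∫⁻ y : Plane, ∫⁻ z : ℝ, ‖σ (y, z) - σ (y - R, z)‖ₑ = 0 := fun R => by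
    have hmeas : Measurable fun x : Space => ‖σ x - σ (x.1 - R, x.2)‖ₑ := by fun_prop
    rw [← lintegral_prod (fun x : Space => ‖σ x - σ (x.1 - R, x.2)‖ₑ) hmeas.aemeasurable,
      lintegral_eq_zero_iff hmeas]
    filter_upwards [h R, hρσ, (measurePreserving_planeShift R).quasiMeasurePreserving.ae hρσ]
      with x h1 h2 h3
    have h4 : σ (x.1 - R, x.2) = σ x := by
      rw [← h2, ← h1, h3]
      rfl
    simp [h4]
  have hmeas2 : Measurable fun p : Plane × Plane =>
      ∫⁻ z : ℝ, ‖σ (p.2, z) - σ (p.2 - p.1, z)‖ₑ := by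
    refine Measurable.lintegral_prod_right'
      (f := fun q : (Plane × Plane) × ℝ => ‖σ (q.1.2, q.2) - σ (q.1.2 - q.1.1, q.2)‖ₑ) ?_
    fun_prop
  have hz : ∫⁻ y : Plane, ∫⁻ R : Plane, ∫⁻ z : ℝ, ‖σ (y, z) - σ (y - R, z)‖ₑ = 0 := by
    rw [lintegral_lintegral_swap (f := fun y R => ∫⁻ z : ℝ, ‖σ (y, z) - σ (y - R, z)‖ₑ)
      (hmeas2.comp measurable_swap).aemeasurable]
    simp [hσR]
  rw [lintegral_eq_zero_iff (Measurable.lintegral_prod_right'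
    (f := fun q : Plane × Plane => ∫⁻ z : ℝ, ‖σ (q.1, z) - σ (q.1 - q.2, z)‖ₑ)
    (hmeas2.comp measurable_swap))] at hz
  obtain ⟨y, hy⟩ := hz.exists
  refine ⟨fun z => σ (y, z), hρσ.trans ?_⟩
  replace hy : ∫⁻ R : Plane, ∫⁻ z : ℝ, ‖σ (y, z) - σ (y - R, z)‖ₑ = 0 := hy
  rw [lintegral_sub_left_eq_self (fun w => ∫⁻ z : ℝ, ‖σ (y, z) - σ (w, z)‖ₑ) y]
    at hy
  have hmeas : Measurable fun x : Space => ‖σ (y, x.2) - σ x‖ₑ := by fun_prop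
  rw [← lintegral_prod (fun x : Space => ‖σ (y, x.2) - σ x‖ₑ) hmeas.aemeasurable,
    ← Measure.volume_eq_prod, lintegral_eq_zero_iff hmeas] at hy
  filter_upwards [hy] with x hx
  have : σ (y, x.2) - σ x = 0 := by simpa using hx
  exact (sub_eq_zero.1 this).symm

theorem IsDensity.congr {X : Type} [MeasureSpace X] [TopologicalSpace X] [T2Space X]
    [OpensMeasurableSpace X] {T : L2 X →L[ℂ] L2 X} {ρ ρ' : X → ℂ} (h : IsDensity T ρ)
    (hρ : ρ =ᵐ[volume] ρ') : IsDensity T ρ' :=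
  ⟨h.1, h.2.1.congr hρ, fun K hK => (h.2.2 K hK).trans (integral_congr_ae (ae_restrict_of_ae hρ))⟩

/-- The density of an operator commuting with the magnetic translations depends on `x₃` alone. -/
theorem exists_density_snd {b : ℝ} {γ : L2 Space →L[ℂ] L2 Space}
    (hmag : ∀ R : Plane, γ ∘L magneticTranslation b R = magneticTranslation b R ∘L γ)
    (hγ : IsLocallyTraceClass γ) : ∃ r : ℝ → ℂ, IsDensity γ fun x => r x.2 := by
  obtain ⟨ρ, hρ⟩ := exists_density hγ
  obtain ⟨r, hr⟩ := exists_eq_snd_of_planeShift hρ.2.1.aestronglyMeasurable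
    (density_comp_planeShift hmag hρ)
  exact ⟨r, hρ.congr hr⟩

end Invariance


/-! ### The tensor product -/

section Tensor

theorem tensor_ae (f : L2 Plane) (g : L2 ℝ) :
    tensor f g =ᵐ[volume] fun x : Space => f x.1 * g x.2 :=
  (memLp_tensor f g).coeFn_toLp

theorem ae_fst {p : Plane → Prop} (h : ∀ᵐ y, p y) : ∀ᵐ x : Space, p x.1 :=
  Measure.quasiMeasurePreserving_fst.ae h

theorem ae_snd {p : ℝ → Prop} (h : ∀ᵐ z, p z) : ∀ᵐ x : Space, p x.2 :=
  Measure.quasiMeasurePreserving_snd.ae h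

theorem inner_tensor (f f' : L2 Plane) (g g' : L2 ℝ) :
    ⟪tensor f g, tensor f' g'⟫_ℂ = ⟪f, f'⟫_ℂ * ⟪g, g'⟫_ℂ := by
  rw [L2_inner_eq, L2_inner_eq, L2_inner_eq, ← integral_prod_mul]
  refine integral_congr_ae ?_
  filter_upwards [tensor_ae f g, tensor_ae f' g'] with x h1 h2
  rw [h1, h2, map_mul]
  ring

theorem norm_tensor (f : L2 Plane) (g : L2 ℝ) : ‖tensor f g‖ = ‖f‖ * ‖g‖ := by
  have h := inner_tensor f f g g
  simp only [inner_self_eq_norm_sq_to_K] at h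
  have h2 : ‖tensor f g‖ ^ 2 = (‖f‖ * ‖g‖) ^ 2 := by
    rw [mul_pow]
    exact Complex.ofReal_injective (by push_cast; exact h)
  exact (pow_left_inj₀ (norm_nonneg _) (by positivity) two_ne_zero).1 h2

theorem tensor_add_left (f f' : L2 Plane) (g : L2 ℝ) :
    tensor (f + f') g = tensor f g + tensor f' g := by
  refine Lp.ext ?_
  filter_upwards [tensor_ae (f + f') g, tensor_ae f g, tensor_ae f' g,
    Lp.coeFn_add (tensor f g) (tensor f' g), ae_fst (Lp.coeFn_add f f')] with x h1 h2 h3 h4 h5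
  rw [h1, h4, Pi.add_apply, h2, h3, h5, Pi.add_apply, add_mul]

theorem tensor_add_right (f : L2 Plane) (g g' : L2 ℝ) :
    tensor f (g + g') = tensor f g + tensor f g' := by
  refine Lp.ext ?_
  filter_upwards [tensor_ae f (g + g'), tensor_ae f g, tensor_ae f g',
    Lp.coeFn_add (tensor f g) (tensor f g'), ae_snd (Lp.coeFn_add g g')] with x h1 h2 h3 h4 h5
  rw [h1, h4, Pi.add_apply, h2, h3, h5, Pi.add_apply, mul_add]

theorem tensor_smul_left (c : ℂ) (f : L2 Plane) (g : L2 ℝ) :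
    tensor (c • f) g = c • tensor f g := by
  refine Lp.ext ?_
  filter_upwards [tensor_ae (c • f) g, tensor_ae f g,
    Lp.coeFn_smul c (tensor f g), ae_fst (Lp.coeFn_smul c f)] with x h1 h2 h3 h4
  rw [h1, h3, Pi.smul_apply, h2, h4, Pi.smul_apply, smul_mul_assoc]

theorem tensor_smul_right (c : ℂ) (f : L2 Plane) (g : L2 ℝ) :
    tensor f (c • g) = c • tensor f g := by
  refine Lp.ext ?_
  filter_upwards [tensor_ae f (c • g), tensor_ae f g,
    Lp.coeFn_smul c (tensor f g), ae_snd (Lp.coeFn_smul c g)] with x h1 h2 h3 h4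
  rw [h1, h3, Pi.smul_apply, h2, h4, Pi.smul_apply, mul_smul_comm]

/-- The tensor product as a continuous bilinear map. -/
noncomputable def tensorL : L2 Plane →L[ℂ] L2 ℝ →L[ℂ] L2 Space :=
  LinearMap.mkContinuous₂
    (LinearMap.mk₂ ℂ tensor tensor_add_left tensor_smul_left tensor_add_right tensor_smul_right)
    1 fun f g => by rw [one_mul]; exact (norm_tensor f g).le

@[simp]
theorem tensorL_apply (f : L2 Plane) (g : L2 ℝ) : tensorL f g = tensor f g := rfl

/-- A function in `L²(ℝ³)` orthogonal to all `f ⊗ g` has vanishing integrals over the measurable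
rectangles in a compact box, hence over all measurable subsets of the box. -/
theorem eq_zero_of_forall_inner_tensor (F : L2 Space)
    (h : ∀ (f : L2 Plane) (g : L2 ℝ), ⟪tensor f g, F⟫_ℂ = 0) : F = 0 := by
  let A₀ : ℕ → Set Plane := fun n => Metric.closedBall 0 n
  let B₀ : ℕ → Set ℝ := fun n => Metric.closedBall 0 n
  have hA₀ : ∀ n, volume (A₀ n) < ⊤ := fun n => measure_closedBall_lt_top
  have hB₀ : ∀ n, volume (B₀ n) < ⊤ := fun n => measure_closedBall_lt_top
  have mA₀ : ∀ n, MeasurableSet (A₀ n) := fun n => measurableSet_closedBall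
  have mB₀ : ∀ n, MeasurableSet (B₀ n) := fun n => measurableSet_closedBall
  have hQ : ∀ n, volume (A₀ n ×ˢ B₀ n) < ⊤ := fun n => by
    rw [Measure.volume_eq_prod, Measure.prod_prod]
    exact ENNReal.mul_lt_top (hA₀ n) (hB₀ n)
  have hzero : ∀ n, ∀ᵐ x ∂(volume.restrict (A₀ n ×ˢ B₀ n)), F x = 0 := fun n => by
    have : IsFiniteMeasure (volume.restrict (A₀ n ×ˢ B₀ n)) := ⟨by simpa using hQ n⟩
    have hint : Integrable F (volume.restrict (A₀ n ×ˢ B₀ n)) :=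
      ((Lp.memLp F).restrict _).integrable one_le_two
    have hrect : ∀ (A : Set Plane) (B : Set ℝ), MeasurableSet A → MeasurableSet B →
        ∫ x in A ×ˢ B, F x ∂(volume.restrict (A₀ n ×ˢ B₀ n)) = 0 := fun A B hA hB => by
      rw [Measure.restrict_restrict (hA.prod hB), Set.prod_inter_prod]
      have hA' : volume (A ∩ A₀ n) ≠ ⊤ :=
        ((measure_mono Set.inter_subset_right).trans_lt (hA₀ n)).ne
      have hB' : volume (B ∩ B₀ n) ≠ ⊤ :=
        ((measure_mono Set.inter_subset_right).trans_lt (hB₀ n)).ne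
      rw [← h (indicatorConstLp 2 (hA.inter (mA₀ n)) hA' 1)
        (indicatorConstLp 2 (hB.inter (mB₀ n)) hB' 1), L2_inner_eq, ← integral_indicator
        ((hA.inter (mA₀ n)).prod (hB.inter (mB₀ n)))]
      refine integral_congr_ae ?_
      filter_upwards [tensor_ae (indicatorConstLp 2 (hA.inter (mA₀ n)) hA' 1)
        (indicatorConstLp 2 (hB.inter (mB₀ n)) hB' 1),
        ae_fst (indicatorConstLp_coeFn (p := 2) (hs := hA.inter (mA₀ n)) (hμs := hA')
          (c := (1 : ℂ))),
        ae_snd (indicatorConstLp_coeFn (p := 2) (hs := hB.inter (mB₀ n)) (hμs := hB')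
          (c := (1 : ℂ)))] with x h1 h2 h3
      rw [h1, h2, h3]
      by_cases h4 : x.1 ∈ A ∩ A₀ n <;> by_cases h5 : x.2 ∈ B ∩ B₀ n <;>
        simp only [Set.indicator, Set.mem_prod, h4, h5, and_self, and_true, and_false, if_true,
          if_false, map_zero, map_one, mul_zero, zero_mul, one_mul]
    refine hint.ae_eq_zero_of_forall_setIntegral_eq_zero fun s hs _ => ?_
    refine MeasurableSpace.induction_on_inter
      (C := fun s _ => ∫ x in s, F x ∂(volume.restrict (A₀ n ×ˢ B₀ n)) = 0)
      generateFrom_prod.symm isPiSystem_prod ?_ ?_ ?_ ?_ s hs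
    · simp
    · rintro _ ⟨A, hA, B, hB, rfl⟩
      exact hrect A B hA hB
    · intro t ht ih
      have h1 := integral_add_compl ht hint
      have h2 := hrect Set.univ Set.univ MeasurableSet.univ MeasurableSet.univ
      rw [Set.univ_prod_univ, Measure.restrict_univ] at h2
      rwa [ih, h2, zero_add] at h1
    · intro t hd ht ih
      rw [integral_iUnion ht hd hint.integrableOn]
      simp [ih]
  rw [Lp.eq_zero_iff_ae_eq_zero]
  have hU : (⋃ n, A₀ n ×ˢ B₀ n) = Set.univ := by
    refine Set.eq_univ_of_forall fun x => ?_
    obtain ⟨n, hn⟩ := exists_nat_ge ‖x‖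
    refine Set.mem_iUnion.2 ⟨n, ?_, ?_⟩
    · simpa [A₀] using (norm_fst_le x).trans hn
    · simpa [B₀] using (norm_snd_le x).trans hn
  have h := (ae_restrict_iUnion_iff _ _).2 hzero
  rwa [hU, Measure.restrict_univ] at h

variable {ι κ : Type*}

theorem orthonormal_tensor {e : ι → L2 Plane} {q : κ → L2 ℝ} (he : Orthonormal ℂ e)
    (hq : Orthonormal ℂ q) : Orthonormal ℂ fun p : ι × κ => tensor (e p.1) (q p.2) := by
  classical
  rw [orthonormal_iff_ite] at he hq ⊢
  rintro ⟨i, l⟩ ⟨j, m⟩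
  rw [inner_tensor, he, hq]
  by_cases h1 : i = j <;> by_cases h2 : l = m <;> simp [h1, h2]

theorem _root_.HilbertBasis.ext_continuousLinearMap {H E : Type*} [NormedAddCommGroup H]
    [InnerProductSpace ℂ H] [NormedAddCommGroup E] [NormedSpace ℂ E] (e : HilbertBasis ι ℂ H)
    {A B : H →L[ℂ] E} (h : ∀ i, A (e i) = B (e i)) : A = B := by
  refine ContinuousLinearMap.ext_on (s := Set.range e)
    (Submodule.dense_iff_topologicalClosure_eq_top.2 e.dense_span) ?_
  rintro _ ⟨i, rfl⟩
  exact h i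

theorem eq_zero_of_forall_inner_tensor_basis (e : HilbertBasis ι ℂ (L2 Plane))
    (q : HilbertBasis κ ℂ (L2 ℝ)) (F : L2 Space) (h : ∀ i l, ⟪tensor (e i) (q l), F⟫_ℂ = 0) :
    F = 0 := by
  have h1 : ∀ i g, ⟪tensor (e i) g, F⟫_ℂ = 0 := fun i g => by
    have hT : (innerSL ℂ F) ∘L tensorL (e i) = 0 := q.ext_continuousLinearMap fun l => by
      simpa using inner_eq_zero_symm.1 (h i l)
    exact inner_eq_zero_symm.1 (DFunLike.congr_fun hT g)
  refine eq_zero_of_forall_inner_tensor F fun f g => ?_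
  have hT : (innerSL ℂ F) ∘L tensorL.flip g = 0 := e.ext_continuousLinearMap fun i => by
    simpa using inner_eq_zero_symm.1 (h1 i g)
  exact inner_eq_zero_symm.1 (DFunLike.congr_fun hT f)

/-- The Hilbert basis `eᵢ ⊗ qₗ` of `L²(ℝ³)`. -/
noncomputable def tensorBasis (e : HilbertBasis ι ℂ (L2 Plane)) (q : HilbertBasis κ ℂ (L2 ℝ)) :
    HilbertBasis (ι × κ) ℂ (L2 Space) :=
  HilbertBasis.mkOfOrthogonalEqBot (orthonormal_tensor e.orthonormal q.orthonormal) <| by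
    rw [Submodule.eq_bot_iff]
    intro F hF
    refine eq_zero_of_forall_inner_tensor_basis e q F fun i l => ?_
    exact (Submodule.mem_orthogonal _ _).1 hF _ (Submodule.subset_span ⟨(i, l), rfl⟩)

theorem tensorBasis_apply (e : HilbertBasis ι ℂ (L2 Plane)) (q : HilbertBasis κ ℂ (L2 ℝ))
    (p : ι × κ) : tensorBasis e q p = tensor (e p.1) (q p.2) := by
  rw [tensorBasis, HilbertBasis.coe_mkOfOrthogonalEqBot]

end Tensor


/-! ### Gaussians as Schwartz functions -/

section Gaussian

variable {E : Type*} [NormedAddCommGroup E] [NormedSpace ℝ E]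

/-- All derivatives of the exponential function at `z` are those at `0`, multiplied by `exp z`. -/
theorem iteratedFDeriv_cexp (n : ℕ) (z : ℂ) :
    iteratedFDeriv ℝ n Complex.exp z = Complex.exp z • iteratedFDeriv ℝ n Complex.exp 0 := by
  have h : (fun w => Complex.exp (w + z)) = fun w => Complex.exp z • Complex.exp w := by
    funext w
    rw [Complex.exp_add, smul_eq_mul, mul_comm]
  have h1 := iteratedFDeriv_comp_add_right (𝕜 := ℝ) (f := Complex.exp) n z 0
  rw [zero_add] at h1
  rw [← h1, h, iteratedFDeriv_const_smul_apply' (Complex.contDiff_exp (𝕜 := ℝ)).contDiffAt]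

theorem exists_bound_exp_neg_sq {q : ℝ} (hq : 0 < q) (N : ℕ) :
    ∃ C : ℝ, 0 ≤ C ∧ ∀ r : ℝ, 0 ≤ r → (1 + r) ^ N * Real.exp (-q * r ^ 2) ≤ C := by
  refine ⟨N.factorial * Real.exp (1 + 1 / (4 * q)), by positivity, fun r hr => ?_⟩
  have h1 : (1 + r) ^ N ≤ N.factorial * Real.exp (1 + r) := by
    have := Real.pow_div_factorial_le_exp (1 + r) (by positivity) N
    rwa [div_le_iff₀ (by positivity), mul_comm] at this
  have h2 : 1 + r + -q * r ^ 2 ≤ 1 + 1 / (4 * q) := by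
    have h3 : 1 / (4 * q) - r + q * r ^ 2 = q * (r - 1 / (2 * q)) ^ 2 := by
      field_simp
      ring
    have h4 : 0 ≤ q * (r - 1 / (2 * q)) ^ 2 := by positivity
    linarith
  calc _ ≤ (N.factorial * Real.exp (1 + r)) * Real.exp (-q * r ^ 2) := by gcongr
    _ = N.factorial * Real.exp (1 + r + -q * r ^ 2) := by
      rw [Real.exp_add (1 + r)]; ring
    _ ≤ _ := by gcongr

/-- The Schwartz function `exp Q`, for a function `Q` of temperate growth whose real part is
bounded above by a negative multiple of `‖x‖²`. -/
noncomputable def gaussianSchwartz (Q : E → ℂ) (hQ : Q.HasTemperateGrowth) (q : ℝ) (hq : 0 < q)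
    (h : ∀ x, (Q x).re ≤ -q * ‖x‖ ^ 2) : SchwartzMap E ℂ where
  toFun x := Complex.exp (Q x)
  smooth' := hQ.1.cexp
  decay' := by
    intro k n
    obtain ⟨m, C, hC0, hC⟩ := hQ.norm_iteratedFDeriv_le_uniform n
    obtain ⟨B, hB0, hB⟩ := exists_bound_exp_neg_sq hq (k + m * n)
    set M := ∑ i ∈ Finset.range (n + 1), ‖iteratedFDeriv ℝ i Complex.exp 0‖ with hM
    have hM0 : 0 ≤ M := Finset.sum_nonneg fun _ _ => norm_nonneg _
    refine ⟨n.factorial * M * (max 1 C) ^ n * B, fun x => ?_⟩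
    have hx : 1 ≤ 1 + ‖x‖ := by linarith [norm_nonneg x]
    have h1 : ‖iteratedFDeriv ℝ n (Complex.exp ∘ Q) x‖ ≤
        n.factorial * (‖Complex.exp (Q x)‖ * M) * (max 1 C * (1 + ‖x‖) ^ m) ^ n := by
      refine norm_iteratedFDeriv_comp_le (N := ∞) Complex.contDiff_exp hQ.1
        (mod_cast le_top) x ?_ ?_
      · intro i hi
        rw [iteratedFDeriv_cexp, norm_smul]
        gcongr
        exact Finset.single_le_sum (f := fun i => ‖iteratedFDeriv ℝ i Complex.exp 0‖)
          (fun _ _ => norm_nonneg _) (Finset.mem_range.2 (by omega))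
      · intro i hi hin
        refine (hC i hin x).trans ?_
        refine (mul_le_mul_of_nonneg_right (le_max_right 1 C) (by positivity)).trans ?_
        exact le_self_pow₀ (one_le_mul_of_one_le_of_one_le (le_max_left _ _)
          (one_le_pow₀ hx)) (by omega)
    have h2 : ‖Complex.exp (Q x)‖ ≤ Real.exp (-q * ‖x‖ ^ 2) := by
      rw [Complex.norm_exp]
      exact Real.exp_le_exp.2 (h x)
    have h3 : ‖x‖ ^ k ≤ (1 + ‖x‖) ^ k := by gcongr; linarith
    calc ‖x‖ ^ k * ‖iteratedFDeriv ℝ n (Complex.exp ∘ Q) x‖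
        ≤ (1 + ‖x‖) ^ k * (n.factorial * (Real.exp (-q * ‖x‖ ^ 2) * M) *
          (max 1 C * (1 + ‖x‖) ^ m) ^ n) := by
          gcongr
          refine h1.trans ?_
          gcongr
      _ = n.factorial * M * (max 1 C) ^ n *
          ((1 + ‖x‖) ^ (k + m * n) * Real.exp (-q * ‖x‖ ^ 2)) := by
          rw [mul_pow, ← pow_mul, pow_add]; ring
      _ ≤ _ := by gcongr; exact hB _ (norm_nonneg _)

end Gaussian

/-! ### Kinetic momenta, generators of the magnetic translations, and ladder operators -/

section Ladder

/-- Schwartz functions on the plane. -/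
abbrev SPlane : Type := SchwartzMap Plane ℂ

open LineDeriv SchwartzMap

/-- The derivative `∂₁` on Schwartz functions. -/
noncomputable def D₁ : SPlane →L[ℂ] SPlane := lineDerivOpCLM ℂ SPlane ((1, 0) : Plane)
/-- The derivative `∂₂` on Schwartz functions. -/
noncomputable def D₂ : SPlane →L[ℂ] SPlane := lineDerivOpCLM ℂ SPlane ((0, 1) : Plane)
/-- Multiplication by the coordinate `x₁` on Schwartz functions. -/
noncomputable def X₁ : SPlane →L[ℂ] SPlane := smulLeftCLM ℂ fun x : Plane => (x.1 : ℂ)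
/-- Multiplication by the coordinate `x₂` on Schwartz functions. -/
noncomputable def X₂ : SPlane →L[ℂ] SPlane := smulLeftCLM ℂ fun x : Plane => (x.2 : ℂ)

theorem hasTemperateGrowth_fst : (fun x : Plane => (x.1 : ℂ)).HasTemperateGrowth :=
  (Complex.ofRealCLM ∘L ContinuousLinearMap.fst ℝ ℝ ℝ).hasTemperateGrowth

theorem hasTemperateGrowth_snd : (fun x : Plane => (x.2 : ℂ)).HasTemperateGrowth :=
  (Complex.ofRealCLM ∘L ContinuousLinearMap.snd ℝ ℝ ℝ).hasTemperateGrowth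

theorem X₁_apply (u : SPlane) (x : Plane) : X₁ u x = (x.1 : ℂ) * u x := by
  rw [X₁, smulLeftCLM_apply_apply hasTemperateGrowth_fst, smul_eq_mul]

theorem X₂_apply (u : SPlane) (x : Plane) : X₂ u x = (x.2 : ℂ) * u x := by
  rw [X₂, smulLeftCLM_apply_apply hasTemperateGrowth_snd, smul_eq_mul]

theorem D₁_apply (u : SPlane) (x : Plane) : D₁ u x = fderiv ℝ u x (1, 0) := rfl
theorem D₂_apply (u : SPlane) (x : Plane) : D₂ u x = fderiv ℝ u x (0, 1) := rfl

theorem coe_X₁ (u : SPlane) : ⇑(X₁ u) = fun x => (x.1 : ℂ) * u x := funext (X₁_apply u)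
theorem coe_X₂ (u : SPlane) : ⇑(X₂ u) = fun x => (x.2 : ℂ) * u x := funext (X₂_apply u)

theorem hasFDerivAt_fst (x : Plane) : HasFDerivAt (fun x : Plane => (x.1 : ℂ))
    (Complex.ofRealCLM ∘L ContinuousLinearMap.fst ℝ ℝ ℝ) x :=
  (Complex.ofRealCLM ∘L ContinuousLinearMap.fst ℝ ℝ ℝ).hasFDerivAt

theorem hasFDerivAt_snd (x : Plane) : HasFDerivAt (fun x : Plane => (x.2 : ℂ))
    (Complex.ofRealCLM ∘L ContinuousLinearMap.snd ℝ ℝ ℝ) x :=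
  (Complex.ofRealCLM ∘L ContinuousLinearMap.snd ℝ ℝ ℝ).hasFDerivAt

theorem D₁_X₁ (u : SPlane) : D₁ (X₁ u) = X₁ (D₁ u) + u := by
  ext x
  rw [D₁_apply, coe_X₁, fderiv_fun_mul (hasFDerivAt_fst x).differentiableAt (u.differentiableAt),
    (hasFDerivAt_fst x).fderiv]
  simp [X₁_apply, D₁_apply]

theorem D₁_X₂ (u : SPlane) : D₁ (X₂ u) = X₂ (D₁ u) := by
  ext x
  rw [D₁_apply, coe_X₂, fderiv_fun_mul (hasFDerivAt_snd x).differentiableAt (u.differentiableAt),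
    (hasFDerivAt_snd x).fderiv]
  simp [X₂_apply, D₁_apply]

theorem D₂_X₁ (u : SPlane) : D₂ (X₁ u) = X₁ (D₂ u) := by
  ext x
  rw [D₂_apply, coe_X₁, fderiv_fun_mul (hasFDerivAt_fst x).differentiableAt (u.differentiableAt),
    (hasFDerivAt_fst x).fderiv]
  simp [X₁_apply, D₂_apply]

theorem D₂_X₂ (u : SPlane) : D₂ (X₂ u) = X₂ (D₂ u) + u := by
  ext x
  rw [D₂_apply, coe_X₂, fderiv_fun_mul (hasFDerivAt_snd x).differentiableAt (u.differentiableAt),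
    (hasFDerivAt_snd x).fderiv]
  simp [X₂_apply, D₂_apply]

theorem X₂_X₁ (u : SPlane) : X₂ (X₁ u) = X₁ (X₂ u) := by
  ext x
  simp only [X₁_apply, X₂_apply]
  ring

theorem D₂_D₁ (u : SPlane) : D₂ (D₁ u) = D₁ (D₂ u) := by
  ext x
  have h1 : ∀ v w : Plane, fderiv ℝ (fun y => fderiv ℝ u y v) x w =
      fderiv ℝ (fderiv ℝ u) x w v := fun v w => by
    have hd : DifferentiableAt ℝ (fderiv ℝ u) x :=
      ((u.smooth 2).fderiv_right (m := 1) (by norm_num)).differentiable (by norm_num) x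
    rw [fderiv_clm_apply hd (differentiableAt_const _)]
    simp
  have hs : IsSymmSndFDerivAt ℝ u x := (u.smooth 2).contDiffAt.isSymmSndFDerivAt (by simp)
  exact (h1 (1, 0) (0, 1)).trans ((hs _ _).trans (h1 (0, 1) (1, 0)).symm)

variable (b : ℝ)

/-- The kinetic momentum `p₁ = -i ∂₁` on Schwartz functions. -/
noncomputable def p₁ : SPlane →L[ℂ] SPlane := (-Complex.I) • D₁
/-- The kinetic momentum `p₂ = -i ∂₂ + b x₁` on Schwartz functions. -/
noncomputable def p₂ : SPlane →L[ℂ] SPlane := (-Complex.I) • D₂ + (b : ℂ) • X₁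
/-- The generator `k₁ = -i ∂₁ + b x₂` of the magnetic translations along the first axis. -/
noncomputable def k₁ : SPlane →L[ℂ] SPlane := (-Complex.I) • D₁ + (b : ℂ) • X₂
/-- The generator `k₂ = -i ∂₂` of the magnetic translations along the second axis. -/
noncomputable def k₂ : SPlane →L[ℂ] SPlane := (-Complex.I) • D₂

/-- The sign of `b`, as a complex number. -/
noncomputable def sgn : ℂ := ((b / |b| : ℝ) : ℂ)

/-- The normalization `1 / √(2|b|)` of the ladder operators. -/
noncomputable def ladderNorm : ℂ := (((√(2 * |b|))⁻¹ : ℝ) : ℂ)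

/-- The operator lowering the Landau level. -/
noncomputable def lowerL : SPlane →L[ℂ] SPlane :=
  ladderNorm b • (p₁ - (Complex.I * sgn b) • p₂ b)
/-- The operator raising the Landau level. -/
noncomputable def raiseL : SPlane →L[ℂ] SPlane :=
  ladderNorm b • (p₁ + (Complex.I * sgn b) • p₂ b)
/-- The lowering operator within each Landau level. -/
noncomputable def lowerM : SPlane →L[ℂ] SPlane :=
  ladderNorm b • (k₁ b + (Complex.I * sgn b) • k₂)
/-- The raising operator within each Landau level. -/
noncomputable def raiseM : SPlane →L[ℂ] SPlane :=
  ladderNorm b • (k₁ b - (Complex.I * sgn b) • k₂)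

variable {b}

theorem sgn_mul_self (hb : b ≠ 0) : sgn b * sgn b = 1 := by
  rw [sgn, ← Complex.ofReal_mul, div_mul_div_comm, abs_mul_abs_self,
    div_self (mul_ne_zero hb hb), Complex.ofReal_one]

theorem sgn_mul_b (hb : b ≠ 0) : sgn b * b = (|b| : ℝ) := by
  rw [sgn, ← Complex.ofReal_mul, div_mul_eq_mul_div, ← abs_mul_abs_self b,
    mul_div_assoc, div_self (abs_ne_zero.2 hb), mul_one]

theorem ladderNorm_sq (hb : b ≠ 0) : ladderNorm b * ladderNorm b * (2 * (|b| : ℝ)) = 1 := by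
  have h : 0 < 2 * |b| := by positivity
  have h2 := Real.mul_self_sqrt h.le
  have h3 : (√(2 * |b|))⁻¹ * (√(2 * |b|))⁻¹ * (2 * |b|) = 1 := by
    rw [← mul_inv, h2, inv_mul_cancel₀ h.ne']
  rw [ladderNorm]
  exact_mod_cast h3

/-- The constant in the canonical commutation relations. -/
theorem ladder_const (hb : b ≠ 0) :
    -2 * (ladderNorm b * ladderNorm b) * (Complex.I * Complex.I) * (sgn b * b) = 1 := by
  linear_combination (-2 * (ladderNorm b * ladderNorm b) * (sgn b * b)) * Complex.I_mul_I +
    2 * (ladderNorm b * ladderNorm b) * sgn_mul_b hb + ladderNorm_sq hb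

/-- The canonical commutation relation of the Landau level ladder. -/
theorem lowerL_raiseL (hb : b ≠ 0) (u : SPlane) :
    lowerL b (raiseL b u) = raiseL b (lowerL b u) + u := by
  simp only [lowerL, raiseL, p₁, p₂, smul_apply, add_apply, sub_apply, map_add, map_sub, map_smul,
    D₁_X₁, D₂_X₁, D₂_D₁]
  linear_combination (norm := module) ladder_const hb • u

/-- The canonical commutation relation of the ladder within the Landau levels. -/
theorem lowerM_raiseM (hb : b ≠ 0) (u : SPlane) :
    lowerM b (raiseM b u) = raiseM b (lowerM b u) + u := by
  simp only [lowerM, raiseM, k₁, k₂, smul_apply, add_apply, sub_apply, map_add, map_sub, map_smul,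
    D₁_X₂, D₂_X₂, D₂_D₁]
  linear_combination (norm := module) ladder_const hb • u

theorem p₁_k₁ (u : SPlane) : p₁ (k₁ b u) = k₁ b (p₁ u) := by
  simp only [p₁, k₁, smul_apply, add_apply, map_add, map_smul, D₁_X₂]
  module

theorem p₁_k₂ (u : SPlane) : p₁ (k₂ u) = k₂ (p₁ u) := by
  simp only [p₁, k₂, smul_apply, map_smul, D₂_D₁]

theorem p₂_k₁ (u : SPlane) : p₂ b (k₁ b u) = k₁ b (p₂ b u) := by
  simp only [p₂, k₁, smul_apply, add_apply, map_add, map_smul, D₁_X₁, D₂_X₂, X₂_X₁, D₂_D₁]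
  module

theorem p₂_k₂ (u : SPlane) : p₂ b (k₂ u) = k₂ (p₂ b u) := by
  simp only [p₂, k₂, smul_apply, add_apply, map_add, map_smul, D₂_X₁]
  module

theorem lowerL_raiseM (u : SPlane) : lowerL b (raiseM b u) = raiseM b (lowerL b u) := by
  simp only [lowerL, raiseM, smul_apply, sub_apply, map_sub, map_smul,
    p₁_k₁, p₁_k₂, p₂_k₁, p₂_k₂]
  module

theorem raiseL_raiseM (u : SPlane) : raiseL b (raiseM b u) = raiseM b (raiseL b u) := by
  simp only [raiseL, raiseM, smul_apply, add_apply, sub_apply, map_add, map_sub, map_smul,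
    p₁_k₁, p₁_k₂, p₂_k₁, p₂_k₂]
  module

theorem raiseL_lowerM (u : SPlane) : raiseL b (lowerM b u) = lowerM b (raiseL b u) := by
  simp only [raiseL, lowerM, smul_apply, add_apply, map_add, map_smul,
    p₁_k₁, p₁_k₂, p₂_k₁, p₂_k₂]
  module

/-- The Landau operator on Schwartz functions. -/
noncomputable def landauS (b : ℝ) : SPlane →L[ℂ] SPlane := p₁ ∘L p₁ + p₂ b ∘L p₂ b

/-- The Landau operator is a harmonic oscillator: `L = |b| (2 a† a + 1)`. -/
theorem landauS_eq (hb : b ≠ 0) (u : SPlane) :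
    landauS b u = ((|b| : ℝ) : ℂ) • ((2 : ℂ) • raiseL b (lowerL b u) + u) := by
  have h1 : ladderNorm b * ladderNorm b * (2 * (|b| : ℝ)) = 1 := ladderNorm_sq hb
  have h2 := sgn_mul_self hb
  have h3 := sgn_mul_b hb
  have h4 := Complex.I_mul_I
  have key : raiseL b (lowerL b u) = (ladderNorm b * ladderNorm b) •
      (landauS b u - (Complex.I * sgn b) • (p₁ (p₂ b u) - p₂ b (p₁ u))) := by
    simp only [raiseL, lowerL, landauS, smul_apply, add_apply, sub_apply, map_sub, map_smul,
      ContinuousLinearMap.comp_apply]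
    have h5 : -(Complex.I * sgn b * (Complex.I * sgn b)) = 1 := by
      linear_combination -sgn b * sgn b * h4 + h2
    linear_combination (norm := module) ((ladderNorm b * ladderNorm b) * h5) • (p₂ b (p₂ b u))
  have comm : p₁ (p₂ b u) - p₂ b (p₁ u) = (-Complex.I * b) • u := by
    simp only [p₁, p₂, smul_apply, add_apply, map_add, map_smul, D₁_X₁, D₂_D₁]
    module
  have h6 : (Complex.I * sgn b) * (-Complex.I * b) = ((|b| : ℝ) : ℂ) := by
    linear_combination (-sgn b * b) * h4 + h3
  rw [comm, smul_smul, h6] at key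
  rw [key]
  linear_combination (norm := module) (-h1) • (landauS b u) + (((|b| : ℝ) : ℂ) * h1) • u

/-! ### Pointwise relations -/

/-- The function `λ(y) = b (-y₂ + i sgn(b) y₁) / √(2|b|)`: the difference of `raiseL` and
`lowerM`. -/
noncomputable def ladderShift (b : ℝ) (y : Plane) : ℂ :=
  ladderNorm b * (b * (-(y.2 : ℂ) + Complex.I * sgn b * (y.1 : ℂ)))

theorem conj_sgn (b : ℝ) : starRingEnd ℂ (sgn b) = sgn b := Complex.conj_ofReal _
theorem conj_ladderNorm (b : ℝ) : starRingEnd ℂ (ladderNorm b) = ladderNorm b :=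
  Complex.conj_ofReal _

theorem raiseL_apply (u : SPlane) (y : Plane) :
    raiseL b u y = lowerM b u y + ladderShift b y * u y := by
  simp only [raiseL, lowerM, p₁, p₂, k₁, k₂, ladderShift, smul_apply, add_apply, X₁_apply,
    X₂_apply, smul_eq_mul]
  ring

theorem lowerL_apply (u : SPlane) (y : Plane) :
    lowerL b u y = raiseM b u y + starRingEnd ℂ (ladderShift b y) * u y := by
  simp only [lowerL, raiseM, p₁, p₂, k₁, k₂, ladderShift, smul_apply, add_apply, sub_apply,
    X₁_apply, X₂_apply, smul_eq_mul, map_mul, map_add, map_neg, conj_sgn, conj_ladderNorm,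
    Complex.conj_ofReal, Complex.conj_I]
  ring

theorem norm_sq_ladderShift (hb : b ≠ 0) (y : Plane) :
    ‖ladderShift b y‖ ^ 2 = |b| / 2 * (y.1 ^ 2 + y.2 ^ 2) := by
  have h1 := ladderNorm_sq hb
  have h2 := sgn_mul_self hb
  have h3 := sgn_mul_b hb
  have h5 : ((|b| : ℝ) : ℂ) * ((|b| : ℝ) : ℂ) = b * b := by
    rw [← Complex.ofReal_mul, abs_mul_abs_self, Complex.ofReal_mul]
  apply Complex.ofReal_injective
  rw [← Complex.normSq_eq_norm_sq, ← Complex.mul_conj]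
  simp only [ladderShift, map_mul, map_add, map_neg, conj_sgn, conj_ladderNorm,
    Complex.conj_ofReal, Complex.conj_I]
  push_cast
  have h6 : ladderNorm b * ladderNorm b * (b * b) = ((|b| : ℝ) : ℂ) / 2 := by
    rw [← h5]
    linear_combination ((|b| : ℝ) : ℂ) / 2 * h1
  linear_combination ((y.1 : ℂ) ^ 2 + (y.2 : ℂ) ^ 2) * h6 -
    ladderNorm b * ladderNorm b * b * b * (y.1 : ℂ) ^ 2 * (sgn b * sgn b * Complex.I_mul_I - h2)

/-! ### Symmetry -/

/-- Schwartz functions on the plane as elements of `L²(ℝ²)`. -/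
noncomputable def toL2 : SPlane →L[ℂ] L2 Plane := toLpCLM ℂ ℂ 2 volume

theorem toL2_ae (u : SPlane) : toL2 u =ᵐ[volume] u := u.coeFn_toLp 2 volume

theorem inner_toL2 (u : SPlane) (f : L2 Plane) :
    ⟪toL2 u, f⟫_ℂ = ∫ x, starRingEnd ℂ (u x) * f x := by
  rw [L2_inner_eq]
  refine integral_congr_ae ?_
  filter_upwards [toL2_ae u] with x hx
  rw [hx]

theorem inner_toL2_toL2 (u v : SPlane) :
    ⟪toL2 u, toL2 v⟫_ℂ = ∫ x, starRingEnd ℂ (u x) * v x := by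
  rw [inner_toL2]
  refine integral_congr_ae ?_
  filter_upwards [toL2_ae v] with x hx
  rw [hx]

theorem inner_lineDeriv (m : Plane) (u v : SPlane) :
    ⟪toL2 (lineDerivOpCLM ℂ SPlane m u), toL2 v⟫_ℂ =
      -⟪toL2 u, toL2 (lineDerivOpCLM ℂ SPlane m v)⟫_ℂ := by
  have h := integral_bilinear_lineDerivOp_right_eq_neg_left (μ := (volume : Measure Plane)) u v
    ((ContinuousLinearMap.mul ℝ ℂ) ∘L (Complex.conjCLE : ℂ →L[ℝ] ℂ)) m
  rw [inner_toL2_toL2, inner_toL2_toL2]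
  simp only [lineDerivOpCLM_apply]
  simpa using (neg_eq_iff_eq_neg.2 h).symm

theorem inner_D₁ (u v : SPlane) : ⟪toL2 (D₁ u), toL2 v⟫_ℂ =
    -⟪toL2 u, toL2 (D₁ v)⟫_ℂ := inner_lineDeriv _ u v

theorem inner_D₂ (u v : SPlane) : ⟪toL2 (D₂ u), toL2 v⟫_ℂ =
    -⟪toL2 u, toL2 (D₂ v)⟫_ℂ := inner_lineDeriv _ u v

theorem inner_X₁ (u v : SPlane) : ⟪toL2 (X₁ u), toL2 v⟫_ℂ =
    ⟪toL2 u, toL2 (X₁ v)⟫_ℂ := by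
  rw [inner_toL2_toL2, inner_toL2_toL2]
  simp only [X₁_apply, map_mul, Complex.conj_ofReal]
  congr with x
  ring

theorem inner_X₂ (u v : SPlane) : ⟪toL2 (X₂ u), toL2 v⟫_ℂ =
    ⟪toL2 u, toL2 (X₂ v)⟫_ℂ := by
  rw [inner_toL2_toL2, inner_toL2_toL2]
  simp only [X₂_apply, map_mul, Complex.conj_ofReal]
  congr with x
  ring

theorem inner_raiseL (b : ℝ) (u v : SPlane) :
    ⟪toL2 (raiseL b u), toL2 v⟫_ℂ =
      ⟪toL2 u, toL2 (lowerL b v)⟫_ℂ := by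
  simp only [raiseL, lowerL, p₁, p₂, smul_apply, add_apply, sub_apply, map_add, map_sub,
    map_smul, inner_add_left, inner_smul_left, inner_add_right, inner_sub_right, inner_smul_right,
    inner_D₁, inner_D₂, inner_X₁, map_mul, map_neg, conj_sgn, conj_ladderNorm, Complex.conj_ofReal,
    Complex.conj_I]
  ring

theorem inner_raiseM (b : ℝ) (u v : SPlane) :
    ⟪toL2 (raiseM b u), toL2 v⟫_ℂ =
      ⟪toL2 u, toL2 (lowerM b v)⟫_ℂ := by
  simp only [raiseM, lowerM, k₁, k₂, smul_apply, add_apply, sub_apply, map_add, map_sub,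
    map_smul, inner_add_left, inner_sub_left, inner_smul_left, inner_add_right, inner_smul_right,
    inner_D₁, inner_D₂, inner_X₂, map_mul, map_neg, conj_sgn, conj_ladderNorm, Complex.conj_ofReal,
    Complex.conj_I]
  ring

end Ladder


/-! ### The Landau eigenfunctions -/

section Eigenfunctions

open SchwartzMap

variable {b : ℝ}

/-- The exponent of the ground state. -/
noncomputable def vacuumExponent (b : ℝ) (x : Plane) : ℂ :=
  -(((|b| / 4 : ℝ) : ℂ) * ((x.1 : ℂ) * (x.1 : ℂ) + (x.2 : ℂ) * (x.2 : ℂ))) -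
    Complex.I * ((b / 2 : ℝ) : ℂ) * ((x.1 : ℂ) * (x.2 : ℂ))

theorem hasTemperateGrowth_vacuumExponent (b : ℝ) : (vacuumExponent b).HasTemperateGrowth := by
  have h1 := hasTemperateGrowth_fst
  have h2 := hasTemperateGrowth_snd
  exact (((Function.HasTemperateGrowth.const _).mul ((h1.mul h1).add (h2.mul h2))).neg).sub
    ((Function.HasTemperateGrowth.const _).mul (h1.mul h2))

theorem re_vacuumExponent (b : ℝ) (x : Plane) :
    (vacuumExponent b x).re = -(|b| / 4) * (x.1 ^ 2 + x.2 ^ 2) := by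
  simp only [vacuumExponent, Complex.sub_re, Complex.neg_re, Complex.mul_re, Complex.add_re,
    Complex.mul_im, Complex.add_im, Complex.ofReal_re, Complex.ofReal_im, Complex.I_re,
    Complex.I_im]
  ring

/-- The norm of `ℝ × ℝ` is the maximum norm, which is bounded by the Euclidean one. -/
theorem norm_sq_le_sq_add_sq (x : Plane) : ‖x‖ ^ 2 ≤ x.1 ^ 2 + x.2 ^ 2 := by
  rw [Prod.norm_def]
  rcases max_choice ‖x.1‖ ‖x.2‖ with h | h <;> rw [h, Real.norm_eq_abs, sq_abs] <;>
    nlinarith [sq_nonneg x.1, sq_nonneg x.2]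

theorem re_vacuumExponent_le (b : ℝ) (x : Plane) :
    (vacuumExponent b x).re ≤ -(|b| / 4) * ‖x‖ ^ 2 := by
  rw [re_vacuumExponent]
  nlinarith [abs_nonneg b, norm_sq_le_sq_add_sq x]

/-- The normalized ground state `√(|b|/2π) exp(-|b||x|²/4 - i b x₁x₂/2)`, annihilated by both
lowering operators. -/
noncomputable def vacuum (hb : b ≠ 0) : SPlane :=
  ((√(|b| / (2 * Real.pi)) : ℝ) : ℂ) •
    gaussianSchwartz (vacuumExponent b) (hasTemperateGrowth_vacuumExponent b) (|b| / 4)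
      (by positivity) (re_vacuumExponent_le b)

theorem vacuum_apply (hb : b ≠ 0) (x : Plane) :
    vacuum hb x = ((√(|b| / (2 * Real.pi)) : ℝ) : ℂ) * Complex.exp (vacuumExponent b x) := rfl

theorem norm_sq_vacuum (hb : b ≠ 0) (x : Plane) :
    ‖vacuum hb x‖ ^ 2 = |b| / (2 * Real.pi) * Real.exp (-(|b| / 2 * (x.1 ^ 2 + x.2 ^ 2))) := by
  rw [vacuum_apply, norm_mul, mul_pow, Complex.norm_real, Real.norm_of_nonneg (Real.sqrt_nonneg _),
    Real.sq_sqrt (by positivity), Complex.norm_exp, re_vacuumExponent, ← Real.exp_nat_mul]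
  congr 2
  push_cast
  ring

theorem fderiv_vacuum (hb : b ≠ 0) (x v : Plane) :
    fderiv ℝ (vacuum hb) x v = (-(((|b| / 2 : ℝ) : ℂ) * (x.1 * v.1 + x.2 * v.2)) -
      Complex.I * ((b / 2 : ℝ) : ℂ) * (x.1 * v.2 + x.2 * v.1)) * vacuum hb x := by
  have h1 := hasFDerivAt_fst x
  have h2 := hasFDerivAt_snd x
  have h : HasFDerivAt (vacuum hb) _ x :=
    (((((h1.mul h1).add (h2.mul h2)).const_mul ((|b| / 4 : ℝ) : ℂ)).neg.sub
      ((h1.mul h2).const_mul (Complex.I * ((b / 2 : ℝ) : ℂ)))).cexp).const_mul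
      ((√(|b| / (2 * Real.pi)) : ℝ) : ℂ)
  rw [h.fderiv, vacuum_apply]
  simp only [vacuumExponent, smul_apply, add_apply, sub_apply, neg_apply,
    ContinuousLinearMap.comp_apply, ContinuousLinearMap.coe_fst', ContinuousLinearMap.coe_snd',
    Complex.ofRealCLM_apply, smul_eq_mul, Pi.mul_apply, Pi.add_apply, Pi.sub_apply, Pi.neg_apply]
  push_cast
  ring

theorem D₁_vacuum (hb : b ≠ 0) (x : Plane) : D₁ (vacuum hb) x =
    (-(((|b| / 2 : ℝ) : ℂ) * x.1) - Complex.I * ((b / 2 : ℝ) : ℂ) * x.2) * vacuum hb x := by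
  rw [D₁_apply, fderiv_vacuum]
  simp

theorem D₂_vacuum (hb : b ≠ 0) (x : Plane) : D₂ (vacuum hb) x =
    (-(((|b| / 2 : ℝ) : ℂ) * x.2) - Complex.I * ((b / 2 : ℝ) : ℂ) * x.1) * vacuum hb x := by
  rw [D₂_apply, fderiv_vacuum]
  simp

theorem sgn_mul_abs (hb : b ≠ 0) : sgn b * (|b| : ℝ) = b := by
  rw [← sgn_mul_b hb, ← mul_assoc, sgn_mul_self hb, one_mul]

theorem lowerL_vacuum (hb : b ≠ 0) : lowerL b (vacuum hb) = 0 := by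
  ext x
  have h1 := sgn_mul_abs hb
  have h2 := sgn_mul_b hb
  simp only [lowerL, p₁, p₂, smul_apply, add_apply, sub_apply, X₁_apply, D₁_vacuum, D₂_vacuum,
    smul_eq_mul, zero_apply]
  push_cast
  linear_combination (ladderNorm b * vacuum hb x) *
    ((Complex.I * x.1 / 2) * (-h2) + (x.2 / 2) * h1 +
      (b * x.2 / 2 - sgn b * (|b| : ℝ) * x.2 / 2 - Complex.I * sgn b * b * x.1 / 2) *
        Complex.I_mul_I)

theorem lowerM_vacuum (hb : b ≠ 0) : lowerM b (vacuum hb) = 0 := by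
  ext x
  have h1 := sgn_mul_abs hb
  have h2 := sgn_mul_b hb
  simp only [lowerM, k₁, k₂, smul_apply, add_apply, X₂_apply, D₁_vacuum, D₂_vacuum,
    smul_eq_mul, zero_apply]
  push_cast
  linear_combination (ladderNorm b * vacuum hb x) *
    ((Complex.I * x.1 / 2) * (-h2) + (-(x.2 / 2)) * h1 +
      (b * x.2 / 2 + sgn b * (|b| : ℝ) * x.2 / 2 + Complex.I * sgn b * b * x.1 / 2) *
        Complex.I_mul_I)

/-- The eigenfunction number `k` in the Landau level `n`: the ground state, raised `k` times by
`raiseM` and `n` times by `raiseL`, and normalized. -/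
noncomputable def landauFun (hb : b ≠ 0) : ℕ → ℕ → SPlane
  | 0, 0 => vacuum hb
  | 0, k + 1 => (((√(k + 1 : ℝ))⁻¹ : ℝ) : ℂ) • raiseM b (landauFun hb 0 k)
  | n + 1, k => (((√(n + 1 : ℝ))⁻¹ : ℝ) : ℂ) • raiseL b (landauFun hb n k)

variable (hb : b ≠ 0)

theorem ofReal_sqrt_mul_inv (n : ℕ) :
    ((√(n + 1 : ℝ) : ℝ) : ℂ) * (((√(n + 1 : ℝ))⁻¹ : ℝ) : ℂ) = 1 := by
  rw [← Complex.ofReal_mul, mul_inv_cancel₀ (by positivity), Complex.ofReal_one]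

theorem ofReal_sqrt_mul_sqrt (n : ℕ) :
    ((√(n + 1 : ℝ) : ℝ) : ℂ) * ((√(n + 1 : ℝ) : ℝ) : ℂ) = n + 1 := by
  rw [← Complex.ofReal_mul, Real.mul_self_sqrt (by positivity)]
  push_cast
  rfl

theorem ofReal_inv_sqrt (n : ℕ) :
    (((√(n + 1 : ℝ))⁻¹ : ℝ) : ℂ) * (n + 1) = ((√(n + 1 : ℝ) : ℝ) : ℂ) := by
  rw [← ofReal_sqrt_mul_sqrt, ← mul_assoc, mul_comm (((√(n + 1 : ℝ))⁻¹ : ℝ) : ℂ),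
    ofReal_sqrt_mul_inv, one_mul]

theorem raiseL_landauFun (n k : ℕ) :
    raiseL b (landauFun hb n k) = ((√(n + 1 : ℝ) : ℝ) : ℂ) • landauFun hb (n + 1) k := by
  rw [landauFun, smul_smul, ofReal_sqrt_mul_inv, one_smul]

theorem raiseM_landauFun (n k : ℕ) :
    raiseM b (landauFun hb n k) = ((√(k + 1 : ℝ) : ℝ) : ℂ) • landauFun hb n (k + 1) := by
  induction n with
  | zero => rw [landauFun, smul_smul, ofReal_sqrt_mul_inv, one_smul]
  | succ n ih =>
    rw [landauFun, landauFun, map_smul, ← raiseL_raiseM, ih, map_smul, smul_comm]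

theorem lowerL_landauFun_zero (k : ℕ) : lowerL b (landauFun hb 0 k) = 0 := by
  induction k with
  | zero => rw [landauFun, lowerL_vacuum]
  | succ k ih => rw [landauFun, map_smul, lowerL_raiseM, ih, map_zero, smul_zero]

theorem lowerL_landauFun_succ (n k : ℕ) :
    lowerL b (landauFun hb (n + 1) k) = ((√(n + 1 : ℝ) : ℝ) : ℂ) • landauFun hb n k := by
  have h : raiseL b (lowerL b (landauFun hb n k)) = (n : ℂ) • landauFun hb n k := by
    cases n with
    | zero => rw [lowerL_landauFun_zero]; simp
    | succ n =>
      rw [lowerL_landauFun_succ n k, map_smul, raiseL_landauFun, smul_smul, ofReal_sqrt_mul_sqrt]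
      push_cast
      rfl
  rw [landauFun, map_smul, lowerL_raiseL hb, h, ← ofReal_inv_sqrt, mul_smul, add_smul, one_smul]

theorem raiseL_lowerL_landauFun (n k : ℕ) :
    raiseL b (lowerL b (landauFun hb n k)) = (n : ℂ) • landauFun hb n k := by
  cases n with
  | zero => rw [lowerL_landauFun_zero]; simp
  | succ n =>
    rw [lowerL_landauFun_succ, map_smul, raiseL_landauFun, smul_smul, ofReal_sqrt_mul_sqrt]
    push_cast
    rfl

theorem lowerM_landauFun_zero (n : ℕ) : lowerM b (landauFun hb n 0) = 0 := by
  induction n with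
  | zero => rw [landauFun, lowerM_vacuum]
  | succ n ih => rw [landauFun, map_smul, ← raiseL_lowerM, ih, map_zero, smul_zero]

theorem lowerM_landauFun_succ (n k : ℕ) :
    lowerM b (landauFun hb n (k + 1)) = ((√(k + 1 : ℝ) : ℝ) : ℂ) • landauFun hb n k := by
  have h : raiseM b (lowerM b (landauFun hb n k)) = (k : ℂ) • landauFun hb n k := by
    cases k with
    | zero => rw [lowerM_landauFun_zero]; simp
    | succ k =>
      rw [lowerM_landauFun_succ n k, map_smul, raiseM_landauFun, smul_smul, ofReal_sqrt_mul_sqrt]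
      push_cast
      rfl
  have h2 : landauFun hb n (k + 1) =
      (((√(k + 1 : ℝ))⁻¹ : ℝ) : ℂ) • raiseM b (landauFun hb n k) := by
    rw [raiseM_landauFun, smul_smul, mul_comm, ofReal_sqrt_mul_inv, one_smul]
  rw [h2, map_smul, lowerM_raiseM hb, h, ← ofReal_inv_sqrt, mul_smul, add_smul, one_smul]

theorem landauS_landauFun (n k : ℕ) :
    landauS b (landauFun hb n k) = (landauEnergy b n : ℂ) • landauFun hb n k := by
  rw [landauS_eq hb, raiseL_lowerL_landauFun, landauEnergy]
  push_cast
  module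

/-! ### Orthonormality -/

theorem inner_vacuum : ⟪toL2 (vacuum hb), toL2 (vacuum hb)⟫_ℂ = 1 := by
  have hs : 0 < |b| := abs_pos.2 hb
  rw [inner_toL2_toL2]
  have h : ∀ x : Plane, starRingEnd ℂ (vacuum hb x) * vacuum hb x =
      ((|b| / (2 * Real.pi) * (Real.exp (-(|b| / 2) * x.1 ^ 2) *
        Real.exp (-(|b| / 2) * x.2 ^ 2)) : ℝ) : ℂ) := fun x => by
    rw [mul_comm, Complex.mul_conj, Complex.normSq_eq_norm_sq, norm_sq_vacuum, ← Real.exp_add]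
    congr 3
    ring
  simp_rw [h]
  rw [integral_complex_ofReal, integral_const_mul, Measure.volume_eq_prod,
    integral_prod_mul (fun x : ℝ => Real.exp (-(|b| / 2) * x ^ 2))
      (fun x : ℝ => Real.exp (-(|b| / 2) * x ^ 2)), integral_gaussian,
    Real.mul_self_sqrt (by positivity)]
  norm_cast
  field_simp

/-- The eigenfunctions as elements of `L²(ℝ²)`. -/
noncomputable def landauVec (n k : ℕ) : L2 Plane := toL2 (landauFun hb n k)

theorem inner_landauVec (n k m l : ℕ) :
    ⟪landauVec hb n k, landauVec hb m l⟫_ℂ = if n = m ∧ k = l then 1 else 0 := by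
  unfold landauVec
  induction n generalizing m with
  | zero =>
    cases m with
    | zero =>
      induction k generalizing l with
      | zero =>
        cases l with
        | zero => simpa [landauFun] using inner_vacuum hb
        | succ l =>
          rw [← inner_conj_symm, landauFun.eq_2, map_smul, inner_smul_left, inner_raiseM,
            lowerM_landauFun_zero]
          simp
      | succ k ih =>
        rw [landauFun.eq_2, map_smul, inner_smul_left, inner_raiseM]
        cases l with
        | zero => rw [lowerM_landauFun_zero]; simp
        | succ l =>
          rw [lowerM_landauFun_succ, map_smul, inner_smul_right, ih, Complex.conj_ofReal]
          by_cases h : k = l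
          · subst h
            simp only [and_self, if_true, mul_one]
            rw [mul_comm, ofReal_sqrt_mul_inv]
          · simp [h]
    | succ m =>
      rw [← inner_conj_symm, landauFun.eq_3, map_smul, inner_smul_left, inner_raiseL,
        lowerL_landauFun_zero]
      simp
  | succ n ih =>
    rw [landauFun.eq_3, map_smul, inner_smul_left, inner_raiseL]
    cases m with
    | zero => rw [lowerL_landauFun_zero]; simp
    | succ m =>
      rw [lowerL_landauFun_succ, map_smul, inner_smul_right, ih, Complex.conj_ofReal]
      by_cases h : n = m
      · subst h
        simp only [true_and]
        rw [← mul_assoc, mul_comm (((√(n + 1 : ℝ))⁻¹ : ℝ) : ℂ), ofReal_sqrt_mul_inv, one_mul]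
      · simp [h]

theorem orthonormal_landauVec : Orthonormal ℂ fun p : ℕ × ℕ => landauVec hb p.1 p.2 := by
  classical
  rw [orthonormal_iff_ite]
  rintro ⟨n, k⟩ ⟨m, l⟩
  rw [inner_landauVec]
  simp [Prod.ext_iff]

/-! ### The diagonal of the Landau projectors -/

/-- In the lowest level `lowerL` vanishes, so that `raiseM` acts as a multiplication operator. -/
theorem landauFun_zero_succ_apply (k : ℕ) (y : Plane) :
    ((√(k + 1 : ℝ) : ℝ) : ℂ) * landauFun hb 0 (k + 1) y =
      -starRingEnd ℂ (ladderShift b y) * landauFun hb 0 k y := by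
  have h := lowerL_apply (b := b) (landauFun hb 0 k) y
  rw [lowerL_landauFun_zero, raiseM_landauFun, zero_apply, smul_apply, smul_eq_mul] at h
  linear_combination -h

theorem norm_sq_landauFun_zero (k : ℕ) (y : Plane) :
    ‖landauFun hb 0 k y‖ ^ 2 =
      ‖vacuum hb y‖ ^ 2 * ((‖ladderShift b y‖ ^ 2) ^ k / k.factorial) := by
  induction k with
  | zero => simp [landauFun]
  | succ k ih =>
    have h := congrArg (fun z => ‖z‖ ^ 2) (landauFun_zero_succ_apply hb k y)
    simp only [norm_mul, norm_neg, RCLike.norm_conj, mul_pow, Complex.norm_real, ih] at h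
    rw [Real.norm_of_nonneg (Real.sqrt_nonneg _), Real.sq_sqrt (by positivity)] at h
    rw [← mul_right_inj' (show (k + 1 : ℝ) ≠ 0 by positivity), h, Nat.factorial_succ]
    push_cast
    field_simp
    ring

theorem hasSum_norm_sq_landauFun_zero (y : Plane) :
    HasSum (fun k => ‖landauFun hb 0 k y‖ ^ 2) (|b| / (2 * Real.pi)) := by
  simp_rw [norm_sq_landauFun_zero]
  have h := (NormedSpace.expSeries_div_hasSum_exp (𝔸 := ℝ) (‖ladderShift b y‖ ^ 2)).mul_left
    (‖vacuum hb y‖ ^ 2)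
  have e : ‖vacuum hb y‖ ^ 2 * NormedSpace.exp (‖ladderShift b y‖ ^ 2) = |b| / (2 * Real.pi) := by
    rw [norm_sq_vacuum, norm_sq_ladderShift hb, ← Real.exp_eq_exp_ℝ, mul_assoc, ← Real.exp_add]
    simp
  rwa [e] at h

theorem landauFun_succ_succ_apply (n k : ℕ) (y : Plane) :
    ((√(n + 1 : ℝ) : ℝ) : ℂ) * landauFun hb (n + 1) (k + 1) y =
      ((√(k + 1 : ℝ) : ℝ) : ℂ) * landauFun hb n k y +
        ladderShift b y * landauFun hb n (k + 1) y := by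
  have h := raiseL_apply (b := b) (landauFun hb n (k + 1)) y
  rwa [raiseL_landauFun, lowerM_landauFun_succ] at h

theorem landauFun_succ_zero_apply (n : ℕ) (y : Plane) :
    ((√(n + 1 : ℝ) : ℝ) : ℂ) * landauFun hb (n + 1) 0 y =
      ladderShift b y * landauFun hb n 0 y := by
  have h := raiseL_apply (b := b) (landauFun hb n 0) y
  rwa [raiseL_landauFun, lowerM_landauFun_zero, zero_apply, zero_add] at h

theorem landauFun_lower_apply (n k : ℕ) (y : Plane) :
    ((√(n + 1 : ℝ) : ℝ) : ℂ) * landauFun hb n k y =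
      ((√(k + 1 : ℝ) : ℝ) : ℂ) * landauFun hb (n + 1) (k + 1) y +
        starRingEnd ℂ (ladderShift b y) * landauFun hb (n + 1) k y := by
  have h := lowerL_apply (b := b) (landauFun hb (n + 1) k) y
  rwa [lowerL_landauFun_succ, raiseM_landauFun] at h

theorem one_le_sqrt_succ (n : ℕ) : (1 : ℝ) ≤ √(n + 1 : ℝ) := by
  rw [Real.one_le_sqrt]
  linarith [(Nat.cast_nonneg n : (0 : ℝ) ≤ n)]

theorem sqrt_succ_le_two_pow (k : ℕ) : √(k + 1 : ℝ) ≤ 2 ^ k := by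
  have h : (k + 1 : ℝ) ≤ 2 ^ k := by exact_mod_cast Nat.lt_two_pow_self
  refine (Real.sqrt_le_sqrt h).trans ?_
  rw [Real.sqrt_le_left (by positivity)]
  exact le_self_pow₀ (one_le_pow₀ (by norm_num)) (by norm_num)

/-- For a fixed point, the eigenfunctions of a Landau level decay faster than exponentially in
the quantum number `k`. -/
theorem tendsto_pow_mul_landauFun (n : ℕ) (y : Plane) (R : ℝ) (hR : 0 ≤ R) :
    Filter.Tendsto (fun k => R ^ k * ‖landauFun hb n k y‖) Filter.atTop (nhds 0) := by
  induction n generalizing R with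
  | zero =>
    have h := ((FloorSemiring.tendsto_pow_div_factorial_atTop
      (R ^ 2 * ‖ladderShift b y‖ ^ 2)).const_mul (‖vacuum hb y‖ ^ 2)).sqrt
    rw [mul_zero, Real.sqrt_zero] at h
    refine h.congr fun k => ?_
    rw [Real.sqrt_eq_iff_eq_sq (by positivity) (by positivity), mul_pow (R ^ k),
      norm_sq_landauFun_zero, mul_pow (R ^ 2)]
    ring
  | succ n ih =>
    rw [← Filter.tendsto_add_atTop_iff_nat 1]
    have h1 := (ih (2 * R) (by positivity)).const_mul (R)
    have h2 := ((Filter.tendsto_add_atTop_iff_nat 1).2 (ih R hR)).const_mul ‖ladderShift b y‖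
    have h3 := h1.add h2
    rw [mul_zero, mul_zero, add_zero] at h3
    refine squeeze_zero (fun k => by positivity) (fun k => ?_) h3
    have h4 := congrArg norm (landauFun_succ_succ_apply hb n k y)
    have h5 : ‖landauFun hb (n + 1) (k + 1) y‖ ≤
        2 ^ k * ‖landauFun hb n k y‖ + ‖ladderShift b y‖ * ‖landauFun hb n (k + 1) y‖ := by
      calc _ ≤ √(n + 1 : ℝ) * ‖landauFun hb (n + 1) (k + 1) y‖ :=
            le_mul_of_one_le_left (norm_nonneg _) (one_le_sqrt_succ n)
        _ = ‖((√(k + 1 : ℝ) : ℝ) : ℂ) * landauFun hb n k y +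
              ladderShift b y * landauFun hb n (k + 1) y‖ := by
            rw [← h4, norm_mul, Complex.norm_real, Real.norm_of_nonneg (Real.sqrt_nonneg _)]
        _ ≤ √(k + 1 : ℝ) * ‖landauFun hb n k y‖ +
              ‖ladderShift b y‖ * ‖landauFun hb n (k + 1) y‖ := by
            refine (norm_add_le _ _).trans ?_
            rw [norm_mul, norm_mul, Complex.norm_real, Real.norm_of_nonneg (Real.sqrt_nonneg _)]
        _ ≤ _ := by gcongr; exact sqrt_succ_le_two_pow k
    calc R ^ (k + 1) * ‖landauFun hb (n + 1) (k + 1) y‖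
        ≤ R ^ (k + 1) * (2 ^ k * ‖landauFun hb n k y‖ +
          ‖ladderShift b y‖ * ‖landauFun hb n (k + 1) y‖) := by gcongr
      _ = _ := by rw [mul_pow]; ring

/-- Passing from one Landau level to the next changes the partial sums of the diagonal by a
boundary term only: the sum telescopes. -/
theorem sum_norm_sq_landauFun_succ (n K : ℕ) (y : Plane) :
    ((√(n + 1 : ℝ) : ℝ) : ℂ) * (((∑ k ∈ Finset.range (K + 1), ‖landauFun hb (n + 1) k y‖ ^ 2 -
      ∑ k ∈ Finset.range (K + 1), ‖landauFun hb n k y‖ ^ 2 : ℝ)) : ℂ) =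
      -(((√(K + 1 : ℝ) : ℝ) : ℂ) *
        (starRingEnd ℂ (landauFun hb (n + 1) (K + 1) y) * landauFun hb n K y)) := by
  have hsq : ∀ z : ℂ, ((‖z‖ ^ 2 : ℝ) : ℂ) = z * starRingEnd ℂ z := fun z => by
    rw [Complex.mul_conj, Complex.normSq_eq_norm_sq]
  have hlow : ∀ k, ((√(n + 1 : ℝ) : ℝ) : ℂ) * starRingEnd ℂ (landauFun hb n k y) =
      ((√(k + 1 : ℝ) : ℝ) : ℂ) * starRingEnd ℂ (landauFun hb (n + 1) (k + 1) y) +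
        ladderShift b y * starRingEnd ℂ (landauFun hb (n + 1) k y) := fun k => by
    simpa using congrArg (starRingEnd ℂ) (landauFun_lower_apply hb n k y)
  induction K with
  | zero =>
    have h1 := landauFun_succ_zero_apply hb n y
    have h2 := hlow 0
    rw [Finset.sum_range_one, Finset.sum_range_one, Complex.ofReal_sub, hsq, hsq]
    linear_combination starRingEnd ℂ (landauFun hb (n + 1) 0 y) * h1 - landauFun hb n 0 y * h2
  | succ K ih =>
    have h1 := landauFun_succ_succ_apply hb n K y
    have h2 := hlow (K + 1)
    rw [Finset.sum_range_succ _ (K + 1), Finset.sum_range_succ _ (K + 1), add_sub_add_comm,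
      Complex.ofReal_add, mul_add, ih, Complex.ofReal_sub, hsq, hsq]
    linear_combination starRingEnd ℂ (landauFun hb (n + 1) (K + 1) y) * h1 -
      landauFun hb n (K + 1) y * h2

/-- The diagonal of every Landau projector is the constant `|b| / 2π`. -/
theorem hasSum_norm_sq_landauFun (n : ℕ) (y : Plane) :
    HasSum (fun k => ‖landauFun hb n k y‖ ^ 2) (|b| / (2 * Real.pi)) := by
  induction n with
  | zero => exact hasSum_norm_sq_landauFun_zero hb y
  | succ n ih =>
    rw [hasSum_iff_tendsto_nat_of_nonneg (fun _ => by positivity),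
      ← Filter.tendsto_add_atTop_iff_nat 1] at ih ⊢
    have hlim : Filter.Tendsto (fun K => ∑ k ∈ Finset.range (K + 1), ‖landauFun hb (n + 1) k y‖ ^ 2
        - ∑ k ∈ Finset.range (K + 1), ‖landauFun hb n k y‖ ^ 2) Filter.atTop (nhds 0) := by
      have h1 := ((Filter.tendsto_add_atTop_iff_nat 1).2
        (tendsto_pow_mul_landauFun hb (n + 1) y 1 zero_le_one)).mul
        (tendsto_pow_mul_landauFun hb n y 2 zero_le_two)
      rw [mul_zero] at h1
      refine squeeze_zero_norm (fun K => ?_) h1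
      have h2 := congrArg norm (sum_norm_sq_landauFun_succ hb n K y)
      rw [norm_neg, norm_mul, norm_mul, norm_mul, Complex.norm_real, Complex.norm_real,
        Complex.norm_real, Real.norm_of_nonneg (Real.sqrt_nonneg _),
        Real.norm_of_nonneg (Real.sqrt_nonneg _), RCLike.norm_conj] at h2
      refine (le_mul_of_one_le_left (norm_nonneg _) (one_le_sqrt_succ n)).trans (h2.le.trans ?_)
      rw [one_pow, one_mul, mul_left_comm]
      gcongr
      exact sqrt_succ_le_two_pow K
    simpa using hlim.add ih

end Eigenfunctions


/-! ### Injectivity of the Fourier transform -/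

section Fourier

variable {E : Type*} [NormedAddCommGroup E] [NormedSpace ℝ E] [MeasurableSpace E] [BorelSpace E]
  {μ : Measure E}

theorem integrable_cexp_mul {h : E → ℂ} (hh : Integrable h μ) (L : StrongDual ℝ E) :
    Integrable (fun x => Complex.exp (L x * Complex.I) * h x) μ := by
  refine hh.bdd_mul (c := 1) (by fun_prop) (Filter.Eventually.of_forall fun x => ?_)
  rw [Complex.norm_exp_ofReal_mul_I]

variable [SecondCountableTopology E] [CompleteSpace E]

/-- The positive and the negative part of `r` are densities of finite measures with the same
characteristic function, hence agree. -/
theorem ae_eq_zero_of_fourier_eq_zero_real {r : E → ℝ} (hr : Integrable r μ)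
    (h : ∀ L : StrongDual ℝ E, ∫ x, Complex.exp (L x * Complex.I) * (r x : ℂ) ∂μ = 0) :
    r =ᵐ[μ] 0 := by
  have hm : AEMeasurable (fun x => ENNReal.ofReal (r x)) μ := hr.aemeasurable.ennreal_ofReal
  have hm' : AEMeasurable (fun x => ENNReal.ofReal (-r x)) μ := hr.neg.aemeasurable.ennreal_ofReal
  have hfin : ∫⁻ x, ENNReal.ofReal (r x) ∂μ ≠ ⊤ := hr.lintegral_lt_top.ne
  have hfin' : ∫⁻ x, ENNReal.ofReal (-r x) ∂μ ≠ ⊤ := hr.neg.lintegral_lt_top.ne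
  have : IsFiniteMeasure (μ.withDensity fun x => ENNReal.ofReal (r x)) :=
    isFiniteMeasure_withDensity hfin
  have : IsFiniteMeasure (μ.withDensity fun x => ENNReal.ofReal (-r x)) :=
    isFiniteMeasure_withDensity hfin'
  have key : μ.withDensity (fun x => ENNReal.ofReal (r x)) =
      μ.withDensity fun x => ENNReal.ofReal (-r x) := by
    refine Measure.ext_of_charFunDual (funext fun L => ?_)
    rw [charFunDual_apply, charFunDual_apply,
      integral_withDensity_eq_integral_toReal_smul₀ hm (by simp),
      integral_withDensity_eq_integral_toReal_smul₀ hm' (by simp), ← sub_eq_zero, ← integral_sub]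
    · rw [← h L]
      refine integral_congr_ae (Filter.Eventually.of_forall fun x => ?_)
      rcases le_total 0 (r x) with hx | hx
      · simp [ENNReal.toReal_ofReal, hx, ENNReal.ofReal_of_nonpos, mul_comm]
      · simp [ENNReal.toReal_ofReal, hx, ENNReal.ofReal_of_nonpos, mul_comm]
    · refine (integrable_cexp_mul (h := fun x => ((ENNReal.ofReal (r x)).toReal : ℂ)) ?_ L).congr
        (Filter.Eventually.of_forall fun x => ?_)
      · exact (integrable_toReal_of_lintegral_ne_top hm hfin).ofReal
      · simp [mul_comm]
    · refine (integrable_cexp_mul (h := fun x => ((ENNReal.ofReal (-r x)).toReal : ℂ)) ?_ L).congr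
        (Filter.Eventually.of_forall fun x => ?_)
      · exact (integrable_toReal_of_lintegral_ne_top hm' hfin').ofReal
      · simp [mul_comm]
  filter_upwards [(withDensity_eq_iff hm hm' hfin).1 key] with x hx
  rcases le_total 0 (r x) with h0 | h0
  · rw [ENNReal.ofReal_of_nonpos (neg_nonpos.2 h0), ENNReal.ofReal_eq_zero] at hx
    exact le_antisymm hx h0
  · rw [ENNReal.ofReal_of_nonpos h0, eq_comm, ENNReal.ofReal_eq_zero] at hx
    exact le_antisymm h0 (neg_nonpos.1 hx)

theorem ae_eq_zero_of_fourier_eq_zero {h : E → ℂ} (hh : Integrable h μ)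
    (h0 : ∀ L : StrongDual ℝ E, ∫ x, Complex.exp (L x * Complex.I) * h x ∂μ = 0) :
    h =ᵐ[μ] 0 := by
  have hconj : Integrable (fun x => starRingEnd ℂ (h x)) μ := by
    refine hh.norm.mono' (Complex.continuous_conj.comp_aestronglyMeasurable hh.1)
      (Filter.Eventually.of_forall fun x => ?_)
    simp
  have h1 : ∀ L : StrongDual ℝ E,
      ∫ x, Complex.exp (L x * Complex.I) * starRingEnd ℂ (h x) ∂μ = 0 := fun L => by
    have h2 := congrArg (starRingEnd ℂ) (h0 (-L))
    rw [← integral_conj, map_zero] at h2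
    rw [← h2]
    refine integral_congr_ae (Filter.Eventually.of_forall fun x => ?_)
    simp [← Complex.exp_conj]
  have hre : (fun x => (h x).re) =ᵐ[μ] 0 := by
    refine ae_eq_zero_of_fourier_eq_zero_real hh.re fun L => ?_
    have h2 : ∀ x, Complex.exp (L x * Complex.I) * ((h x).re : ℂ) =
        (1 / 2 : ℂ) * (Complex.exp (L x * Complex.I) * h x +
          Complex.exp (L x * Complex.I) * starRingEnd ℂ (h x)) := fun x => by
      rw [← mul_add, Complex.add_conj]
      push_cast
      ring
    simp_rw [h2]
    rw [integral_const_mul, integral_add (integrable_cexp_mul hh L) (integrable_cexp_mul hconj L),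
      h0, h1]
    simp
  have him : (fun x => (h x).im) =ᵐ[μ] 0 := by
    refine ae_eq_zero_of_fourier_eq_zero_real hh.im fun L => ?_
    have h2 : ∀ x, Complex.exp (L x * Complex.I) * ((h x).im : ℂ) =
        (-Complex.I / 2 : ℂ) * (Complex.exp (L x * Complex.I) * h x -
          Complex.exp (L x * Complex.I) * starRingEnd ℂ (h x)) := fun x => by
      rw [← mul_sub, Complex.sub_conj]
      push_cast
      linear_combination (Complex.exp (L x * Complex.I) * (h x).im) * Complex.I_mul_I
    simp_rw [h2]
    rw [integral_const_mul, integral_sub (integrable_cexp_mul hh L) (integrable_cexp_mul hconj L),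
      h0, h1]
    simp
  filter_upwards [hre, him] with x h2 h3
  exact Complex.ext h2 h3

end Fourier

/-! ### Completeness of the eigenfunctions -/

section Completeness

variable {b : ℝ} (hb : b ≠ 0)

/-- The span of the eigenfunctions. -/
noncomputable def landauSpan : Submodule ℂ SPlane :=
  Submodule.span ℂ (Set.range fun p : ℕ × ℕ => landauFun hb p.1 p.2)

theorem landauFun_mem (n k : ℕ) : landauFun hb n k ∈ landauSpan hb :=
  Submodule.subset_span ⟨(n, k), rfl⟩

theorem map_mem_landauSpan {A : SPlane →L[ℂ] SPlane}
    (hA : ∀ n k, A (landauFun hb n k) ∈ landauSpan hb) {u : SPlane} (hu : u ∈ landauSpan hb) :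
    A u ∈ landauSpan hb := by
  have h : landauSpan hb ≤ (landauSpan hb).comap (A : SPlane →ₗ[ℂ] SPlane) := by
    rw [landauSpan, Submodule.span_le]
    rintro _ ⟨p, rfl⟩
    exact hA _ _
  exact h hu

theorem raiseL_mem {u : SPlane} (hu : u ∈ landauSpan hb) : raiseL b u ∈ landauSpan hb :=
  map_mem_landauSpan hb (fun n k => by
    rw [raiseL_landauFun]; exact Submodule.smul_mem _ _ (landauFun_mem hb _ _)) hu

theorem raiseM_mem {u : SPlane} (hu : u ∈ landauSpan hb) : raiseM b u ∈ landauSpan hb :=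
  map_mem_landauSpan hb (fun n k => by
    rw [raiseM_landauFun]; exact Submodule.smul_mem _ _ (landauFun_mem hb _ _)) hu

theorem lowerL_mem {u : SPlane} (hu : u ∈ landauSpan hb) : lowerL b u ∈ landauSpan hb :=
  map_mem_landauSpan hb (fun n k => by
    cases n with
    | zero => rw [lowerL_landauFun_zero]; exact Submodule.zero_mem _
    | succ n => rw [lowerL_landauFun_succ]; exact Submodule.smul_mem _ _ (landauFun_mem hb _ _)) hu

theorem lowerM_mem {u : SPlane} (hu : u ∈ landauSpan hb) : lowerM b u ∈ landauSpan hb :=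
  map_mem_landauSpan hb (fun n k => by
    cases k with
    | zero => rw [lowerM_landauFun_zero]; exact Submodule.zero_mem _
    | succ k => rw [lowerM_landauFun_succ]; exact Submodule.smul_mem _ _ (landauFun_mem hb _ _)) hu

theorem ladderNorm_ne_zero (hb : b ≠ 0) : ladderNorm b ≠ 0 := fun h => by
  simpa [h] using ladderNorm_sq hb

/-- The coordinates are linear combinations of the ladder operators, hence preserve the span of the
eigenfunctions. -/
theorem X₂_mem {u : SPlane} (hu : u ∈ landauSpan hb) : X₂ u ∈ landauSpan hb := by
  have hb' : (b : ℂ) ≠ 0 := Complex.ofReal_ne_zero.2 hb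
  have h : X₂ u = (-(2 * ladderNorm b * b)⁻¹) •
      ((raiseL b u - lowerM b u) + (lowerL b u - raiseM b u)) := by
    have hN := ladderNorm_ne_zero hb
    ext y
    simp only [smul_apply, add_apply, sub_apply, raiseL_apply, lowerL_apply, X₂_apply, ladderShift,
      smul_eq_mul, map_mul, map_add, map_neg, conj_sgn, conj_ladderNorm, Complex.conj_ofReal,
      Complex.conj_I]
    field_simp
    ring
  rw [h]
  exact Submodule.smul_mem _ _ (Submodule.add_mem _
    (Submodule.sub_mem _ (raiseL_mem hb hu) (lowerM_mem hb hu))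
    (Submodule.sub_mem _ (lowerL_mem hb hu) (raiseM_mem hb hu)))

theorem X₁_mem {u : SPlane} (hu : u ∈ landauSpan hb) : X₁ u ∈ landauSpan hb := by
  have hb' : (b : ℂ) ≠ 0 := Complex.ofReal_ne_zero.2 hb
  have hσ : sgn b ≠ 0 := fun h => by simpa [h] using sgn_mul_self hb
  have h : X₁ u = ((2 * Complex.I * sgn b * ladderNorm b * b)⁻¹) •
      ((raiseL b u - lowerM b u) - (lowerL b u - raiseM b u)) := by
    have hN := ladderNorm_ne_zero hb
    have hI := Complex.I_ne_zero
    ext y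
    simp only [smul_apply, sub_apply, raiseL_apply, lowerL_apply, X₁_apply, ladderShift,
      smul_eq_mul, map_mul, map_add, map_neg, conj_sgn, conj_ladderNorm, Complex.conj_ofReal,
      Complex.conj_I]
    field_simp
    ring
  rw [h]
  exact Submodule.smul_mem _ _ (Submodule.sub_mem _
    (Submodule.sub_mem _ (raiseL_mem hb hu) (lowerM_mem hb hu))
    (Submodule.sub_mem _ (lowerL_mem hb hu) (raiseM_mem hb hu)))

theorem exists_pow_mul_vacuum (L : StrongDual ℝ Plane) (n : ℕ) :
    ∃ u ∈ landauSpan hb, ∀ x, u x = (L x : ℂ) ^ n * vacuum hb x := by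
  induction n with
  | zero => exact ⟨vacuum hb, by simpa [landauFun] using landauFun_mem hb 0 0, fun x => by simp⟩
  | succ n ih =>
    obtain ⟨u, hu, hux⟩ := ih
    refine ⟨(L (1, 0) : ℂ) • X₁ u + (L (0, 1) : ℂ) • X₂ u, Submodule.add_mem _
      (Submodule.smul_mem _ _ (X₁_mem hb hu)) (Submodule.smul_mem _ _ (X₂_mem hb hu)), fun x => ?_⟩
    have hL : L x = x.1 * L (1, 0) + x.2 * L (0, 1) := by
      conv_lhs => rw [show x = x.1 • ((1 : ℝ), (0 : ℝ)) + x.2 • ((0 : ℝ), (1 : ℝ)) by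
        simp]
      rw [map_add, map_smul, map_smul, smul_eq_mul, smul_eq_mul]
    rw [add_apply, smul_apply, smul_apply, X₁_apply, X₂_apply, hux, hL]
    push_cast
    simp only [smul_eq_mul]
    ring

/-- The Gaussian ground state has all exponential moments: half of its exponent absorbs `|L x|`. -/
theorem memLp_exp_mul_vacuum (L : StrongDual ℝ Plane) :
    MemLp (fun x => Real.exp |L x| * ‖vacuum hb x‖) 2 (volume : Measure Plane) := by
  have hs : 0 < |b| := abs_pos.2 hb
  let Q : Plane → ℂ := fun x =>
    -(((|b| / 8 : ℝ) : ℂ) * ((x.1 : ℂ) * (x.1 : ℂ) + (x.2 : ℂ) * (x.2 : ℂ)))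
  have hQ : Q.HasTemperateGrowth := by
    have h1 := hasTemperateGrowth_fst
    have h2 := hasTemperateGrowth_snd
    exact ((Function.HasTemperateGrowth.const _).mul ((h1.mul h1).add (h2.mul h2))).neg
  have hQre : ∀ x, (Q x).re = -(|b| / 8) * (x.1 ^ 2 + x.2 ^ 2) := fun x => by
    simp only [Q, Complex.neg_re, Complex.mul_re, Complex.add_re,
      Complex.mul_im, Complex.add_im, Complex.ofReal_re, Complex.ofReal_im]
    ring
  let g := gaussianSchwartz Q hQ (|b| / 8) (by positivity) fun x => by
    rw [hQre]; nlinarith [norm_sq_le_sq_add_sq x]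
  have hg : MemLp g 2 (volume : Measure Plane) := g.memLp 2 volume
  refine (hg.norm.const_mul (√(|b| / (2 * Real.pi)) * Real.exp (2 * ‖L‖ ^ 2 / |b|))).mono
    (by fun_prop) (Filter.Eventually.of_forall fun x => ?_)
  have h1 : ‖g x‖ = Real.exp (-(|b| / 8) * (x.1 ^ 2 + x.2 ^ 2)) := by
    change ‖Complex.exp (Q x)‖ = _
    rw [Complex.norm_exp, hQre]
  have h2 : ‖vacuum hb x‖ = √(|b| / (2 * Real.pi)) *
      Real.exp (-(|b| / 4) * (x.1 ^ 2 + x.2 ^ 2)) := by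
    rw [vacuum_apply, norm_mul, Complex.norm_real, Real.norm_of_nonneg (Real.sqrt_nonneg _),
      Complex.norm_exp, re_vacuumExponent]
  -- Young's inequality, by completing the square.
  have h3 : |L x| ≤ 2 * ‖L‖ ^ 2 / |b| + |b| / 8 * (x.1 ^ 2 + x.2 ^ 2) := by
    have h4 : |L x| ≤ ‖L‖ * ‖x‖ := L.le_opNorm x
    have h5 : ‖L‖ * ‖x‖ ≤ 2 * ‖L‖ ^ 2 / |b| + |b| / 8 * ‖x‖ ^ 2 := by
      have h6 : 2 * ‖L‖ ^ 2 / |b| + |b| / 8 * ‖x‖ ^ 2 - ‖L‖ * ‖x‖ =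
          2 / |b| * (‖L‖ - |b| / 4 * ‖x‖) ^ 2 := by
        field_simp
        ring
      have h7 : 0 ≤ 2 / |b| * (‖L‖ - |b| / 4 * ‖x‖) ^ 2 := by positivity
      linarith
    nlinarith [norm_sq_le_sq_add_sq x]
  rw [Real.norm_of_nonneg (by positivity), Real.norm_of_nonneg (by positivity), h1, h2]
  calc _ = √(|b| / (2 * Real.pi)) * Real.exp (|L x| + -(|b| / 4) * (x.1 ^ 2 + x.2 ^ 2)) := by
        rw [Real.exp_add]; ring
    _ ≤ √(|b| / (2 * Real.pi)) * Real.exp (2 * ‖L‖ ^ 2 / |b| +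
        -(|b| / 8) * (x.1 ^ 2 + x.2 ^ 2)) := by
        gcongr √(|b| / (2 * Real.pi)) * Real.exp ?_
        linarith
    _ = _ := by rw [Real.exp_add]; ring

/-- If `F` is orthogonal to all eigenfunctions, all moments of `conj e₀₀ · F` vanish, hence, by
expansion of the exponential, so does its Fourier transform. -/
theorem eq_zero_of_forall_inner_landauVec {F : L2 Plane}
    (hF : ∀ n k, ⟪landauVec hb n k, F⟫_ℂ = 0) : F = 0 := by
  have hspan : ∀ u ∈ landauSpan hb, ⟪toL2 u, F⟫_ℂ = 0 := fun u hu => by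
    induction hu using Submodule.span_induction with
    | mem x h => obtain ⟨p, rfl⟩ := h; exact hF _ _
    | zero => simp
    | add x y _ _ hx hy => rw [map_add, inner_add_left, hx, hy, add_zero]
    | smul c x _ hx => rw [map_smul, inner_smul_left, hx, mul_zero]
  let h : Plane → ℂ := fun x => starRingEnd ℂ (vacuum hb x) * F x
  have hvc : Continuous (vacuum hb) := (vacuum hb).continuous
  have hmeas : AEStronglyMeasurable h volume :=
    (Complex.continuous_conj.comp hvc).aestronglyMeasurable.mul (Lp.aestronglyMeasurable F)
  have hexp : ∀ L : StrongDual ℝ Plane, Integrable (fun x => Real.exp |L x| * ‖h x‖) volume := by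
    intro L
    refine ((memLp_exp_mul_vacuum hb L).integrable_mul (Lp.memLp F).norm).congr
      (Filter.Eventually.of_forall fun x => ?_)
    simp only [h, norm_mul, RCLike.norm_conj, Pi.mul_apply]
    ring
  have hint : Integrable h volume := by
    refine (hexp 0).mono' hmeas (Filter.Eventually.of_forall fun x => ?_)
    simp
  have hmom : ∀ (L : StrongDual ℝ Plane) (n : ℕ), ∫ x, (L x : ℂ) ^ n * h x = 0 := fun L n => by
    obtain ⟨u, hu, hux⟩ := exists_pow_mul_vacuum hb L n
    rw [← hspan u hu, inner_toL2]
    refine integral_congr_ae (Filter.Eventually.of_forall fun x => ?_)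
    simp only [hux, h, map_mul, map_pow, Complex.conj_ofReal, mul_assoc]
  have hfour : ∀ L : StrongDual ℝ Plane, ∫ x, Complex.exp (L x * Complex.I) * h x = 0 := by
    intro L
    have hs := hasSum_integral_of_dominated_convergence (μ := (volume : Measure Plane))
      (F := fun n x => (L x * Complex.I) ^ n / n.factorial * h x)
      (f := fun x => Complex.exp (L x * Complex.I) * h x)
      (fun n x => |L x| ^ n / n.factorial * ‖h x‖) (fun n => ?_) (fun n => ?_) ?_ ?_ ?_
    · have h0 : ∀ n : ℕ, ∫ x, (L x * Complex.I) ^ n / n.factorial * h x = 0 := fun n => by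
        have : ∀ x, (L x * Complex.I) ^ n / n.factorial * h x =
            (Complex.I ^ n / n.factorial) * ((L x : ℂ) ^ n * h x) := fun x => by
          rw [mul_pow]; ring
        simp_rw [this]
        rw [integral_const_mul, hmom, mul_zero]
      simp_rw [h0] at hs
      exact hs.unique hasSum_zero
    · refine AEStronglyMeasurable.mul ?_ hmeas
      exact Continuous.aestronglyMeasurable (by fun_prop)
    · refine Filter.Eventually.of_forall fun x => ?_
      simp
    · refine Filter.Eventually.of_forall fun x => ?_
      exact (Real.summable_pow_div_factorial _).mul_right _
    · refine (hexp L).congr (Filter.Eventually.of_forall fun x => ?_)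
      simp only []
      rw [tsum_mul_right, Real.exp_eq_exp_ℝ, NormedSpace.exp_eq_tsum_div]
    · refine Filter.Eventually.of_forall fun x => ?_
      have := NormedSpace.expSeries_div_hasSum_exp (𝔸 := ℂ) (L x * Complex.I)
      rw [← Complex.exp_eq_exp_ℂ] at this
      exact this.mul_right _
  rw [Lp.eq_zero_iff_ae_eq_zero]
  filter_upwards [ae_eq_zero_of_fourier_eq_zero hint hfour] with x hx
  have hv : vacuum hb x ≠ 0 := by
    rw [vacuum_apply]
    refine mul_ne_zero (Complex.ofReal_ne_zero.2 ?_) (Complex.exp_ne_zero _)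
    have hs : 0 < |b| := abs_pos.2 hb
    positivity
  have hx' : starRingEnd ℂ (vacuum hb x) * F x = 0 := hx
  rcases mul_eq_zero.1 hx' with h1 | h1
  · exact absurd ((map_eq_zero _).1 h1) hv
  · exact h1

/-- The Hilbert basis of `L²(ℝ²)` of eigenfunctions of the Landau operator. -/
noncomputable def landauBasis : HilbertBasis (ℕ × ℕ) ℂ (L2 Plane) :=
  HilbertBasis.mkOfOrthogonalEqBot (orthonormal_landauVec hb) <| by
    rw [Submodule.eq_bot_iff]
    intro F hF
    refine eq_zero_of_forall_inner_landauVec hb fun n k => ?_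
    exact (Submodule.mem_orthogonal _ _).1 hF _ (Submodule.subset_span ⟨(n, k), rfl⟩)

theorem landauBasis_apply (p : ℕ × ℕ) : landauBasis hb p = landauVec hb p.1 p.2 := by
  rw [landauBasis, HilbertBasis.coe_mkOfOrthogonalEqBot]

end Completeness


/-! ### Density of the test functions -/

section Density

variable {E : Type*} [NormedAddCommGroup E] [NormedSpace ℝ E] [FiniteDimensional ℝ E]

open Filter Topology

/-- A smooth cutoff function with values in `[0, 1]`, equal to `1` on the unit ball. -/
noncomputable def cutoff (E : Type*) [NormedAddCommGroup E] [NormedSpace ℝ E]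
    [FiniteDimensional ℝ E] : ContDiffBump (0 : E) := ⟨1, 2, one_pos, one_lt_two⟩

/-- The rescaled cutoff `χ(δ x)` tends to `1` as `δ → 0`, with all derivatives, at the expense of
one power of `x`: near the origin the difference vanishes, and every derivative brings a
factor `δ`. -/
theorem exists_bound_iteratedFDeriv_cutoff_sub_one (n : ℕ) :
    ∃ B : ℝ, 0 ≤ B ∧ ∀ (i : ℕ), i ≤ n → ∀ (δ : ℝ), 0 ≤ δ → δ ≤ 1 → ∀ x : E,
      ‖iteratedFDeriv ℝ i (fun y => cutoff E (δ • y) - 1) x‖ ≤ δ * B * (1 + ‖x‖) := by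
  have hb : ∀ i : ℕ, ∃ B : ℝ, ∀ x : E, ‖iteratedFDeriv ℝ i (cutoff E) x‖ ≤ B := fun i => by
    have hc : Continuous (iteratedFDeriv ℝ i (cutoff E)) :=
      ((cutoff E).contDiff (n := i)).continuous_iteratedFDeriv le_rfl
    exact (((cutoff E).hasCompactSupport.iteratedFDeriv i).exists_bound_of_continuous hc)
  choose B hB using hb
  have hB0 : ∀ i, 0 ≤ B i := fun i => (norm_nonneg _).trans (hB i 0)
  refine ⟨1 + ∑ i ∈ Finset.range (n + 1), B i,
    add_nonneg zero_le_one (Finset.sum_nonneg fun i _ => hB0 i), fun i hi δ h0 h1 x => ?_⟩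
  have hS : B i ≤ ∑ i ∈ Finset.range (n + 1), B i :=
    Finset.single_le_sum (fun i _ => hB0 i) (Finset.mem_range.2 (by omega))
  have hS0 : 0 ≤ ∑ i ∈ Finset.range (n + 1), B i := (hB0 i).trans hS
  have hx := norm_nonneg x
  rcases Nat.eq_zero_or_pos i with rfl | hpos
  · rw [norm_iteratedFDeriv_zero]
    have h2 : ‖cutoff E (δ • x) - 1‖ ≤ δ * ‖x‖ := by
      rcases le_total ‖δ • x‖ 1 with h | h
      · rw [(cutoff E).one_of_mem_closedBall (by simpa [cutoff] using h)]
        simp only [sub_self, norm_zero]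
        positivity
      · rw [norm_smul, Real.norm_of_nonneg h0] at h
        refine le_trans ?_ h
        rw [Real.norm_eq_abs, abs_le]
        constructor <;> linarith [(cutoff E).nonneg (x := δ • x), (cutoff E).le_one (x := δ • x)]
    refine h2.trans ?_
    rw [mul_assoc]
    gcongr
    nlinarith
  · have h2 : iteratedFDeriv ℝ i (fun y => cutoff E (δ • y) - 1) x =
        δ ^ i • iteratedFDeriv ℝ i (cutoff E) (δ • x) := by
      have h3 : (fun y => cutoff E (δ • y) - 1) = (fun y => cutoff E (δ • y)) - fun _ => 1 := rfl
      have h4 : ContDiff ℝ i fun y => cutoff E (δ • y) :=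
        (cutoff E).contDiff.comp (contDiff_const_smul δ)
      rw [h3, iteratedFDeriv_sub_apply h4.contDiffAt contDiff_const.contDiffAt,
        iteratedFDeriv_const_of_ne hpos.ne', Pi.zero_apply, sub_zero,
        iteratedFDeriv_comp_const_smul δ (cutoff E).contDiff]
    rw [h2, norm_smul, norm_pow, Real.norm_of_nonneg h0]
    have h5 : δ ^ i ≤ δ := pow_le_of_le_one h0 h1 hpos.ne'
    calc δ ^ i * ‖iteratedFDeriv ℝ i (cutoff E) (δ • x)‖ ≤ δ * B i := by gcongr; exact hB i _
      _ ≤ δ * (1 + ∑ i ∈ Finset.range (n + 1), B i) * (1 + ‖x‖) := by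
        rw [mul_assoc]
        gcongr
        nlinarith

theorem hasCompactSupport_cutoff {δ : ℝ} (hδ : δ ≠ 0) :
    HasCompactSupport fun x : E => cutoff E (δ • x) :=
  (cutoff E).hasCompactSupport.comp_homeomorph (Homeomorph.smulOfNeZero δ hδ)

/-- Compactly supported functions are dense in the Schwartz space. -/
theorem dense_hasCompactSupport : Dense {u : SchwartzMap E ℂ | HasCompactSupport u} := by
  intro u
  have hv : ∀ j : ℕ, HasCompactSupport fun x => cutoff E ((1 / (j + 1 : ℝ)) • x) • u x :=
    fun j => (hasCompactSupport_cutoff (by positivity)).smul_right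
  have hv' : ∀ j : ℕ, ContDiff ℝ ∞ fun x => cutoff E ((1 / (j + 1 : ℝ)) • x) • u x :=
    fun j => ((cutoff E).contDiff.comp (contDiff_const_smul _)).smul u.smooth'
  let v : ℕ → SchwartzMap E ℂ := fun j => (hv j).toSchwartzMap (hv' j)
  refine mem_closure_of_tendsto (f := v) (b := atTop) ?_ (Eventually.of_forall fun j => ?_)
  · rw [(schwartz_withSeminorms ℝ E ℂ).tendsto_nhds]
    rintro ⟨k, n⟩ ε hε
    obtain ⟨B, hB0, hB⟩ := exists_bound_iteratedFDeriv_cutoff_sub_one (E := E) n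
    set M := ∑ i ∈ Finset.range (n + 1), (n.choose i : ℝ) * B *
      (SchwartzMap.seminorm ℝ k (n - i) u + SchwartzMap.seminorm ℝ (k + 1) (n - i) u) with hM
    have hM0 : 0 ≤ M := Finset.sum_nonneg fun i _ => by positivity
    have hle : ∀ j : ℕ, SchwartzMap.seminorm ℝ k n (v j - u) ≤ 1 / (j + 1 : ℝ) * M := fun j => by
      have hδ0 : (0 : ℝ) ≤ 1 / (j + 1 : ℝ) := by positivity
      have hδ1 : 1 / (j + 1 : ℝ) ≤ 1 := by
        rw [div_le_one (by positivity)]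
        linarith [(Nat.cast_nonneg j : (0 : ℝ) ≤ j)]
      refine SchwartzMap.seminorm_le_bound ℝ k n _ (by positivity) fun x => ?_
      have e : ⇑(v j - u) = fun x => (cutoff E ((1 / (j + 1 : ℝ)) • x) - 1) • u x := by
        funext x
        change cutoff E ((1 / (j + 1 : ℝ)) • x) • u x - u x = _
        rw [sub_smul, one_smul]
      have hc : ContDiff ℝ n fun x => cutoff E ((1 / (j + 1 : ℝ)) • x) - 1 :=
        ((cutoff E).contDiff.comp (contDiff_const_smul _)).sub contDiff_const
      rw [e]
      calc _ ≤ ‖x‖ ^ k * ∑ i ∈ Finset.range (n + 1), (n.choose i : ℝ) *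
            ‖iteratedFDeriv ℝ i (fun x => cutoff E ((1 / (j + 1 : ℝ)) • x) - 1) x‖ *
              ‖iteratedFDeriv ℝ (n - i) u x‖ := by
            gcongr
            exact norm_iteratedFDeriv_smul_le hc (u.smooth n) x le_rfl
        _ ≤ ‖x‖ ^ k * ∑ i ∈ Finset.range (n + 1), (n.choose i : ℝ) *
            (1 / (j + 1 : ℝ) * B * (1 + ‖x‖)) * ‖iteratedFDeriv ℝ (n - i) u x‖ := by
            gcongr with i hi
            exact hB i (by simpa [Nat.lt_succ_iff] using hi) _ hδ0 hδ1 x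
        _ = 1 / (j + 1 : ℝ) * ∑ i ∈ Finset.range (n + 1), (n.choose i : ℝ) * B *
            (‖x‖ ^ k * ‖iteratedFDeriv ℝ (n - i) u x‖ +
              ‖x‖ ^ (k + 1) * ‖iteratedFDeriv ℝ (n - i) u x‖) := by
            rw [Finset.mul_sum, Finset.mul_sum]
            refine Finset.sum_congr rfl fun i _ => ?_
            ring
        _ ≤ _ := by
            rw [hM]
            gcongr <;> exact SchwartzMap.le_seminorm ℝ _ _ _ _
    have hlim : Tendsto (fun j : ℕ => 1 / (j + 1 : ℝ) * M) atTop (𝓝 0) := by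
      simpa using tendsto_one_div_add_atTop_nhds_zero_nat.mul_const M
    filter_upwards [hlim.eventually (gt_mem_nhds hε)] with j hj
    exact (hle j).trans_lt hj
  · exact hv j

end Density

/-! ### The Landau operator on test functions -/

section LandauTest

theorem lineDeriv_eq_D₁ (u : SPlane) (x : Plane) : lineDeriv ℝ u x (1, 0) = D₁ u x :=
  u.differentiableAt.lineDeriv_eq_fderiv

theorem lineDeriv_eq_D₂ (u : SPlane) (x : Plane) : lineDeriv ℝ u x (0, 1) = D₂ u x :=
  u.differentiableAt.lineDeriv_eq_fderiv

theorem momentum₁_eq (u : SPlane) : momentum₁ u = p₁ u := by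
  funext x
  rw [momentum₁, lineDeriv_eq_D₁, p₁, smul_apply, smul_apply, smul_eq_mul]

theorem momentum₂_eq (b : ℝ) (u : SPlane) : momentum₂ b u = p₂ b u := by
  funext x
  rw [momentum₂, lineDeriv_eq_D₂, p₂, add_apply, smul_apply, smul_apply, add_apply, smul_apply,
    smul_apply, X₁_apply, smul_eq_mul, smul_eq_mul, mul_assoc]

theorem landauExpr_eq (b : ℝ) (u : SPlane) : landauExpr b u = landauS b u := by
  funext x
  rw [landauExpr, momentum₁_eq, momentum₁_eq, momentum₂_eq, momentum₂_eq]
  rfl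

theorem inner_landauS (b : ℝ) (u v : SPlane) :
    ⟪toL2 (landauS b u), toL2 v⟫_ℂ = ⟪toL2 u, toL2 (landauS b v)⟫_ℂ := by
  simp only [landauS, p₁, p₂, ContinuousLinearMap.comp_apply, smul_apply, add_apply, map_add,
    map_smul, inner_add_left, inner_smul_left, inner_add_right, inner_smul_right, inner_D₁,
    inner_D₂, inner_X₁, map_neg, Complex.conj_ofReal, Complex.conj_I]
  ring

end LandauTest


/-! ### Landau levels -/

section Levels

variable {b : ℝ}

/-- In the definition of the Landau operator, test functions may be replaced with Schwartz
functions. -/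
theorem IsLandau.inner {f g : L2 Plane} (h : IsLandau b f g) (u : SPlane) :
    ⟪toL2 (landauS b u), f⟫_ℂ = ⟪toL2 u, g⟫_ℂ := by
  have hc : Continuous fun u : SPlane => ⟪toL2 (landauS b u), f⟫_ℂ := by fun_prop
  have hc' : Continuous fun u : SPlane => ⟪toL2 u, g⟫_ℂ := by fun_prop
  refine congrFun (Continuous.ext_on dense_hasCompactSupport hc hc' fun u hu => ?_) u
  have h1 := h u u.smooth' hu
  rwa [landauExpr_eq, ← inner_toL2, ← inner_toL2] at h1

theorem inner_landauS_landauVec (hb : b ≠ 0) (u : SPlane) (n k : ℕ) :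
    ⟪toL2 (landauS b u), landauVec hb n k⟫_ℂ =
      ⟪toL2 u, (landauEnergy b n : ℂ) • landauVec hb n k⟫_ℂ := by
  rw [landauVec, inner_landauS, landauS_landauFun, map_smul]

theorem isLandau_landauVec (hb : b ≠ 0) (n k : ℕ) :
    IsLandau b (landauVec hb n k) ((landauEnergy b n : ℂ) • landauVec hb n k) := by
  intro φ hφ hc
  have h := inner_landauS_landauVec hb (hc.toSchwartzMap hφ) n k
  rwa [inner_toL2, inner_toL2, ← landauExpr_eq] at h

theorem landauVec_mem (hb : b ≠ 0) (n k : ℕ) : landauVec hb n k ∈ landauLevel b n :=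
  isLandau_landauVec hb n k

theorem landauEnergy_injective (hb : b ≠ 0) : Function.Injective (landauEnergy b) := by
  intro m n h
  have h1 : (2 * m + 1 : ℝ) = 2 * n + 1 := mul_left_cancel₀ (abs_ne_zero.2 hb) h
  exact_mod_cast (by linarith : (m : ℝ) = n)

/-- The Landau energies of different levels are different. -/
theorem eq_zero_of_landauEnergy_mul {m n : ℕ} (hb : b ≠ 0) (hmn : m ≠ n) {z : ℂ}
    (h : (landauEnergy b m : ℂ) * z = (landauEnergy b n : ℂ) * z) : z = 0 := by
  by_contra hz
  exact hmn (landauEnergy_injective hb (Complex.ofReal_injective (mul_right_cancel₀ hz h)))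

theorem inner_landauVec_of_mem (hb : b ≠ 0) {m n : ℕ} (hmn : m ≠ n) (j : ℕ) {f : L2 Plane}
    (hf : f ∈ landauLevel b n) : ⟪landauVec hb m j, f⟫_ℂ = 0 := by
  have h := IsLandau.inner (show IsLandau b f ((landauEnergy b n : ℂ) • f) from hf)
    (landauFun hb m j)
  rw [landauS_landauFun, map_smul, inner_smul_left, inner_smul_right, Complex.conj_ofReal] at h
  exact eq_zero_of_landauEnergy_mul hb hmn h

theorem landauProjector_landauVec_self (hb : b ≠ 0) (n k : ℕ) :
    landauProjector b n (landauVec hb n k) = landauVec hb n k :=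
  Submodule.starProjection_eq_self_iff.2 (landauVec_mem hb n k)

theorem landauProjector_landauVec_of_ne (hb : b ≠ 0) {m n : ℕ} (hmn : m ≠ n) (j : ℕ) :
    landauProjector b n (landauVec hb m j) = 0 := by
  rw [landauProjector, Submodule.starProjection_apply_eq_zero_iff, Submodule.mem_orthogonal]
  exact fun f hf => inner_eq_zero_symm.1 (inner_landauVec_of_mem hb hmn j hf)

end Levels

/-! ### The operator `L ⊗ 1` on tensor products -/

section SpaceLandau

variable {b : ℝ}

theorem hasCompactSupport_slice {φ : Space → ℂ} (hc : HasCompactSupport φ) (z : ℝ) :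
    HasCompactSupport fun y => φ (y, z) := by
  refine HasCompactSupport.intro (hc.isCompact.image continuous_fst) fun y hy => ?_
  by_contra h
  exact hy ⟨(y, z), subset_tsupport φ h, rfl⟩

theorem contDiff_slice {φ : Space → ℂ} (hφ : ContDiff ℝ ∞ φ) (z : ℝ) :
    ContDiff ℝ ∞ fun y => φ (y, z) :=
  hφ.comp (contDiff_id.prodMk contDiff_const)

theorem lineDeriv_slice {φ : Space → ℂ} (hφ : ContDiff ℝ ∞ φ) (x : Space) (v : Plane) :
    lineDeriv ℝ (fun y => φ (y, x.2)) x.1 v = fderiv ℝ φ x (v, 0) := by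
  have h : HasFDerivAt (fun y => φ (y, x.2))
      ((fderiv ℝ φ x).comp (ContinuousLinearMap.inl ℝ Plane ℝ)) x.1 :=
    HasFDerivAt.comp x.1 (hφ.differentiable (by simp) x).hasFDerivAt (hasFDerivAt_prodMk_left _ _)
  rw [(h.hasLineDerivAt v).lineDeriv]
  simp

theorem momentum_slice_test {φ : Space → ℂ} (hφ : ContDiff ℝ ∞ φ) (hc : HasCompactSupport φ) :
    (ContDiff ℝ ∞ fun x : Space => momentum₁ (fun y => φ (y, x.2)) x.1) ∧
      (HasCompactSupport fun x : Space => momentum₁ (fun y => φ (y, x.2)) x.1) ∧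
      (ContDiff ℝ ∞ fun x : Space => momentum₂ b (fun y => φ (y, x.2)) x.1) ∧
      HasCompactSupport fun x : Space => momentum₂ b (fun y => φ (y, x.2)) x.1 := by
  unfold momentum₁ momentum₂
  simp_rw [lineDeriv_slice hφ]
  have h1 : ∀ v, ContDiff ℝ ∞ fun x => fderiv ℝ φ x v := fun v =>
    (hφ.fderiv_right (m := ∞) (by simp)).clm_apply contDiff_const
  have h2 : ∀ v, HasCompactSupport fun x => fderiv ℝ φ x v := fun v =>
    (hc.fderiv (𝕜 := ℝ)).comp_left (g := fun T : Space →L[ℝ] ℂ => T v) rfl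
  have h3 : ContDiff ℝ ∞ fun x : Space => (b : ℂ) * (x.1.1 : ℂ) :=
    contDiff_const.mul (Complex.ofRealCLM.contDiff.comp (contDiff_fst.comp contDiff_fst))
  exact ⟨contDiff_const.mul (h1 _), (h2 _).mul_left (f := fun _ => -Complex.I),
    (contDiff_const.mul (h1 _)).add (h3.mul hφ),
    ((h2 _).mul_left (f := fun _ => -Complex.I)).add
      (hc.mul_left (f := fun x : Space => (b : ℂ) * (x.1.1 : ℂ)))⟩

theorem landauExprSpace_test {φ : Space → ℂ} (hφ : ContDiff ℝ ∞ φ) (hc : HasCompactSupport φ) :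
    Continuous (landauExprSpace b φ) ∧ HasCompactSupport (landauExprSpace b φ) := by
  obtain ⟨a1, a2, a3, a4⟩ := momentum_slice_test (b := b) hφ hc
  obtain ⟨b1, b2, -, -⟩ := momentum_slice_test (b := b) a1 a2
  obtain ⟨-, -, c1, c2⟩ := momentum_slice_test (b := b) a3 a4
  exact ⟨b1.continuous.add c1.continuous, b2.add c2⟩

theorem integrable_conj_mul_tensor {φ : Space → ℂ} (hφ : Continuous φ) (hc : HasCompactSupport φ)
    (f : L2 Plane) (g : L2 ℝ) :
    Integrable fun x : Space => starRingEnd ℂ (φ x) * (f x.1 * g x.2) := by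
  have h := (hφ.memLp_of_hasCompactSupport (p := 2) (μ := (volume : Measure Space)) hc).star
  exact h.integrable_mul (memLp_tensor f g)

/-- Fubini's theorem reduces the test of `L ⊗ 1` to the slices at fixed `x₃`. -/
theorem isLandauSpace_tensor (hb : b ≠ 0) (n k : ℕ) (g : L2 ℝ) :
    IsLandauSpace b (tensor (landauVec hb n k) g)
      ((landauEnergy b n : ℂ) • tensor (landauVec hb n k) g) := by
  intro φ hφ hc
  obtain ⟨h1, h2⟩ := landauExprSpace_test (b := b) hφ hc
  have e1 : ∫ x, starRingEnd ℂ (landauExprSpace b φ x) * tensor (landauVec hb n k) g x =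
      ∫ x : Space, starRingEnd ℂ (landauExprSpace b φ x) * (landauVec hb n k x.1 * g x.2) := by
    refine integral_congr_ae ?_
    filter_upwards [tensor_ae (landauVec hb n k) g] with x hx
    rw [hx]
  have e2 : ∫ x, starRingEnd ℂ (φ x) *
        ((landauEnergy b n : ℂ) • tensor (landauVec hb n k) g : L2 Space) x =
      ∫ x : Space, (landauEnergy b n : ℂ) *
        (starRingEnd ℂ (φ x) * (landauVec hb n k x.1 * g x.2)) := by
    refine integral_congr_ae ?_
    filter_upwards [tensor_ae (landauVec hb n k) g,
      Lp.coeFn_smul (landauEnergy b n : ℂ) (tensor (landauVec hb n k) g)] with x hx hx'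
    rw [hx', Pi.smul_apply, hx, smul_eq_mul]
    ring
  rw [e1, e2, integral_const_mul, Measure.volume_eq_prod,
    integral_prod_symm _ (integrable_conj_mul_tensor h1 h2 _ _),
    integral_prod_symm _ (integrable_conj_mul_tensor hφ.continuous hc _ _), ← integral_const_mul]
  refine integral_congr_ae (Filter.Eventually.of_forall fun z => ?_)
  have h3 := isLandau_landauVec hb n k _ (contDiff_slice hφ z) (hasCompactSupport_slice hc z)
  have e3 : ∫ y, starRingEnd ℂ (φ (y, z)) *
      ((landauEnergy b n : ℂ) • landauVec hb n k : L2 Plane) y =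
      (landauEnergy b n : ℂ) * ∫ y, starRingEnd ℂ (φ (y, z)) * landauVec hb n k y := by
    rw [← integral_const_mul]
    refine integral_congr_ae ?_
    filter_upwards [Lp.coeFn_smul (landauEnergy b n : ℂ) (landauVec hb n k)] with y hy
    rw [hy, Pi.smul_apply, smul_eq_mul]
    ring
  rw [e3] at h3
  simp only [← mul_assoc]
  rw [integral_mul_const, integral_mul_const]
  change (∫ y, starRingEnd ℂ (landauExpr b (fun y => φ (y, z)) y) * landauVec hb n k y) * g z = _
  rw [h3, mul_assoc]

theorem IsLandauSpace.inner_tensor_of_hasCompactSupport {F G : L2 Space}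
    (h : IsLandauSpace b F G) {u : SPlane} (hu : HasCompactSupport u) {w : SchwartzMap ℝ ℂ}
    (hw : HasCompactSupport w) :
    ⟪tensor (toL2 (landauS b u)) (w.toLp 2 volume), F⟫_ℂ =
      ⟪tensor (toL2 u) (w.toLp 2 volume), G⟫_ℂ := by
  have key : ∀ (v : SPlane) (H : L2 Space), ⟪tensor (toL2 v) (w.toLp 2 volume), H⟫_ℂ =
      ∫ x : Space, starRingEnd ℂ (v x.1 * w x.2) * H x := fun v H => by
    rw [L2_inner_eq]
    refine integral_congr_ae ?_
    filter_upwards [tensor_ae (toL2 v) (w.toLp 2 volume), ae_fst (toL2_ae v),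
      ae_snd (w.coeFn_toLp 2 volume)] with x h1 h2 h3
    rw [h1, h2, h3]
  have h1 := h (fun x => u x.1 * w x.2)
    ((u.smooth'.comp contDiff_fst).mul (w.smooth'.comp contDiff_snd)) (by
      refine HasCompactSupport.intro (hu.isCompact.prod hw.isCompact) fun x hx => ?_
      by_contra h0
      exact hx ⟨subset_tsupport u (left_ne_zero_of_mul h0),
        subset_tsupport w (right_ne_zero_of_mul h0)⟩)
  rw [key, key, ← h1]
  congr 1
  funext x
  have h2 : (fun y => u y * w x.2) = ⇑(w x.2 • u) := by
    funext y
    rw [smul_apply, smul_eq_mul, mul_comm]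
  rw [landauExprSpace, h2, landauExpr_eq, map_smul, smul_apply, smul_eq_mul, mul_comm (w x.2)]

/-- The analogue of `IsLandau.inner` for `L ⊗ 1`: the test functions `u ⊗ w` suffice to replace `u`
with any Schwartz function and `w` with any element of `L²(ℝ)`. -/
theorem IsLandauSpace.inner_tensor {F G : L2 Space} (h : IsLandauSpace b F G) (u : SPlane)
    (g : L2 ℝ) : ⟪tensor (toL2 (landauS b u)) g, F⟫_ℂ = ⟪tensor (toL2 u) g, G⟫_ℂ := by
  simp only [← tensorL_apply]
  have hd : Dense ((SchwartzMap.toLpCLM ℂ ℂ 2 (volume : Measure ℝ)) ''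
      {w : SchwartzMap ℝ ℂ | HasCompactSupport w}) :=
    (SchwartzMap.denseRange_toLpCLM (by simp)).dense_image
      (SchwartzMap.toLpCLM ℂ ℂ 2 (volume : Measure ℝ)).continuous dense_hasCompactSupport
  have hg : ∀ u : SPlane, HasCompactSupport u → ∀ g : L2 ℝ,
      ⟪tensorL (toL2 (landauS b u)) g, F⟫_ℂ = ⟪tensorL (toL2 u) g, G⟫_ℂ := fun u hu g => by
    refine congrFun (Continuous.ext_on hd (f := fun g => ⟪tensorL (toL2 (landauS b u)) g, F⟫_ℂ)
      (g := fun g => ⟪tensorL (toL2 u) g, G⟫_ℂ) (by fun_prop) (by fun_prop) ?_) g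
    rintro _ ⟨w, hw, rfl⟩
    exact h.inner_tensor_of_hasCompactSupport hu hw
  exact congrFun (Continuous.ext_on dense_hasCompactSupport
    (f := fun u : SPlane => ⟪tensorL (toL2 (landauS b u)) g, F⟫_ℂ)
    (g := fun u : SPlane => ⟪tensorL (toL2 u) g, G⟫_ℂ) (by fun_prop) (by fun_prop)
    fun u hu => hg u hu g) u

/-- An operator commuting with `L ⊗ 1` does not connect different Landau levels. -/
theorem inner_tensor_apply_tensor_of_ne (hb : b ≠ 0) {γ : L2 Space →L[ℂ] L2 Space}
    (hγ : CommutesWithLandau b γ) {m n : ℕ} (hmn : m ≠ n) (j k : ℕ) (g g' : L2 ℝ) :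
    ⟪tensor (landauVec hb m j) g', γ (tensor (landauVec hb n k) g)⟫_ℂ = 0 := by
  have h := (hγ _ _ (isLandauSpace_tensor hb n k g)).inner_tensor (landauFun hb m j) g'
  rw [landauS_landauFun, map_smul, tensor_smul_left, map_smul, inner_smul_left, inner_smul_right,
    Complex.conj_ofReal] at h
  exact eq_zero_of_landauEnergy_mul hb hmn h

end SpaceLandau


/-! ### Generators of the magnetic translations -/

section Generators

variable {b : ℝ}

/-- Translates of a Schwartz function by at most a unit vector have a common square integrable
bound. -/
theorem exists_bound_shift (u : SPlane) (v : Plane) (hv : ‖v‖ ≤ 1) :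
    ∃ C : ℝ, ∀ t ∈ Metric.ball (0 : ℝ) 1, ∀ y : Plane,
      ‖u (y - t • v)‖ ≤ C * (1 + ‖y‖) ^ (-2 : ℝ) := by
  refine ⟨4 * (2 ^ 2 * (Finset.Iic (2, 0)).sup (fun m => SchwartzMap.seminorm ℝ m.1 m.2) u),
    fun t ht y => ?_⟩
  have h1 := SchwartzMap.one_add_le_sup_seminorm_apply (𝕜 := ℝ) (m := (2, 0)) (k := 2) (n := 0)
    le_rfl le_rfl u (y - t • v)
  rw [norm_iteratedFDeriv_zero] at h1
  have h2 : ‖y‖ ≤ ‖y - t • v‖ + 1 := by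
    have h3 : ‖t • v‖ ≤ 1 := by
      rw [norm_smul]
      exact mul_le_one₀ (by simpa using (Metric.mem_ball.1 ht).le) (norm_nonneg _) hv
    have h4 := norm_add_le (y - t • v) (t • v)
    rw [sub_add_cancel] at h4
    linarith
  have h5 : 0 < 1 + ‖y‖ := by positivity
  rw [Real.rpow_neg h5.le, ← div_eq_mul_inv, le_div_iff₀ (by positivity)]
  norm_num at h1 ⊢
  calc ‖u (y - t • v)‖ * (1 + ‖y‖) ^ 2 ≤ ‖u (y - t • v)‖ * (2 * (1 + ‖y - t • v‖)) ^ 2 := by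
        gcongr
        linarith [norm_nonneg (y - t • v)]
    _ = 4 * ((1 + ‖y - t • v‖) ^ 2 * ‖u (y - t • v)‖) := by ring
    _ ≤ _ := by gcongr

theorem memLp_one_add_norm : MemLp (fun y : Plane => (1 + ‖y‖) ^ (-2 : ℝ)) 2 volume := by
  rw [memLp_two_iff_integrable_sq (by fun_prop : Measurable _).aestronglyMeasurable]
  have h : Integrable (fun y : Plane => (1 + ‖y‖) ^ (-4 : ℝ)) volume :=
    integrable_one_add_norm (by simp; norm_num)
  refine h.congr (Filter.Eventually.of_forall fun y => ?_)
  simp only []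
  rw [← Real.rpow_natCast, ← Real.rpow_mul (by positivity)]
  norm_num

theorem magneticTranslation_tensor_ae (b : ℝ) (R : Plane) (w : SPlane) (g : L2 ℝ) :
    magneticTranslation b R (tensor (toL2 w) g) =ᵐ[volume] fun x : Space =>
      Complex.exp (-(Complex.I * ((b * R.1 * x.1.2 : ℝ) : ℂ))) * w (x.1 - R) * g x.2 := by
  filter_upwards [magneticTranslation_ae b R (tensor (toL2 w) g),
    (measurePreserving_shift R).quasiMeasurePreserving.ae (tensor_ae (toL2 w) g),
    (measurePreserving_shift R).quasiMeasurePreserving.ae (ae_fst (toL2_ae w))] with x h1 h2 h3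
  have h4 : ((x.1.1 - R.1, x.1.2 - R.2) : Plane) = x.1 - R := rfl
  rw [h1, h2, h3, h4]
  ring

/-- The generator of the magnetic translations in the direction `v`. -/
noncomputable def generator (b : ℝ) (v : Plane) : SPlane →L[ℂ] SPlane :=
  (v.1 : ℂ) • k₁ b + (v.2 : ℂ) • k₂

/-- Along a coordinate axis (`v₁ v₂ = 0`) the magnetic translations form a one-parameter group, and
`generator b v` generates it at every time. -/
theorem hasDerivAt_shift (w : SPlane) (v : Plane) (hv : v.1 * v.2 = 0) (y : Plane) (t : ℝ) :
    HasDerivAt (fun t : ℝ => Complex.exp (-(Complex.I * ((b * (t • v).1 * y.2 : ℝ) : ℂ))) *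
      w (y - t • v))
      (-Complex.I * (Complex.exp (-(Complex.I * ((b * (t • v).1 * y.2 : ℝ) : ℂ))) *
        generator b v w (y - t • v))) t := by
  have h1 : HasDerivAt (fun t : ℝ => y - t • v) (-v) t := by
    simpa using ((hasDerivAt_id t).smul_const v).const_sub y
  have h2 : HasDerivAt (fun t : ℝ => w (y - t • v)) (fderiv ℝ w (y - t • v) (-v)) t :=
    w.differentiableAt.hasFDerivAt.comp_hasDerivAt t h1
  have h3 : HasDerivAt (fun t : ℝ => -(Complex.I * ((b * (t • v).1 * y.2 : ℝ) : ℂ)))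
      (-(Complex.I * ((b * v.1 * y.2 : ℝ) : ℂ))) t := by
    have h4 : HasDerivAt (fun t : ℝ => b * (t • v).1 * y.2) (b * v.1 * y.2) t := by
      simpa using (((hasDerivAt_id t).mul_const v.1).const_mul b).mul_const y.2
    exact (h4.ofReal_comp.const_mul _).neg
  refine (h3.cexp.mul h2).congr_deriv ?_
  have h5 : fderiv ℝ w (y - t • v) (-v) =
      -((v.1 : ℂ) * D₁ w (y - t • v) + (v.2 : ℂ) * D₂ w (y - t • v)) := by
    have h6 : ∀ T : Plane →L[ℝ] ℂ, T v = v.1 * T (1, 0) + v.2 * T (0, 1) := fun T => by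
      conv_lhs => rw [show v = v.1 • ((1 : ℝ), (0 : ℝ)) + v.2 • ((0 : ℝ), (1 : ℝ)) by simp]
      rw [map_add, map_smul, map_smul, Complex.real_smul, Complex.real_smul]
    rw [map_neg, D₁_apply, D₂_apply, h6]
  have h7 : (v.1 : ℂ) * v.2 = 0 := by exact_mod_cast hv
  rw [h5]
  simp only [generator, k₁, k₂, add_apply, smul_apply, X₂_apply, smul_eq_mul, Prod.snd_sub,
    Prod.smul_snd]
  push_cast
  linear_combination (-Complex.I * b * t * w (y - t • v) * Complex.exp
      (-(Complex.I * (b * ((t • v).1 : ℝ) * y.2)))) * h7 -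
    Complex.exp (-(Complex.I * (b * ((t • v).1 : ℝ) * y.2))) *
      ((v.1 : ℂ) * D₁ w (y - t • v) + (v.2 : ℂ) * D₂ w (y - t • v)) * Complex.I_mul_I

/-- Weak differentiability of the magnetic translations on `w ⊗ g` with `w` a Schwartz function, by
differentiation under the integral. -/
theorem hasDerivAt_inner_magneticTranslation (F : L2 Space) (w : SPlane) (g : L2 ℝ) (v : Plane)
    (hv : v.1 * v.2 = 0) (hv1 : ‖v‖ ≤ 1) :
    HasDerivAt (fun t : ℝ => ⟪F, magneticTranslation b (t • v) (tensor (toL2 w) g)⟫_ℂ)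
      (-Complex.I * ⟪F, tensor (toL2 (generator b v w)) g⟫_ℂ) 0 := by
  obtain ⟨C, hC⟩ := exists_bound_shift (generator b v w) v hv1
  have hexp : ∀ (t : ℝ) (x : Space),
      ‖Complex.exp (-(Complex.I * ((b * (t • v).1 * x.1.2 : ℝ) : ℂ)))‖ = 1 := fun t x => by
    simp [Complex.norm_exp]
  have e : ∀ t : ℝ, ⟪F, magneticTranslation b (t • v) (tensor (toL2 w) g)⟫_ℂ =
      ∫ x : Space, starRingEnd ℂ (F x) * g x.2 *
        (Complex.exp (-(Complex.I * ((b * (t • v).1 * x.1.2 : ℝ) : ℂ))) * w (x.1 - t • v)) :=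
      fun t => by
    rw [L2_inner_eq]
    refine integral_congr_ae ?_
    filter_upwards [magneticTranslation_tensor_ae b (t • v) w g] with x hx
    rw [hx]
    ring
  have hFg : AEStronglyMeasurable (fun x : Space => starRingEnd ℂ (F x) * g x.2) volume :=
    (Complex.continuous_conj.comp_aestronglyMeasurable (Lp.aestronglyMeasurable F)).mul
      (Lp.aestronglyMeasurable g).comp_snd
  have hmeas : ∀ (u : SPlane) (t : ℝ), AEStronglyMeasurable (fun x : Space =>
      starRingEnd ℂ (F x) * g x.2 *
        (Complex.exp (-(Complex.I * ((b * (t • v).1 * x.1.2 : ℝ) : ℂ))) * u (x.1 - t • v)))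
      volume := fun u t => by
    refine hFg.mul (Continuous.aestronglyMeasurable ?_)
    have := u.continuous
    fun_prop
  have hbound : Integrable (fun x : Space => ‖F x‖ * (C * (1 + ‖x.1‖) ^ (-2 : ℝ) * ‖g x.2‖))
      volume := by
    have h1 : MemLp (fun x : Space => (1 + ‖x.1‖) ^ (-2 : ℝ) * ‖g x.2‖) 2 volume := by
      have hm : AEStronglyMeasurable (fun x : Space => (1 + ‖x.1‖) ^ (-2 : ℝ) * ‖g x.2‖)
          (volume : Measure Space) :=
        (memLp_one_add_norm.1.comp_fst).mul (Lp.aestronglyMeasurable g).norm.comp_snd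
      rw [memLp_two_iff_integrable_sq hm]
      have h2 := Integrable.mul_prod memLp_one_add_norm.integrable_sq
        (Lp.memLp g).norm.integrable_sq
      simp only [mul_pow]
      exact h2
    refine ((Lp.memLp F).norm.integrable_mul (h1.const_mul C)).congr
      (Filter.Eventually.of_forall fun x => ?_)
    simp only [Pi.mul_apply, mul_assoc]
  have key := hasDerivAt_integral_of_dominated_loc_of_deriv_le (μ := (volume : Measure Space))
    (𝕜 := ℝ) (E := ℂ) (x₀ := 0) (s := Metric.ball 0 1)
    (F := fun t x => starRingEnd ℂ (F x) * g x.2 *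
      (Complex.exp (-(Complex.I * ((b * (t • v).1 * x.1.2 : ℝ) : ℂ))) * w (x.1 - t • v)))
    (F' := fun t x => starRingEnd ℂ (F x) * g x.2 *
      (-Complex.I * (Complex.exp (-(Complex.I * ((b * (t • v).1 * x.1.2 : ℝ) : ℂ))) *
        generator b v w (x.1 - t • v))))
    (bound := fun x => ‖F x‖ * (C * (1 + ‖x.1‖) ^ (-2 : ℝ) * ‖g x.2‖))
    (Metric.ball_mem_nhds _ one_pos) (Filter.Eventually.of_forall fun t => hmeas w t) ?_ ?_ ?_
    hbound ?_
  · simp_rw [e]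
    refine key.2.congr_deriv ?_
    rw [L2_inner_eq, ← integral_const_mul]
    refine integral_congr_ae ?_
    filter_upwards [tensor_ae (toL2 (generator b v w)) g, ae_fst (toL2_ae (generator b v w))]
      with x h1 h2
    rw [h1, h2]
    simp
    ring
  · refine (integrable_conj_mul F
      (magneticTranslation b ((0 : ℝ) • v) (tensor (toL2 w) g))).congr ?_
    filter_upwards [magneticTranslation_tensor_ae b ((0 : ℝ) • v) w g] with x hx
    rw [hx]
    ring
  · refine ((hmeas (generator b v w) 0).const_mul (-Complex.I)).congr
      (Filter.Eventually.of_forall fun x => ?_)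
    simp only []
    ring
  · refine Filter.Eventually.of_forall fun x t ht => ?_
    rw [norm_mul, norm_mul, norm_mul, norm_mul, hexp, one_mul, norm_neg, Complex.norm_I, one_mul,
      RCLike.norm_conj, mul_assoc]
    have h1 := hC t ht x.1
    rw [mul_comm ‖g x.2‖]
    gcongr
  · exact Filter.Eventually.of_forall fun x t _ => (hasDerivAt_shift w v hv x.1 t).const_mul _

end Generators


/-! ### Operators commuting with the magnetic translations -/

section Commutant

variable {b : ℝ} {γ : L2 Space →L[ℂ] L2 Space}

/-- Differentiating `γ 𝔪_{tv} = 𝔪_{tv} γ` at `t = 0`: the operator commutes weakly with the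
generators of the magnetic translations. -/
theorem inner_generator
    (hγ : ∀ R : Plane, γ ∘L magneticTranslation b R = magneticTranslation b R ∘L γ)
    {v : Plane} (hv : v.1 * v.2 = 0) (hv1 : ‖v‖ ≤ 1) (u w : SPlane) (g g' : L2 ℝ) :
    ⟪tensor (toL2 u) g', γ (tensor (toL2 (generator b v w)) g)⟫_ℂ =
      ⟪tensor (toL2 (generator b v u)) g', γ (tensor (toL2 w) g)⟫_ℂ := by
  have h1 := hasDerivAt_inner_magneticTranslation (b := b) (γ.adjoint (tensor (toL2 u) g')) w g v
    hv hv1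
  have h2 := hasDerivAt_inner_magneticTranslation (b := b) (γ (tensor (toL2 w) g)) u g' v hv hv1
  have h3 : HasDerivAt (fun t : ℝ => starRingEnd ℂ
      ⟪γ (tensor (toL2 w) g), magneticTranslation b ((-t) • v) (tensor (toL2 u) g')⟫_ℂ)
      (starRingEnd ℂ (-(-Complex.I *
        ⟪γ (tensor (toL2 w) g), tensor (toL2 (generator b v u)) g'⟫_ℂ))) 0 := by
    have h4 := (HasDerivAt.scomp (h := fun t : ℝ => -t) (0 : ℝ) (by simpa using h2)
      (hasDerivAt_neg (0 : ℝ)))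
    have h5 := (Complex.conjCLE : ℂ →L[ℝ] ℂ).hasFDerivAt.comp_hasDerivAt (0 : ℝ) h4
    simpa [Function.comp_def] using h5
  have e : ∀ t : ℝ, ⟪γ.adjoint (tensor (toL2 u) g'),
      magneticTranslation b (t • v) (tensor (toL2 w) g)⟫_ℂ = starRingEnd ℂ
      ⟪γ (tensor (toL2 w) g), magneticTranslation b ((-t) • v) (tensor (toL2 u) g')⟫_ℂ :=
    fun t => by
    have h6 : b * (t • v).1 * (t • v).2 = 0 := by
      simp only [Prod.smul_fst, Prod.smul_snd, smul_eq_mul]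
      linear_combination b * t * t * hv
    rw [ContinuousLinearMap.adjoint_inner_left, inner_conj_symm, neg_smul]
    have h7 : γ (magneticTranslation b (t • v) (tensor (toL2 w) g)) =
        magneticTranslation b (t • v) (γ (tensor (toL2 w) g)) := DFunLike.congr_fun (hγ (t • v)) _
    rw [h7, ← ContinuousLinearMap.adjoint_inner_left, adjoint_magneticTranslation, h6]
    simp
  simp_rw [e] at h1
  have h8 := h1.unique h3
  rw [ContinuousLinearMap.adjoint_inner_left, map_neg, map_mul, inner_conj_symm, map_neg,
    Complex.conj_I, neg_neg, ← neg_mul] at h8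
  exact mul_left_cancel₀ (neg_ne_zero.2 Complex.I_ne_zero) h8

theorem generator_fst (b : ℝ) : generator b (1, 0) = k₁ b := by simp [generator]
theorem generator_snd (b : ℝ) : generator b (0, 1) = k₂ := by simp [generator]

theorem inner_k₁ (hγ : ∀ R : Plane, γ ∘L magneticTranslation b R = magneticTranslation b R ∘L γ)
    (u w : SPlane) (g g' : L2 ℝ) : ⟪tensor (toL2 u) g', γ (tensor (toL2 (k₁ b w)) g)⟫_ℂ =
      ⟪tensor (toL2 (k₁ b u)) g', γ (tensor (toL2 w) g)⟫_ℂ := by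
  have h := inner_generator hγ (v := (1, 0)) (by simp) (by simp [Prod.norm_def]) u w g g'
  rwa [generator_fst] at h

theorem inner_k₂ (hγ : ∀ R : Plane, γ ∘L magneticTranslation b R = magneticTranslation b R ∘L γ)
    (u w : SPlane) (g g' : L2 ℝ) : ⟪tensor (toL2 u) g', γ (tensor (toL2 (k₂ w)) g)⟫_ℂ =
      ⟪tensor (toL2 (k₂ u)) g', γ (tensor (toL2 w) g)⟫_ℂ := by
  have h := inner_generator hγ (v := (0, 1)) (by simp) (by simp [Prod.norm_def]) u w g g'
  rwa [generator_snd] at h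

theorem inner_apply_lowerM
    (hγ : ∀ R : Plane, γ ∘L magneticTranslation b R = magneticTranslation b R ∘L γ)
    (u w : SPlane) (g g' : L2 ℝ) : ⟪tensor (toL2 u) g', γ (tensor (toL2 (lowerM b w)) g)⟫_ℂ =
      ⟪tensor (toL2 (raiseM b u)) g', γ (tensor (toL2 w) g)⟫_ℂ := by
  simp only [lowerM, raiseM, ← tensorL_apply, smul_apply, add_apply, sub_apply, map_add, map_sub,
    map_smul, inner_add_right, inner_smul_right, inner_smul_left, inner_sub_left]
  simp only [tensorL_apply, inner_k₁ hγ, inner_k₂ hγ, map_mul, conj_sgn, conj_ladderNorm,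
    Complex.conj_I]
  ring

theorem inner_apply_raiseM
    (hγ : ∀ R : Plane, γ ∘L magneticTranslation b R = magneticTranslation b R ∘L γ)
    (u w : SPlane) (g g' : L2 ℝ) : ⟪tensor (toL2 u) g', γ (tensor (toL2 (raiseM b w)) g)⟫_ℂ =
      ⟪tensor (toL2 (lowerM b u)) g', γ (tensor (toL2 w) g)⟫_ℂ := by
  simp only [lowerM, raiseM, ← tensorL_apply, smul_apply, add_apply, sub_apply, map_add, map_sub,
    map_smul, inner_sub_right, inner_smul_right, inner_smul_left, inner_add_left]
  simp only [tensorL_apply, inner_k₁ hγ, inner_k₂ hγ, map_mul, conj_sgn, conj_ladderNorm,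
    Complex.conj_I]
  ring

theorem ofReal_sqrt_succ_ne_zero (n : ℕ) : ((√(n + 1 : ℝ) : ℝ) : ℂ) ≠ 0 :=
  Complex.ofReal_ne_zero.2 (by positivity)

/-- Schur's lemma: within a Landau level, the operator acts as a multiple of the identity in the
quantum number `k`. -/
theorem inner_apply_landauVec
    (hγ : ∀ R : Plane, γ ∘L magneticTranslation b R = magneticTranslation b R ∘L γ) (hb : b ≠ 0)
    (n j k : ℕ) (g g' : L2 ℝ) :
    ⟪tensor (landauVec hb n j) g', γ (tensor (landauVec hb n k) g)⟫_ℂ =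
      if j = k then ⟪tensor (landauVec hb n 0) g', γ (tensor (landauVec hb n 0) g)⟫_ℂ else 0 := by
  unfold landauVec
  induction j generalizing k with
  | zero =>
    cases k with
    | zero => simp
    | succ k =>
      have h := inner_apply_raiseM hγ (landauFun hb n 0) (landauFun hb n k) g g'
      rw [lowerM_landauFun_zero, raiseM_landauFun, map_smul, tensor_smul_left, map_smul,
        inner_smul_right, map_zero, ← tensorL_apply 0, map_zero, zero_apply, inner_zero_left] at h
      rw [if_neg (by simp)]
      exact (mul_eq_zero.1 h).resolve_left (ofReal_sqrt_succ_ne_zero k)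
  | succ j ih =>
    cases k with
    | zero =>
      have h := inner_apply_lowerM hγ (landauFun hb n j) (landauFun hb n 0) g g'
      rw [lowerM_landauFun_zero, raiseM_landauFun, map_smul, tensor_smul_left,
        inner_smul_left, map_zero, ← tensorL_apply 0, map_zero, zero_apply, map_zero,
        inner_zero_right, Complex.conj_ofReal] at h
      rw [if_neg (by simp)]
      exact (mul_eq_zero.1 h.symm).resolve_left (ofReal_sqrt_succ_ne_zero j)
    | succ k =>
      have h := inner_apply_lowerM hγ (landauFun hb n j) (landauFun hb n (k + 1)) g g'
      rw [lowerM_landauFun_succ, raiseM_landauFun, map_smul, map_smul, tensor_smul_left,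
        tensor_smul_left, map_smul, inner_smul_left, inner_smul_right, Complex.conj_ofReal, ih] at h
      by_cases hjk : j = k
      · subst hjk
        simpa using (mul_left_cancel₀ (ofReal_sqrt_succ_ne_zero j) h).symm
      · rw [if_neg hjk, mul_zero] at h
        rw [if_neg (by simpa using hjk)]
        exact (mul_eq_zero.1 h.symm).resolve_left (ofReal_sqrt_succ_ne_zero j)

/-- The block of an operator in the Landau level `n`, as an operator on `L²(ℝ)`. -/
noncomputable def levelBlock (hb : b ≠ 0) (γ : L2 Space →L[ℂ] L2 Space) (n : ℕ) :
    L2 ℝ →L[ℂ] L2 ℝ :=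
  (tensorL (landauVec hb n 0)).adjoint ∘L γ ∘L tensorL (landauVec hb n 0)

theorem inner_levelBlock (hb : b ≠ 0) (γ : L2 Space →L[ℂ] L2 Space) (n : ℕ) (g g' : L2 ℝ) :
    ⟪g', levelBlock hb γ n g⟫_ℂ =
      ⟪tensor (landauVec hb n 0) g', γ (tensor (landauVec hb n 0) g)⟫_ℂ := by
  simp only [levelBlock, ContinuousLinearMap.comp_apply, ContinuousLinearMap.adjoint_inner_right,
    tensorL_apply]

theorem norm_landauVec (hb : b ≠ 0) (n k : ℕ) : ‖landauVec hb n k‖ = 1 :=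
  (orthonormal_landauVec hb).1 (n, k)

theorem norm_levelBlock_le (hb : b ≠ 0) (γ : L2 Space →L[ℂ] L2 Space) (n : ℕ) :
    ‖levelBlock hb γ n‖ ≤ ‖γ‖ := by
  have h1 : ‖tensorL (landauVec hb n 0)‖ ≤ 1 :=
    ContinuousLinearMap.opNorm_le_bound _ zero_le_one fun g => by
      rw [tensorL_apply, norm_tensor, norm_landauVec]
  calc ‖levelBlock hb γ n‖ ≤ ‖(tensorL (landauVec hb n 0)).adjoint‖ *
        (‖γ‖ * ‖tensorL (landauVec hb n 0)‖) :=
        (ContinuousLinearMap.opNorm_comp_le _ _).trans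
          (mul_le_mul_of_nonneg_left (ContinuousLinearMap.opNorm_comp_le _ _) (norm_nonneg _))
    _ ≤ 1 * (‖γ‖ * 1) := by
        rw [LinearIsometryEquiv.norm_map]
        gcongr
    _ = ‖γ‖ := by ring

/-- On the level `n` the operator acts as `1 ⊗ levelBlock hb γ n`: the matrix elements between
different levels vanish, and within the level Schur's lemma applies. -/
theorem apply_tensor_landauVec
    (hγ : ∀ R : Plane, γ ∘L magneticTranslation b R = magneticTranslation b R ∘L γ)
    (hL : CommutesWithLandau b γ) (hb : b ≠ 0) (n k : ℕ) (g : L2 ℝ) :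
    γ (tensor (landauVec hb n k) g) = tensor (landauVec hb n k) (levelBlock hb γ n g) := by
  rw [← sub_eq_zero]
  refine eq_zero_of_forall_inner_tensor_basis (landauBasis hb) (stdBasis (L2 ℝ)) _ fun p l => ?_
  rw [landauBasis_apply, inner_sub_right, inner_tensor, inner_landauVec, inner_levelBlock,
    sub_eq_zero]
  by_cases hp : p.1 = n
  · rw [hp, inner_apply_landauVec hγ hb]
    by_cases hk : p.2 = k <;> simp [hk]
  · rw [inner_tensor_apply_tensor_of_ne hb hL hp]
    simp [hp]

theorem apply_tensor_landauProjector
    (hγ : ∀ R : Plane, γ ∘L magneticTranslation b R = magneticTranslation b R ∘L γ)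
    (hL : CommutesWithLandau b γ) (hb : b ≠ 0) (n : ℕ) (f : L2 Plane) (g : L2 ℝ) :
    γ (tensor (landauProjector b n f) g) =
      tensor (landauProjector b n f) (levelBlock hb γ n g) := by
  have h : γ ∘L tensorL.flip g ∘L landauProjector b n =
      tensorL.flip (levelBlock hb γ n g) ∘L landauProjector b n := by
    refine (landauBasis hb).ext_continuousLinearMap fun p => ?_
    simp only [ContinuousLinearMap.comp_apply, landauBasis_apply]
    by_cases hp : p.1 = n
    · rw [hp, landauProjector_landauVec_self hb]
      simpa using apply_tensor_landauVec hγ hL hb n p.2 g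
    · rw [landauProjector_landauVec_of_ne hb hp]
      simp
  simpa using DFunLike.congr_fun h f

end Commutant

/-! ### The decomposition into Landau levels -/

section Decomposition

variable {b : ℝ} (hb : b ≠ 0)

/-- The sum of all Landau levels but the `n`-th one, tensored with `L²(ℝ)`. -/
noncomputable def otherLevels (n : ℕ) : Submodule ℂ (L2 Space) :=
  Submodule.span ℂ {F | ∃ m, m ≠ n ∧ ∃ j g, F = tensor (landauVec hb m j) g}

/-- The projector `P_n ⊗ 1` on `L²(ℝ³)`, onto the orthogonal complement of the other levels. -/
noncomputable def levelProjector (n : ℕ) : L2 Space →L[ℂ] L2 Space :=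
  (otherLevels hb n)ᗮ.starProjection

theorem levelProjector_tensor_self (n k : ℕ) (g : L2 ℝ) :
    levelProjector hb n (tensor (landauVec hb n k) g) = tensor (landauVec hb n k) g := by
  refine Submodule.starProjection_eq_self_iff.2 ?_
  rw [otherLevels, Submodule.mem_orthogonal]
  intro F hF
  induction hF using Submodule.span_induction with
  | mem F h =>
    obtain ⟨m, hm, j, g', rfl⟩ := h
    rw [inner_tensor, inner_landauVec]
    simp [hm]
  | zero => simp
  | add x y _ _ hx hy => rw [inner_add_left, hx, hy, add_zero]
  | smul c x _ hx => rw [inner_smul_left, hx, mul_zero]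

theorem levelProjector_tensor_of_ne {m n : ℕ} (hmn : m ≠ n) (j : ℕ) (g : L2 ℝ) :
    levelProjector hb n (tensor (landauVec hb m j) g) = 0 :=
  Submodule.starProjection_orthogonal_apply_eq_zero (Submodule.subset_span ⟨m, hmn, j, g, rfl⟩)

theorem levelProjector_tensor (n : ℕ) (f : L2 Plane) (g : L2 ℝ) :
    levelProjector hb n (tensor f g) = tensor (landauProjector b n f) g := by
  have h : levelProjector hb n ∘L tensorL.flip g = tensorL.flip g ∘L landauProjector b n := by
    refine (landauBasis hb).ext_continuousLinearMap fun p => ?_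
    simp only [ContinuousLinearMap.comp_apply, landauBasis_apply, ContinuousLinearMap.flip_apply,
      tensorL_apply]
    by_cases hp : p.1 = n
    · rw [hp, landauProjector_landauVec_self hb, levelProjector_tensor_self]
    · rw [landauProjector_landauVec_of_ne hb hp, levelProjector_tensor_of_ne hb hp, ← tensorL_apply,
        map_zero, zero_apply]
  simpa using DFunLike.congr_fun h f

/-- The projectors `P_n ⊗ 1` resolve the identity: group the expansion in the basis `e_{nk} ⊗ q_l`
by the level `n`. -/
theorem hasSum_levelProjector (F : L2 Space) : HasSum (fun n => levelProjector hb n F) F := by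
  have h := (tensorBasis (landauBasis hb) (stdBasis (L2 ℝ))).hasSum_repr F
  rw [← (Equiv.prodAssoc ℕ ℕ (basisIndex (L2 ℝ))).symm.hasSum_iff] at h
  refine h.prod_fiberwise fun n => ?_
  have h1 := h.mapL (levelProjector hb n)
  have hinj : Function.Injective (Prod.mk n : ℕ × basisIndex (L2 ℝ) → _) :=
    Prod.mk_right_injective n
  refine ((hinj.hasSum_iff ?_).2 h1).congr_fun fun q => ?_
  · rintro ⟨m, q⟩ hm
    have hmn : m ≠ n := fun h0 => hm ⟨q, by rw [h0]⟩
    simp only [Function.comp_apply, tensorBasis_apply, landauBasis_apply, map_smul,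
      Equiv.prodAssoc_symm_apply, levelProjector_tensor_of_ne hb hmn, smul_zero]
  · simp only [Function.comp_apply, tensorBasis_apply, landauBasis_apply, map_smul,
      Equiv.prodAssoc_symm_apply, levelProjector_tensor_self]

end Decomposition


/-! ### Traces of positive operators -/

section PositiveTrace

variable {ι : Type*}

/-- For a convergent series of nonnegative complex numbers, where `z ≥ 0` is expressed as `‖z‖ = z`,
the modulus of the sum is the sum in `ℝ≥0∞`. -/
theorem enorm_eq_tsum_of_hasSum {f : ι → ℂ} {a : ℂ} (hf : ∀ i, (‖f i‖ : ℂ) = f i)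
    (h : HasSum f a) : ‖a‖ₑ = ∑' i, ‖f i‖ₑ ∧ (‖a‖ : ℂ) = a := by
  have hs : Summable fun i => ‖f i‖ := h.summable.norm
  have h1 : a = ((∑' i, ‖f i‖ : ℝ) : ℂ) := by
    have h2 := Complex.hasSum_ofReal.2 hs.hasSum
    simp_rw [hf] at h2
    exact h.unique h2
  have h3 : ‖a‖ = ∑' i, ‖f i‖ := by
    rw [h1, Complex.norm_real, Real.norm_of_nonneg (tsum_nonneg fun i => norm_nonneg _)]
  refine ⟨?_, by rw [h3, h1]⟩
  rw [← ofReal_norm, h3, ENNReal.ofReal_tsum_of_nonneg (fun _ => norm_nonneg _) hs]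
  simp_rw [ofReal_norm]

variable {H : Type} [NormedAddCommGroup H] [InnerProductSpace ℂ H]

theorem norm_inner_of_isPositive {T : H →L[ℂ] H} (hT : T.IsPositive) (x : H) :
    (‖⟪x, T x⟫_ℂ‖ : ℂ) = ⟪x, T x⟫_ℂ :=
  RCLike.norm_of_nonneg' (hT.inner_nonneg_right x)

variable [CompleteSpace H]

theorem enorm_opTrace {T : H →L[ℂ] H} (hT : T.IsPositive) (h : IsTraceClass T)
    (e : HilbertBasis ι ℂ H) :
    ‖opTrace T‖ₑ = ∑' i, ‖⟪e i, T (e i)⟫_ℂ‖ₑ ∧ (‖opTrace T‖ : ℂ) = opTrace T :=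
  enorm_eq_tsum_of_hasSum (fun _ => norm_inner_of_isPositive hT _) (h.hasSum e)

theorem isTraceClass_of_tsum_ne_top {T : H →L[ℂ] H} (hT : T.IsPositive) (e : HilbertBasis ι ℂ H)
    (h : ∑' i, ‖⟪e i, T (e i)⟫_ℂ‖ₑ ≠ ⊤) : IsTraceClass T := by
  refine isTraceClass_of_isPositive hT e (Summable.of_norm ?_)
  have h1 := ENNReal.summable_toReal h
  simpa using h1

end PositiveTrace

/-! ### The trace of a positive operator in terms of its Landau blocks -/

section BlockTrace

variable {b : ℝ}

theorem inner_landauProjector_self (n : ℕ) (f : L2 Plane) :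
    ⟪f, landauProjector b n f⟫_ℂ = ((‖landauProjector b n f‖ ^ 2 : ℝ) : ℂ) := by
  have h1 : landauProjector b n (landauProjector b n f) = landauProjector b n f :=
    Submodule.starProjection_eq_self_iff.2 (Submodule.starProjection_apply_mem _ _)
  have h2 : ⟪landauProjector b n f, landauProjector b n f⟫_ℂ = ⟪f, landauProjector b n f⟫_ℂ := by
    conv_rhs => rw [← h1]
    exact Submodule.inner_starProjection_left_eq_right _ _ _
  rw [← h2, inner_self_eq_norm_sq_to_K]
  push_cast
  rfl

/-- The local trace `Tr (1_Q P_n 1_Q)` of the Landau projector. -/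
theorem tsum_enorm_sq_landauProjector_indicatorOp (hb : b ≠ 0) {ι : Type*}
    (p : HilbertBasis ι ℂ (L2 Plane)) (n : ℕ) (Q : Set Plane) (hQ : MeasurableSet Q) :
    ∑' j, ‖landauProjector b n (indicatorOp Q hQ (p j))‖ₑ ^ 2 =
      ENNReal.ofReal (|b| / (2 * Real.pi)) * volume Q := by
  have hadj : (landauProjector b n ∘L indicatorOp Q hQ).adjoint =
      indicatorOp Q hQ ∘L landauProjector b n := by
    symm
    rw [ContinuousLinearMap.eq_adjoint_iff]
    intro f g
    rw [ContinuousLinearMap.comp_apply, indicatorOp_symm, ContinuousLinearMap.comp_apply]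
    exact Submodule.inner_starProjection_left_eq_right _ _ _
  have h1 := tsum_enorm_sq_adjoint (landauProjector b n ∘L indicatorOp Q hQ) p (landauBasis hb)
  rw [hadj] at h1
  simp only [ContinuousLinearMap.comp_apply, landauBasis_apply] at h1
  rw [h1, ENNReal.tsum_prod (f := fun m k =>
    ‖indicatorOp Q hQ (landauProjector b n (landauVec hb m k))‖ₑ ^ 2), tsum_eq_single n]
  · have h2 : ∀ k, ‖indicatorOp Q hQ (landauProjector b n (landauVec hb n k))‖ₑ ^ 2 =
        ∫⁻ y in Q, ENNReal.ofReal (‖landauFun hb n k y‖ ^ 2) := fun k => by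
      rw [landauProjector_landauVec_self, ← ofReal_norm,
        ← ENNReal.ofReal_pow (norm_nonneg _), norm_sq_indicatorOp,
        ofReal_integral_eq_lintegral_ofReal (integrable_norm_sq _).integrableOn
          (Filter.Eventually.of_forall fun _ => by positivity)]
      refine lintegral_congr_ae (ae_restrict_of_ae ?_)
      filter_upwards [toL2_ae (landauFun hb n k)] with y hy
      rw [landauVec, hy]
    simp_rw [h2]
    rw [← lintegral_tsum fun k => by
      have := (landauFun hb n k).continuous
      exact Measurable.aemeasurable (by fun_prop)]
    have h3 : ∀ y, ∑' k, ENNReal.ofReal (‖landauFun hb n k y‖ ^ 2) =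
        ENNReal.ofReal (|b| / (2 * Real.pi)) := fun y => by
      have h4 := hasSum_norm_sq_landauFun hb n y
      rw [← h4.tsum_eq, ENNReal.ofReal_tsum_of_nonneg (fun _ => by positivity) h4.summable]
    simp_rw [h3]
    rw [setLIntegral_const]
  · intro m hm
    simp [landauProjector_landauVec_of_ne hb hm]

theorem indicatorOp_tensor (Q : Set Plane) (hQ : MeasurableSet Q) (J : Set ℝ)
    (hJ : MeasurableSet J) (f : L2 Plane) (g : L2 ℝ) :
    indicatorOp (Q ×ˢ J) (hQ.prod hJ) (tensor f g) =
      tensor (indicatorOp Q hQ f) (indicatorOp J hJ g) := by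
  refine Lp.ext ?_
  filter_upwards [indicatorOp_ae (Q ×ˢ J) (hQ.prod hJ) (tensor f g), tensor_ae f g,
    tensor_ae (indicatorOp Q hQ f) (indicatorOp J hJ g), ae_fst (indicatorOp_ae Q hQ f),
    ae_snd (indicatorOp_ae J hJ g)] with x h1 h2 h3 h4 h5
  rw [h1, h3, h4, h5]
  by_cases hx : x.1 ∈ Q <;> by_cases hx' : x.2 ∈ J <;>
    simp [Set.indicator, Set.mem_prod, hx, hx', h2]

theorem isPositive_levelBlock (hb : b ≠ 0) {γ : L2 Space →L[ℂ] L2 Space} (hpos : γ.IsPositive)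
    (n : ℕ) : (levelBlock hb γ n).IsPositive :=
  hpos.adjoint_conj _

/-- The quadratic form of the operator on `f ⊗ g` is the sum of those of `P_n ⊗ γ_n`. -/
theorem hasSum_inner_tensor {γ : L2 Space →L[ℂ] L2 Space}
    (hγ : ∀ R : Plane, γ ∘L magneticTranslation b R = magneticTranslation b R ∘L γ)
    (hL : CommutesWithLandau b γ) (hb : b ≠ 0) (f : L2 Plane) (g : L2 ℝ) :
    HasSum (fun n => ((‖landauProjector b n f‖ ^ 2 : ℝ) : ℂ) * ⟪g, levelBlock hb γ n g⟫_ℂ)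
      ⟪tensor f g, γ (tensor f g)⟫_ℂ := by
  refine ((hasSum_levelProjector hb (tensor f g)).mapL (innerSL ℂ (tensor f g) ∘L γ)).congr_fun
    fun n => ?_
  rw [ContinuousLinearMap.comp_apply, innerSL_apply_apply, levelProjector_tensor,
    apply_tensor_landauProjector hγ hL hb, inner_tensor, inner_landauProjector_self]

theorem inner_compression {X : Type} [MeasureSpace X] [TopologicalSpace X] [T2Space X]
    [OpensMeasurableSpace X] (K : Set X) (hK : IsCompact K) (T : L2 X →L[ℂ] L2 X) (f : L2 X) :
    ⟪f, compression K hK T f⟫_ℂ =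
      ⟪indicatorOp K hK.measurableSet f, T (indicatorOp K hK.measurableSet f)⟫_ℂ :=
  (indicatorOp_symm K hK.measurableSet _ _).symm

/-- The traces of the localized Landau blocks add up to the trace of the operator localized to a
box `Q × J`. -/
theorem enorm_opTrace_compression_prod {γ : L2 Space →L[ℂ] L2 Space}
    (hγ : ∀ R : Plane, γ ∘L magneticTranslation b R = magneticTranslation b R ∘L γ)
    (hL : CommutesWithLandau b γ) (hb : b ≠ 0) (hpos : γ.IsPositive) (htr : IsLocallyTraceClass γ)
    {κ : Type*} (q : HilbertBasis κ ℂ (L2 ℝ)) {Q : Set Plane} (hQ : IsCompact Q) {J : Set ℝ}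
    (hJ : IsCompact J) :
    ‖opTrace (compression (Q ×ˢ J) (hQ.prod hJ) γ)‖ₑ =
      ∑' n, ENNReal.ofReal (|b| / (2 * Real.pi)) * volume Q *
        ∑' l, ‖⟪q l, compression J hJ (levelBlock hb γ n) (q l)⟫_ℂ‖ₑ := by
  set p := stdBasis (L2 Plane)
  have hterm : ∀ j l, ‖⟪tensor (p j) (q l),
      compression (Q ×ˢ J) (hQ.prod hJ) γ (tensor (p j) (q l))⟫_ℂ‖ₑ =
      ∑' n, ‖landauProjector b n (indicatorOp Q hQ.measurableSet (p j))‖ₑ ^ 2 *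
        ‖⟪q l, compression J hJ (levelBlock hb γ n) (q l)⟫_ℂ‖ₑ := fun j l => by
    rw [inner_compression, indicatorOp_tensor Q hQ.measurableSet J hJ.measurableSet]
    have h := hasSum_inner_tensor hγ hL hb (indicatorOp Q hQ.measurableSet (p j))
      (indicatorOp J hJ.measurableSet (q l))
    rw [(enorm_eq_tsum_of_hasSum (fun n => ?_) h).1]
    · refine tsum_congr fun n => ?_
      rw [enorm_mul, inner_compression]
      congr 1
      rw [← ofReal_norm, Complex.norm_real, Real.norm_of_nonneg (by positivity),
        ENNReal.ofReal_pow (norm_nonneg _), ofReal_norm]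
    · rw [norm_mul, Complex.norm_real, Real.norm_of_nonneg (by positivity), Complex.ofReal_mul,
        norm_inner_of_isPositive (isPositive_levelBlock hb hpos n)]
  rw [(enorm_opTrace (compression_isPositive hpos _ _) (htr _ (hQ.prod hJ)) (tensorBasis p q)).1]
  simp_rw [tensorBasis_apply]
  rw [ENNReal.tsum_prod (f := fun j l => ‖⟪tensor (p j) (q l),
      compression (Q ×ˢ J) (hQ.prod hJ) γ (tensor (p j) (q l))⟫_ℂ‖ₑ)]
  simp_rw [hterm]
  calc _ = ∑' j, ∑' n, ∑' l, ‖landauProjector b n (indicatorOp Q hQ.measurableSet (p j))‖ₑ ^ 2 *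
        ‖⟪q l, compression J hJ (levelBlock hb γ n) (q l)⟫_ℂ‖ₑ :=
        tsum_congr fun j => ENNReal.tsum_comm
    _ = ∑' n, ∑' j, ∑' l, ‖landauProjector b n (indicatorOp Q hQ.measurableSet (p j))‖ₑ ^ 2 *
        ‖⟪q l, compression J hJ (levelBlock hb γ n) (q l)⟫_ℂ‖ₑ := ENNReal.tsum_comm
    _ = _ := by
        refine tsum_congr fun n => ?_
        simp_rw [ENNReal.tsum_mul_left]
        rw [ENNReal.tsum_mul_right, tsum_enorm_sq_landauProjector_indicatorOp hb]

end BlockTrace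

/-! ### Densities of the Landau blocks -/

section BlockDensity

variable {b : ℝ}

/-- The unit square. -/
def unitSquare : Set Plane := Set.Icc 0 1 ×ˢ Set.Icc 0 1

theorem isCompact_unitSquare : IsCompact unitSquare := isCompact_Icc.prod isCompact_Icc

theorem volume_unitSquare : volume unitSquare = 1 := by
  rw [unitSquare, Measure.volume_eq_prod, Measure.prod_prod]
  simp

/-- Each term of the sum in `enorm_opTrace_compression_prod` is finite, as the total is. -/
theorem isLocallyTraceClass_levelBlock {γ : L2 Space →L[ℂ] L2 Space}
    (hγ : ∀ R : Plane, γ ∘L magneticTranslation b R = magneticTranslation b R ∘L γ)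
    (hL : CommutesWithLandau b γ) (hb : b ≠ 0) (hpos : γ.IsPositive) (htr : IsLocallyTraceClass γ)
    (n : ℕ) : IsLocallyTraceClass (levelBlock hb γ n) := by
  intro J hJ
  have hs : 0 < |b| := abs_pos.2 hb
  have h := enorm_opTrace_compression_prod hγ hL hb hpos htr (stdBasis (L2 ℝ))
    isCompact_unitSquare hJ
  rw [volume_unitSquare, mul_one] at h
  refine isTraceClass_of_tsum_ne_top (compression_isPositive (isPositive_levelBlock hb hpos n) _ _)
    (stdBasis (L2 ℝ)) fun htop => ?_
  have h1 := ENNReal.le_tsum (f := fun n => ENNReal.ofReal (|b| / (2 * Real.pi)) *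
    ∑' l, ‖⟪stdBasis (L2 ℝ) l, compression J hJ (levelBlock hb γ n) (stdBasis (L2 ℝ) l)⟫_ℂ‖ₑ) n
  rw [← h, htop, ENNReal.mul_top (by simpa using (by positivity))] at h1
  exact enorm_ne_top (top_le_iff.1 h1)

/-- A function with nonnegative integrals over compact sets is nonnegative almost everywhere, being
the limit of its averages over small intervals. -/
theorem ae_norm_eq_of_setIntegral {ρ : ℝ → ℂ} (hloc : LocallyIntegrable ρ)
    (h : ∀ K : Set ℝ, IsCompact K → (‖∫ x in K, ρ x‖ : ℂ) = ∫ x in K, ρ x) :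
    ∀ᵐ x, (‖ρ x‖ : ℂ) = ρ x := by
  filter_upwards [IsUnifLocDoublingMeasure.ae_tendsto_average volume hloc 1] with x hx
  have h1 := hx (l := nhdsWithin (0 : ℝ) (Set.Ioi 0)) (fun _ => x) id Filter.tendsto_id (by
    filter_upwards [self_mem_nhdsWithin] with δ hδ
    simpa using (Set.mem_Ioi.1 hδ).le)
  have hcl : IsClosed {z : ℂ | (‖z‖ : ℂ) = z} := isClosed_eq (by fun_prop) continuous_id
  refine hcl.mem_of_tendsto h1 (Filter.Eventually.of_forall fun δ => ?_)
  have h2 := h (Metric.closedBall x (id δ)) (isCompact_closedBall x (id δ))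
  rw [Set.mem_ofPred_eq, setAverage_eq, norm_smul, Complex.real_smul, Complex.ofReal_mul, h2,
    Real.norm_of_nonneg (by positivity)]

/-- The fibre integral over the unit square of a function of the third variable. -/
theorem setIntegral_unitSquare_prod (r : ℝ → ℂ) (J : Set ℝ) :
    ∫ x in unitSquare ×ˢ J, r x.2 = ∫ z in J, r z := by
  have h := setIntegral_prod_mul (μ := (volume : Measure Plane)) (ν := (volume : Measure ℝ))
    (fun _ => (1 : ℂ)) r unitSquare J
  rw [← Measure.volume_eq_prod] at h
  simp only [one_mul] at h
  rw [h]
  simp [measureReal_def, volume_unitSquare]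

theorem locallyIntegrable_of_comp_snd {r : ℝ → ℂ}
    (h : LocallyIntegrable (fun x : Space => r x.2)) : LocallyIntegrable r := by
  rw [locallyIntegrable_iff]
  intro J hJ
  have h1 := h.integrableOn_isCompact (isCompact_unitSquare.prod hJ)
  rw [IntegrableOn, Measure.volume_eq_prod, ← Measure.prod_restrict] at h1
  have h2 : (volume.restrict unitSquare : Measure Plane) ≠ 0 := by
    rw [Ne, Measure.restrict_eq_zero, volume_unitSquare]
    exact one_ne_zero
  exact h1.of_comp_snd h2

theorem lintegral_enorm_eq {ρ : ℝ → ℂ} {J : Set ℝ} (hint : IntegrableOn ρ J)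
    (h0 : ∀ᵐ x, (‖ρ x‖ : ℂ) = ρ x) : ∫⁻ x in J, ‖ρ x‖ₑ = ‖∫ x in J, ρ x‖ₑ := by
  have h1 : ∫ x in J, ρ x = ((∫ x in J, ‖ρ x‖ : ℝ) : ℂ) := by
    rw [← integral_complex_ofReal]
    refine integral_congr_ae (ae_restrict_of_ae ?_)
    filter_upwards [h0] with x hx using hx.symm
  rw [h1, ← ofReal_norm, Complex.norm_real, Real.norm_of_nonneg (integral_nonneg fun _ =>
    norm_nonneg _), ofReal_integral_norm_eq_lintegral_enorm hint]

/-- Nonnegative functions whose integrals over compact sets add up, add up almost everywhere. -/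
theorem ae_hasSum_of_lintegral {ρ : ℝ → ℂ} {σ : ℕ → ℝ → ℂ} (hρ : LocallyIntegrable ρ)
    (hσ : ∀ n, LocallyIntegrable (σ n)) (hρ0 : ∀ᵐ x, (‖ρ x‖ : ℂ) = ρ x)
    (hσ0 : ∀ n, ∀ᵐ x, (‖σ n x‖ : ℂ) = σ n x)
    (h : ∀ J : Set ℝ, IsCompact J → ∫⁻ x in J, ‖ρ x‖ₑ = ∑' n, ∫⁻ x in J, ‖σ n x‖ₑ) :
    ∀ᵐ x, HasSum (fun n => σ n x) (ρ x) := by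
  have hm : AEMeasurable fun x => ∑' n, ‖σ n x‖ₑ :=
    AEMeasurable.tsum fun n => (hσ n).aestronglyMeasurable.enorm
  have hS : ∀ J : Set ℝ, IsCompact J →
      ∫⁻ x in J, ∑' n, ‖σ n x‖ₑ = ∫⁻ x in J, ‖ρ x‖ₑ := fun J hJ => by
    rw [h J hJ, lintegral_tsum fun n => (hσ n).aestronglyMeasurable.enorm.restrict]
  have hfin : ∀ J : Set ℝ, IsCompact J → ∫⁻ x in J, ∑' n, ‖σ n x‖ₑ ≠ ⊤ := fun J hJ => by
    rw [hS J hJ]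
    exact (hρ.integrableOn_isCompact hJ).2.ne
  have key : ∀ N : ℕ, ∀ᵐ x ∂(volume.restrict (Metric.closedBall (0 : ℝ) N)),
      HasSum (fun n => σ n x) (ρ x) := fun N => by
    have hN : IsCompact (Metric.closedBall (0 : ℝ) N) := isCompact_closedBall _ _
    have h1 : (fun x => (((∑' n, ‖σ n x‖ₑ).toReal : ℝ) : ℂ))
        =ᵐ[volume.restrict (Metric.closedBall (0 : ℝ) N)] ρ := by
      refine ae_eq_on_of_forall_compact hN
        (integrable_toReal_of_lintegral_ne_top hm.restrict (hfin _ hN)).ofReal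
        (hρ.integrableOn_isCompact hN) fun K hK _ => ?_
      rw [integral_complex_ofReal, integral_toReal hm.restrict
        (ae_lt_top' hm.restrict (hfin K hK)), hS K hK,
        lintegral_enorm_eq (hρ.integrableOn_isCompact hK) hρ0, toReal_enorm]
      have h2 : ∫ x in K, ρ x = ((∫ x in K, ‖ρ x‖ : ℝ) : ℂ) := by
        rw [← integral_complex_ofReal]
        refine integral_congr_ae (ae_restrict_of_ae ?_)
        filter_upwards [hρ0] with x hx using hx.symm
      rw [h2, Complex.norm_real, Real.norm_of_nonneg (integral_nonneg fun _ => norm_nonneg _)]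
    filter_upwards [h1, ae_restrict_of_ae (ae_all_iff.2 hσ0), ae_lt_top' hm.restrict (hfin _ hN)]
      with x h2 h3 h4
    have h5 := Complex.hasSum_ofReal.2 (ENNReal.hasSum_toReal h4.ne)
    simp only [toReal_enorm, h3] at h5
    rw [← h2, ENNReal.tsum_toReal_eq fun n => enorm_ne_top]
    simpa only [toReal_enorm] using h5
  have hU : (⋃ N : ℕ, Metric.closedBall (0 : ℝ) N) = Set.univ := Metric.iUnion_closedBall_nat 0
  have h6 := (ae_restrict_iUnion_iff _ _).2 key
  rwa [hU, Measure.restrict_univ] at h6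

/-- The densities of the Landau blocks of a positive operator add up to its density. -/
theorem exists_density_levelBlock {γ : L2 Space →L[ℂ] L2 Space}
    (hγ : ∀ R : Plane, γ ∘L magneticTranslation b R = magneticTranslation b R ∘L γ)
    (hL : CommutesWithLandau b γ) (hb : b ≠ 0) (hpos : γ.IsPositive) {ρ : ℝ → ℂ}
    (hρ : IsDensity γ fun x => ρ x.2) :
    ∃ ρn : ℕ → ℝ → ℂ, (∀ n, IsDensity (levelBlock hb γ n) (ρn n)) ∧
      ∀ᵐ z : ℝ, HasSum (fun n => ((|b| / (2 * Real.pi) : ℝ) : ℂ) * ρn n z) (ρ z) := by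
  choose ρn hρn using fun n =>
    exists_density (isLocallyTraceClass_levelBlock hγ hL hb hpos hρ.1 n)
  refine ⟨ρn, hρn, ?_⟩
  have hρloc : LocallyIntegrable ρ := locallyIntegrable_of_comp_snd hρ.2.1
  have htr : ∀ (J : Set ℝ) (hJ : IsCompact J),
      opTrace (compression (unitSquare ×ˢ J) (isCompact_unitSquare.prod hJ) γ) = ∫ z in J, ρ z :=
    fun J hJ => (hρ.2.2 _ _).trans (setIntegral_unitSquare_prod ρ J)
  have hρ0 : ∀ᵐ z, (‖ρ z‖ : ℂ) = ρ z := ae_norm_eq_of_setIntegral hρloc fun J hJ => by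
    rw [← htr J hJ]
    exact (enorm_opTrace (compression_isPositive hpos _ _) (hρ.1 _ _) (stdBasis _)).2
  have hρn0 : ∀ n, ∀ᵐ z, (‖ρn n z‖ : ℂ) = ρn n z := fun n =>
    ae_norm_eq_of_setIntegral (hρn n).2.1 fun J hJ => by
      rw [← (hρn n).2.2 J hJ]
      exact (enorm_opTrace (compression_isPositive (isPositive_levelBlock hb hpos n) _ _)
        ((hρn n).1 _ _) (stdBasis _)).2
  have hc : (0 : ℝ) ≤ |b| / (2 * Real.pi) := by positivity
  refine ae_hasSum_of_lintegral hρloc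
    (fun n => (hρn n).2.1.smul ((|b| / (2 * Real.pi) : ℝ) : ℂ)) hρ0 (fun n => ?_) fun J hJ => ?_
  · filter_upwards [hρn0 n] with z hz
    rw [norm_mul, Complex.norm_real, Real.norm_of_nonneg hc, Complex.ofReal_mul, hz]
  · rw [lintegral_enorm_eq (hρloc.integrableOn_isCompact hJ) hρ0, ← htr J hJ,
      enorm_opTrace_compression_prod hγ hL hb hpos hρ.1 (stdBasis (L2 ℝ)) isCompact_unitSquare hJ,
      volume_unitSquare, mul_one]
    refine tsum_congr fun n => ?_
    rw [← (enorm_opTrace (compression_isPositive (isPositive_levelBlock hb hpos n) _ _)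
      ((hρn n).1 J hJ) (stdBasis _)).1, (hρn n).2.2 J hJ,
      ← lintegral_enorm_eq ((hρn n).2.1.integrableOn_isCompact hJ) (hρn0 n),
      ← lintegral_const_mul'' _ (hρn n).2.1.aestronglyMeasurable.enorm.restrict]
    refine lintegral_congr fun z => ?_
    rw [enorm_mul, ← ofReal_norm ((|b| / (2 * Real.pi) : ℝ) : ℂ), Complex.norm_real,
      Real.norm_of_nonneg hc]

end BlockDensity

end MagneticSlab

open MagneticSlab in
theorem mainTheorem2 (b : ℝ) (hb : b ≠ 0) (γ : L2 Space →L[ℂ] L2 Space)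
    (hmag : ∀ R : Plane, γ ∘L magneticTranslation b R = magneticTranslation b R ∘L γ)
    (hlandau : CommutesWithLandau b γ) :
    ∃ γn : ℕ → L2 ℝ →L[ℂ] L2 ℝ,
      (∀ n, ‖γn n‖ ≤ ‖γ‖) ∧
      (∃ T : ℕ → L2 Space →L[ℂ] L2 Space,
        (∀ n, IsTensorOp (landauProjector b n) (γn n) (T n)) ∧
        ∀ f : L2 Space, HasSum (fun n => T n f) (γ f)) ∧
      (IsLocallyTraceClass γ →
        ∃ ρ : ℝ → ℂ, IsDensity γ (fun x => ρ x.2) ∧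
          (γ.IsPositive →
            ∃ ρn : ℕ → ℝ → ℂ, (∀ n, IsDensity (γn n) (ρn n)) ∧
              ∀ᵐ x₃ : ℝ, HasSum (fun n => ((|b| / (2 * Real.pi) : ℝ) : ℂ) * ρn n x₃) (ρ x₃))) := by
  refine ⟨levelBlock hb γ, norm_levelBlock_le hb γ, ⟨fun n => γ ∘L levelProjector hb n,
    fun n f g => ?_, fun f => (hasSum_levelProjector hb f).mapL γ⟩, fun htr => ?_⟩
  · rw [ContinuousLinearMap.comp_apply, levelProjector_tensor,
      apply_tensor_landauProjector hmag hlandau hb]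
  · obtain ⟨ρ, hρ⟩ := exists_density_snd hmag htr
    exact ⟨ρ, hρ, fun hpos => exists_density_levelBlock hmag hlandau hb hpos hρ⟩
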